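/- Work over $\mathbb{C}$. For $n\ge 0$ let $\mathbb{P}_n=\mathbb{P}(\mathcal{O}\oplus\mathcal{O}(n))\to\mathbb{P}^1$. Let $\sigma\in H^0(\mathbb{P}^1,\mathcal{O}(8))$ be a section with $8$ distinct zeros. For a section $s$ of $\mathcal{O}(8)$ let $E_s\subset\mathbb{P}_8$ be the image of the section of $\mathbb{P}_8\to\mathbb{P}^1$ that corresponds to the cokernel of $(\mathrm{id},s):\mathcal{O}\to\mathcal{O}\oplus\mathcal{O}(8)$; so on $\{x\neq\infty\}\subset\mathbb{P}^1$, with affine coordinate $x$ and a suitable affine fibre coordinate $t$ on each $\mathbb{P}_n$, $E_s$ is given by $t+s(x)=0$. Let $\mu:\mathbb{P}_2\to\mathbb{P}_8$ be the Kummer covering of degree $4$ over $\mathbb{P}^1$ that is given by the fourth powers of the homogeneous fibre coordinates, i.e. $(x,t)\mapsto(x,t^4)$. Let $$f=\frac{t^4+\sigma(x)}{t^4}\in\mathbb{C}(\mathbb{P}_2)^{\times},$$ and let $\mathcal{Y}\to\mathbb{P}_2$ be the double covering given by $\sqrt{f}$, i.e. the normalization of $\mathbb{P}_2$ in $\mathbb{C}(\mathbb{P}_2)[w]/(w^2-f)$.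 Let $C$ be the cyclic covering of degree $4$ of $\mathbb{P}^1$ given by $y^4=\sigma(x)$ (branched at the $8$ zeros of $\sigma$), and let $\mathbb{E}$ be the elliptic curve given by $y^4=x(x-1)^2$; both are taken as the normalizations of $\mathbb{P}^1$ in the corresponding extensions of its function field. Let $\xi$ be a primitive fourth root of unity, let $\gamma_1$ and $\gamma_2$ be the automorphisms $(x,y)\mapsto(x,\xi y)$ of $C$ and $\mathbb{E}$, and let $C\times\mathbb{E}/\langle(1,1)\rangle$ be the quotient of $C\times\mathbb{E}$ by the group generated by $(\gamma_1,\gamma_2)$. Then $\operatorname{div}(f)=\mu^*E_\sigma-\mu^*E_0$, where $\mu^*E_0$ is four times the curve $\{t=0\}$ (so that $\mathcal{Y}$ is the double covering of $\mathbb{P}_2$ ramified along $\mu^*E_\sigma$), and $\mathcal{Y}$ is birationally equivalent over $\mathbb{C}$ to $C\times\mathbb{E}/\langle(1,1)\rangle$. -/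

import Mathlib

noncomputable section
namespace KummerK3
open CategoryTheory CategoryTheory.Limits AlgebraicGeometry

theorem isIntegral_of_cover {X U V : Scheme.{0}} (i : U ⟶ X) (j : V ⟶ X) [IsOpenImmersion i]
    [IsOpenImmersion j] [IsIntegral U] [IsIntegral V]
    (hc : ∀ x, (∃ y, i y = x) ∨ ∃ y, j y = x) (hm : ∃ a b, i a = j b) : IsIntegral X := by
  have hi : IsIrreducible (Set.range i) := by
    rw [← Set.image_univ]
    exact (IrreducibleSpace.isIrreducible_univ U).image _ i.continuous.continuousOn
  have hj : IsIrreducible (Set.range j) := by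
    rw [← Set.image_univ]
    exact (IrreducibleSpace.isIrreducible_univ V).image _ j.continuous.continuousOn
  have : IrreducibleSpace X := by
    rw [irreducibleSpace_def]
    convert! hi.closure
    refine (Set.eq_univ_of_forall fun x ↦ ?_).symm
    obtain (hx | hx) := hc x
    · exact subset_closure hx
    · obtain ⟨a, b, hab⟩ := hm
      exact closure_mono Set.inter_subset_right
        (subset_closure_inter_of_isPreirreducible_of_isOpen hj.2
          i.isOpenEmbedding.isOpen_range ⟨_, ⟨b, rfl⟩, ⟨a, hab⟩⟩ hx)
  have : IsReduced X := by
    have h (x : X) : _root_.IsReduced (X.presheaf.stalk x) := by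
      obtain (⟨y, rfl⟩ | ⟨y, rfl⟩) := hc x
      · exact isReduced_of_injective (i.stalkMap y).hom
          (asIso (i.stalkMap y)).commRingCatIsoToRingEquiv.injective
      · exact isReduced_of_injective (j.stalkMap y).hom
          (asIso (j.stalkMap y)).commRingCatIsoToRingEquiv.injective
    exact isReduced_of_isReduced_stalk X
  exact isIntegral_of_irreducibleSpace_of_isReduced X

section P1
open Polynomial LaurentPolynomial
variable (R : Type) [CommRing R]

/-- The unit `t ^ n` of `R[t, t⁻¹]`. -/
def tUnit (n : ℤ) : R[T;T⁻¹]ˣ where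
  val := T n
  inv := T (-n)
  val_inv := by rw [← T_add]; simp
  inv_val := by rw [← T_add]; simp

/-- The open immersion `Spec R[t, t⁻¹] ⟶ Spec R[t]`. -/
def gm₀ : Spec (.of R[T;T⁻¹]) ⟶ Spec (.of R[X]) :=
  Spec.map (CommRingCat.ofHom (toLaurent : R[X] →+* R[T;T⁻¹]))

/-- The open immersion `Spec R[t, t⁻¹] ⟶ Spec R[s]`, `s = t⁻¹`. -/
def gm₁ : Spec (.of R[T;T⁻¹]) ⟶ Spec (.of R[X]) :=
  Spec.map (CommRingCat.ofHom (eval₂RingHom LaurentPolynomial.C (T (-1))))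

instance : IsOpenImmersion (gm₀ R) :=
  IsOpenImmersion.of_isLocalization (R := R[X]) (S := R[T;T⁻¹]) (X : R[X])

theorem range_gm₀ : Set.range (gm₀ R) =
    {p : Spec (.of R[X]) | (X : R[X]) ∉ p.asIdeal} :=
  PrimeSpectrum.localization_away_comap_range R[T;T⁻¹] (X : R[X])

instance : IsOpenImmersion (gm₁ R) := by
  let e : CommRingCat.of R[T;T⁻¹] ≅ CommRingCat.of R[T;T⁻¹] :=
    (invert (R := R)).toRingEquiv.toCommRingCatIso
  have : gm₁ R = Spec.map e.hom ≫ gm₀ R := by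
    simp only [gm₁, gm₀, ← Spec.map_comp]
    congr 1
    ext x
    · simp [e]
    · simp [e]
  rw [this]
  infer_instance

/-- The projective line over `R`, glued from `Spec R[t]` and `Spec R[s]` along `s = t⁻¹`. -/
def P1 : Scheme.{0} := pushout (gm₀ R) (gm₁ R)

namespace P1

/-- The chart `Spec R[t]`. -/
def ι₀ : Spec (.of R[X]) ⟶ P1 R := pushout.inl _ _

/-- The chart `Spec R[s]`, `s = t⁻¹`. -/
def ι₁ : Spec (.of R[X]) ⟶ P1 R := pushout.inr _ _

instance : IsOpenImmersion (ι₀ R) :=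
  inferInstanceAs (IsOpenImmersion (colimit.ι (span (gm₀ R) (gm₁ R)) WalkingSpan.left))

instance : IsOpenImmersion (ι₁ R) :=
  inferInstanceAs (IsOpenImmersion (colimit.ι (span (gm₀ R) (gm₁ R)) WalkingSpan.right))

theorem glue : gm₀ R ≫ ι₀ R = gm₁ R ≫ ι₁ R := pushout.condition

/-- The structure morphism of the projective line. -/
def str : P1 R ⟶ Spec (.of R) :=
  pushout.desc (Spec.map (CommRingCat.ofHom Polynomial.C)) (Spec.map (CommRingCat.ofHom Polynomial.C)) (by
    simp only [gm₀, gm₁, ← Spec.map_comp, ← CommRingCat.ofHom_comp]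
    congr 2
    ext x
    simp)

theorem ι₀_str : ι₀ R ≫ str R = Spec.map (CommRingCat.ofHom Polynomial.C) :=
  pushout.inl_desc _ _ _

theorem ι₁_str : ι₁ R ≫ str R = Spec.map (CommRingCat.ofHom Polynomial.C) :=
  pushout.inr_desc _ _ _

variable {R} {S : Type} [CommRing S]

/-- The ring homomorphism `R[t] ⟶ S[t]` given by `φ` on coefficients and by `t ↦ u * t ^ k`. -/
def coordMap (φ : R →+* S) (u : Sˣ) (k : ℕ) : R[X] →+* S[X] :=
  eval₂RingHom (Polynomial.C.comp φ) (Polynomial.C (u : S) * X ^ k)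

/-- The morphism `P1 S ⟶ P1 R` given by `φ` on the base and by `t ↦ u * t ^ k` on the fibres
(so by `s ↦ u⁻¹ * s ^ k` in the coordinate `s = t⁻¹`). -/
def map (φ : R →+* S) (u : Sˣ) (k : ℕ) : P1 S ⟶ P1 R :=
  pushout.map _ _ _ _ (Spec.map (CommRingCat.ofHom (coordMap φ u k)))
    (Spec.map (CommRingCat.ofHom (coordMap φ u⁻¹ k)))
    (Spec.map (CommRingCat.ofHom (LaurentPolynomial.eval₂ (LaurentPolynomial.C.comp φ)
      (Units.map (LaurentPolynomial.C : S →+* S[T;T⁻¹]).toMonoidHom u * tUnit S 1 ^ k))))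
    (by
      simp only [gm₀, ← Spec.map_comp, ← CommRingCat.ofHom_comp]
      congr 2
      ext x
      · simp [coordMap]
      · simp [coordMap, tUnit])
    (by
      simp only [gm₁, ← Spec.map_comp, ← CommRingCat.ofHom_comp]
      congr 2
      ext x
      · simp [coordMap]
      · simp [coordMap, tUnit, T_pow])


theorem exists_chart (x : P1 R) : (∃ y, ι₀ R y = x) ∨ ∃ y, ι₁ R y = x := by
  obtain ⟨i, y, hy⟩ := Scheme.IsLocallyDirected.ι_jointly_surjective (span (gm₀ R) (gm₁ R)) x
  obtain (_ | _ | _) := i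
  · refine .inl ⟨gm₀ R y, ?_⟩
    have h := colimit.w (span (gm₀ R) (gm₁ R)) WalkingSpan.Hom.fst
    exact (congr($h y)).trans hy
  · exact .inl ⟨y, hy⟩
  · exact .inr ⟨y, hy⟩

theorem ι₀_eq_ι₁ {a b : Spec (.of R[X])} (h : ι₀ R a = ι₁ R b) :
    ∃ c, gm₀ R c = a ∧ gm₁ R c = b := by
  obtain ⟨k, fi, fj, x, h₁, h₂⟩ := (Scheme.IsLocallyDirected.ι_eq_ι_iff (span (gm₀ R) (gm₁ R))
    (i := WalkingSpan.left) (j := WalkingSpan.right)).mp h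
  obtain (_ | _ | _) := k
  · obtain rfl : fi = WalkingSpan.Hom.fst := Subsingleton.elim _ _
    obtain rfl : fj = WalkingSpan.Hom.snd := Subsingleton.elim _ _
    exact ⟨x, h₁, h₂⟩
  · exact nomatch fj
  · exact nomatch fi

theorem ι₀_map (φ : R →+* S) (u : Sˣ) (k : ℕ) :
    ι₀ S ≫ map φ u k = Spec.map (CommRingCat.ofHom (coordMap φ u k)) ≫ ι₀ R :=
  pushout.inl_desc _ _ _

theorem ι₁_map (φ : R →+* S) (u : Sˣ) (k : ℕ) :
    ι₁ S ≫ map φ u k = Spec.map (CommRingCat.ofHom (coordMap φ u⁻¹ k)) ≫ ι₁ R :=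
  pushout.inr_desc _ _ _

theorem hom_ext {Y : Scheme.{0}} {f g : P1 R ⟶ Y} (h₀ : ι₀ R ≫ f = ι₀ R ≫ g)
    (h₁ : ι₁ R ≫ f = ι₁ R ≫ g) : f = g :=
  pushout.hom_ext h₀ h₁

theorem isOpenImmersion_coordMap (φ : R →+* S) [IsOpenImmersion (Spec.map (CommRingCat.ofHom φ))]
    (u : Sˣ) : IsOpenImmersion (Spec.map (CommRingCat.ofHom (coordMap φ u 1))) := by
  let := φ.toAlgebra
  let := Polynomial.algebra R S
  have h := isPullback_SpecMap_of_isPushout _ _ _ _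
    (CommRingCat.isPushout_of_isPushout R S R[X] S[X])
  have h1 : IsOpenImmersion (Spec.map (CommRingCat.ofHom (algebraMap R[X] S[X]))) :=
    MorphismProperty.of_isPullback (P := @IsOpenImmersion) h ‹_›
  let e : S[X] ≃+* S[X] := RingEquiv.ofRingHom (coordMap (RingHom.id S) u 1)
    (coordMap (RingHom.id S) u⁻¹ 1) (by ext x <;> simp [coordMap, ← mul_assoc, ← map_mul])
    (by ext x <;> simp [coordMap, ← mul_assoc, ← map_mul])
  have : Spec.map (CommRingCat.ofHom (coordMap φ u 1)) = Spec.map e.toCommRingCatIso.hom ≫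
      Spec.map (CommRingCat.ofHom (algebraMap R[X] S[X])) := by
    rw [← Spec.map_comp]
    congr 1
    ext x <;> simp [coordMap, e] <;> rfl
  rw [this]
  infer_instance

theorem isOpenImmersion_map (φ : R →+* S) [IsOpenImmersion (Spec.map (CommRingCat.ofHom φ))]
    (u : Sˣ) : IsOpenImmersion (map φ u 1) := by
  have h₀ : IsOpenImmersion (ι₀ S ≫ map φ u 1) := by
    have := isOpenImmersion_coordMap φ u
    rw [ι₀_map]; infer_instance
  have h₁ : IsOpenImmersion (ι₁ S ≫ map φ u 1) := by
    have := isOpenImmersion_coordMap φ u⁻¹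
    rw [ι₁_map]; infer_instance
  have key (a b : Spec (.of S[X])) (h : map φ u 1 (ι₀ S a) = map φ u 1 (ι₁ S b)) :
      ι₀ S a = ι₁ S b := by
    have h' := h
    simp only [← Scheme.Hom.comp_apply] at h'
    rw [ι₀_map, ι₁_map] at h'
    simp only [Scheme.Hom.comp_apply] at h'
    obtain ⟨c, hc, -⟩ := ι₀_eq_ι₁ h'
    have ha : a ∈ Set.range (gm₀ S) := by
      rw [range_gm₀]
      have : (X : R[X]) ∉ (Spec.map (CommRingCat.ofHom (coordMap φ u 1)) a).asIdeal := by
        rw [← hc]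
        exact (range_gm₀ R).le ⟨c, rfl⟩
      intro hX
      refine this ?_
      change coordMap φ u 1 X ∈ a.asIdeal
      simpa [coordMap] using hX
    obtain ⟨a, rfl⟩ := ha
    have hg : ι₀ S (gm₀ S a) = ι₁ S (gm₁ S a) := congr($(glue S) a)
    rw [hg] at h ⊢
    exact congr(ι₁ S $((ι₁ S ≫ map φ u 1).isOpenEmbedding.injective (by simpa using h)))
  refine IsOpenImmersion.of_forall_source_exists _ ?_ ?_
  · intro x y h
    obtain (⟨a, rfl⟩ | ⟨a, rfl⟩) := exists_chart x <;>
    obtain (⟨b, rfl⟩ | ⟨b, rfl⟩) := exists_chart y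
    · exact congr(ι₀ S $((ι₀ S ≫ map φ u 1).isOpenEmbedding.injective (by simpa using h)))
    · exact key _ _ h
    · exact (key _ _ h.symm).symm
    · exact congr(ι₁ S $((ι₁ S ≫ map φ u 1).isOpenEmbedding.injective (by simpa using h)))
  · intro x
    obtain (⟨a, rfl⟩ | ⟨a, rfl⟩) := exists_chart x
    · exact ⟨_, ι₀ S, inferInstance, ⟨a, rfl⟩, h₀⟩
    · exact ⟨_, ι₁ S, inferInstance, ⟨a, rfl⟩, h₁⟩

theorem map_comp {A : Type} [CommRing A] (φ : R →+* S) (u : Sˣ) (k : ℕ) (ψ : S →+* A) (v : Aˣ)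
    (l : ℕ) : map ψ v l ≫ map φ u k =
      map (ψ.comp φ) (Units.map ψ.toMonoidHom u * v ^ k) (k * l) := by
  refine hom_ext ?_ ?_
  · rw [reassoc_of% (ι₀_map), ι₀_map, ι₀_map, ← Spec.map_comp_assoc, ← CommRingCat.ofHom_comp]
    congr 3
    ext x
    · simp [coordMap]
    · simp [coordMap, mul_pow, ← pow_mul, mul_comm l k, mul_assoc]
  · rw [reassoc_of% (ι₁_map), ι₁_map, ι₁_map, ← Spec.map_comp_assoc, ← CommRingCat.ofHom_comp]
    congr 3
    refine Polynomial.ringHom_ext (fun x ↦ by simp [coordMap]) ?_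
    simp [coordMap, mul_pow, ← pow_mul, mul_comm l k]
    ring

theorem map_str (φ : R →+* S) (u : Sˣ) (k : ℕ) :
    map φ u k ≫ str R = str S ≫ Spec.map (CommRingCat.ofHom φ) := by
  refine hom_ext ?_ ?_
  · rw [reassoc_of% (ι₀_map), ι₀_str, reassoc_of% (ι₀_str), ← Spec.map_comp, ← Spec.map_comp]
    congr 1
    ext x
    simp [coordMap]
  · rw [reassoc_of% (ι₁_map), ι₁_str, reassoc_of% (ι₁_str), ← Spec.map_comp, ← Spec.map_comp]
    congr 1
    ext x
    simp [coordMap]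

instance [IsDomain R] : IsIntegral (P1 R) :=
  isIntegral_of_cover (ι₀ R) (ι₁ R) exists_chart
    (by
      obtain ⟨x⟩ : Nonempty (Spec (.of R[T;T⁻¹])) := inferInstance
      exact ⟨_, _, congr($(glue R) x)⟩)

end P1
end P1

section Hirzebruch
open Polynomial LaurentPolynomial

/-- The ring homomorphism `ℂ[x'] ⟶ ℂ[x, x⁻¹]`, `x' ↦ x⁻¹`. -/
def invX : ℂ[X] →+* ℂ[T;T⁻¹] := eval₂RingHom LaurentPolynomial.C (T (-1))

/-- The part of `ℙ(𝒪 ⊕ 𝒪(n))` over `ℂ[x, x⁻¹]`, embedded in the part over `ℂ[x]`. -/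
def hirzGlue₀ : P1 ℂ[T;T⁻¹] ⟶ P1 ℂ[X] := P1.map toLaurent 1 1

/-- The part of `ℙ(𝒪 ⊕ 𝒪(n))` over `ℂ[x, x⁻¹]`, embedded in the part over `ℂ[x']`, `x' = x⁻¹`;
the fibre coordinates satisfy `t' = x ^ (-n) * t`. -/
def hirzGlue₁ (n : ℕ) : P1 ℂ[T;T⁻¹] ⟶ P1 ℂ[X] := P1.map invX (tUnit ℂ (-n)) 1

instance : IsOpenImmersion hirzGlue₀ :=
  have : IsOpenImmersion (Spec.map (CommRingCat.ofHom (toLaurent : ℂ[X] →+* ℂ[T;T⁻¹]))) :=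
    inferInstanceAs (IsOpenImmersion (gm₀ ℂ))
  P1.isOpenImmersion_map _ _

instance (n : ℕ) : IsOpenImmersion (hirzGlue₁ n) :=
  have : IsOpenImmersion (Spec.map (CommRingCat.ofHom invX)) :=
    inferInstanceAs (IsOpenImmersion (gm₁ ℂ))
  P1.isOpenImmersion_map _ _

/-- The ruled surface `ℙ(𝒪 ⊕ 𝒪(n)) = Proj Sym (𝒪 ⊕ 𝒪(n))` over the complex projective line with
homogeneous coordinates `x₀, x₁`. With `x = x₁ / x₀`, the sheaf `𝒪(n)` is generated by `x₀ ^ n` over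
`Spec ℂ[x]` and by `x₁ ^ n = x ^ n * x₀ ^ n` over `Spec ℂ[x⁻¹]`. If `y₁, y₂` denote the homogeneous
fibre coordinates given by `1 ∈ 𝒪` and by the generator of `𝒪(n)`, then the affine fibre coordinate
`t = y₁ / y₂` changes by `t' = x ^ (-n) * t`. -/
def Hirz (n : ℕ) : Scheme.{0} := pushout hirzGlue₀ (hirzGlue₁ n)

namespace Hirz

/-- The part over `Spec ℂ[x]`. -/
def j₀ (n : ℕ) : P1 ℂ[X] ⟶ Hirz n := pushout.inl _ _

/-- The part over `Spec ℂ[x⁻¹]`. -/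
def j₁ (n : ℕ) : P1 ℂ[X] ⟶ Hirz n := pushout.inr _ _

instance (n : ℕ) : IsOpenImmersion (j₀ n) :=
  inferInstanceAs (IsOpenImmersion (colimit.ι (span hirzGlue₀ (hirzGlue₁ n)) WalkingSpan.left))

instance (n : ℕ) : IsOpenImmersion (j₁ n) :=
  inferInstanceAs (IsOpenImmersion (colimit.ι (span hirzGlue₀ (hirzGlue₁ n)) WalkingSpan.right))

theorem glue (n : ℕ) : hirzGlue₀ ≫ j₀ n = hirzGlue₁ n ≫ j₁ n := pushout.condition

theorem exists_chart {n : ℕ} (x : Hirz n) : (∃ y, j₀ n y = x) ∨ ∃ y, j₁ n y = x := by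
  obtain ⟨i, y, hy⟩ :=
    Scheme.IsLocallyDirected.ι_jointly_surjective (span hirzGlue₀ (hirzGlue₁ n)) x
  obtain (_ | _ | _) := i
  · refine .inl ⟨hirzGlue₀ y, ?_⟩
    have h := colimit.w (span hirzGlue₀ (hirzGlue₁ n)) WalkingSpan.Hom.fst
    exact (congr($h y)).trans hy
  · exact .inl ⟨y, hy⟩
  · exact .inr ⟨y, hy⟩

instance (n : ℕ) : IsIntegral (Hirz n) :=
  isIntegral_of_cover (j₀ n) (j₁ n) exists_chart
    (by
      obtain ⟨x⟩ : Nonempty (P1 ℂ[T;T⁻¹]) := inferInstance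
      exact ⟨_, _, congr($(glue n) x)⟩)

/-- The projection of `ℙ(𝒪 ⊕ 𝒪(n))` onto the projective line. -/
def proj (n : ℕ) : Hirz n ⟶ P1 ℂ :=
  pushout.desc (P1.str ℂ[X] ≫ P1.ι₀ ℂ) (P1.str ℂ[X] ≫ P1.ι₁ ℂ) (by
    simp only [hirzGlue₀, hirzGlue₁, reassoc_of% (P1.map_str)]
    exact congr(P1.str _ ≫ $(P1.glue ℂ)))

/-- The morphism `ℙ(𝒪 ⊕ 𝒪(n)) ⟶ ℙ(𝒪 ⊕ 𝒪(k * n))` over the projective line which is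
`(y₁ : y₂) ↦ (y₁ ^ k : y₂ ^ k)` on the fibres. -/
def mu (n k : ℕ) : Hirz n ⟶ Hirz (k * n) :=
  pushout.map _ _ _ _ (P1.map (RingHom.id _) 1 k) (P1.map (RingHom.id _) 1 k)
    (P1.map (RingHom.id _) 1 k)
    (by
      simp only [hirzGlue₀, P1.map_comp]
      simp)
    (by
      simp only [hirzGlue₁, P1.map_comp]
      congr 1
      · ext <;> simp [tUnit, T_pow]
      · simp)

/-- The dehomogenization `σ(1, x)` of a form `σ(x₀, x₁)`. -/
def dehom₀ (σ : MvPolynomial (Fin 2) ℂ) : ℂ[X] := MvPolynomial.aeval ![1, X] σ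

/-- The dehomogenization `σ(x', 1)` of a form `σ(x₀, x₁)`. -/
def dehom₁ (σ : MvPolynomial (Fin 2) ℂ) : ℂ[X] := MvPolynomial.aeval ![X, 1] σ

theorem invX_dehom₁ {n : ℕ} {σ : MvPolynomial (Fin 2) ℂ} (hσ : σ.IsHomogeneous n) :
    invX (dehom₁ σ) = T (-n) * toLaurent (dehom₀ σ) := by
  have h₁ : invX (dehom₁ σ) =
      MvPolynomial.eval₂ (LaurentPolynomial.C : ℂ →+* ℂ[T;T⁻¹]) ![T (-1), 1] σ := by
    rw [dehom₁, MvPolynomial.aeval_def, MvPolynomial.hom_eval₂]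
    congr 1
    · ext x; simp [invX]
    · funext i; fin_cases i <;> simp [invX]
  have h₀ : toLaurent (dehom₀ σ) =
      MvPolynomial.eval₂ (LaurentPolynomial.C : ℂ →+* ℂ[T;T⁻¹]) ![1, T 1] σ := by
    rw [dehom₀, MvPolynomial.aeval_def, MvPolynomial.hom_eval₂]
    congr 1
    · ext x; simp
    · funext i; fin_cases i <;> simp
  rw [h₁, h₀, MvPolynomial.eval₂_eq', MvPolynomial.eval₂_eq', Finset.mul_sum]
  refine Finset.sum_congr rfl fun d hd ↦ ?_
  have hn : d 0 + d 1 = n := by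
    have := hσ (MvPolynomial.mem_support_iff.mp hd)
    rwa [Finsupp.weight_apply, Finsupp.sum_fintype _ _ (by simp), Fin.sum_univ_two,
      Pi.one_apply, Pi.one_apply, smul_eq_mul, smul_eq_mul, mul_one, mul_one] at this
  simp only [Fin.prod_univ_two, Matrix.cons_val_zero, Matrix.cons_val_one, one_pow, mul_one,
    one_mul, T_pow]
  rw [mul_left_comm, ← T_add]
  congr 2
  lia

/-- The section `E_σ` of `ℙ(𝒪 ⊕ 𝒪(n))` given by `id ⊕ σ : 𝒪 ⟶ 𝒪 ⊕ 𝒪(n)`, that is, by the quotient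
`𝒪 ⊕ 𝒪(n) ⟶ 𝒪(n)`, `(a, b) ↦ b - σ * a`, onto its cokernel. It maps `1 ∈ 𝒪` to `-σ`, so that it is
`t = y₁ / y₂ = -σ(1, x)` over `Spec ℂ[x]`. The section `E_0` is the case `σ = 0`. -/
def sectionE {n : ℕ} (σ : MvPolynomial (Fin 2) ℂ) (hσ : σ.IsHomogeneous n) : P1 ℂ ⟶ Hirz n :=
  pushout.desc
    (Spec.map (CommRingCat.ofHom (evalRingHom (-dehom₀ σ))) ≫ P1.ι₀ ℂ[X] ≫ j₀ n)
    (Spec.map (CommRingCat.ofHom (evalRingHom (-dehom₁ σ))) ≫ P1.ι₀ ℂ[X] ≫ j₁ n) (by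
    have h₀ : gm₀ ℂ ≫ Spec.map (CommRingCat.ofHom (evalRingHom (-dehom₀ σ))) =
        Spec.map (CommRingCat.ofHom (evalRingHom (-toLaurent (dehom₀ σ)))) ≫
          Spec.map (CommRingCat.ofHom (P1.coordMap toLaurent 1 1)) := by
      simp only [gm₀, ← Spec.map_comp, ← CommRingCat.ofHom_comp]
      congr 2
      ext x <;> simp [P1.coordMap]
    have h₁ : gm₁ ℂ ≫ Spec.map (CommRingCat.ofHom (evalRingHom (-dehom₁ σ))) =
        Spec.map (CommRingCat.ofHom (evalRingHom (-toLaurent (dehom₀ σ)))) ≫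
          Spec.map (CommRingCat.ofHom (P1.coordMap invX (tUnit ℂ (-n)) 1)) := by
      simp only [gm₁, ← Spec.map_comp, ← CommRingCat.ofHom_comp]
      congr 2
      refine Polynomial.ringHom_ext (fun x ↦ by simp [P1.coordMap, invX]) ?_
      simpa [P1.coordMap, tUnit, invX] using invX_dehom₁ hσ
    rw [reassoc_of% h₀, reassoc_of% h₁, ← reassoc_of% (P1.ι₀_map), ← reassoc_of% (P1.ι₀_map)]
    exact congr(_ ≫ _ ≫ $(glue n)))

end Hirz
end Hirzebruch

section Kummer
open Polynomial

/-- An affine open chart of an integral scheme embeds its coordinate ring in the function field. -/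
def chartToFunctionField {Y : Scheme.{0}} [IsIntegral Y] {R : CommRingCat.{0}} [Nonempty (Spec R)]
    (i : Spec R ⟶ Y) [IsOpenImmersion i] : R →+* Y.functionField :=
  haveI : Nonempty (i ''ᵁ ⊤ : Y.Opens) :=
    let ⟨x⟩ : Nonempty (Spec R) := inferInstance
    ⟨⟨i x, x, trivial, rfl⟩⟩
  ((Scheme.ΓSpecIso R).inv ≫ (i.appIso ⊤).inv ≫ Y.germToFunctionField (i ''ᵁ ⊤)).hom

variable {Y : Scheme.{0}} [IsIntegral Y] (n : ℕ) (f : Y.functionField)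

/-- `K(Y)[w] / (w ^ n - f)`. -/
abbrev KummerAlgebra : Type := AdjoinRoot (X ^ n - C f : Y.functionField[X])

/-- The morphism `Spec K(Y)[w] / (w ^ n - f) ⟶ Spec K(Y) ⟶ Y` onto the generic point. -/
def kummerGeneric : Spec (.of (KummerAlgebra n f)) ⟶ Y :=
  Spec.map (CommRingCat.ofHom (AdjoinRoot.of (X ^ n - C f : Y.functionField[X]))) ≫
    Y.fromSpecStalk (genericPoint Y)

instance : QuasiCompact (kummerGeneric n f) := by unfold kummerGeneric; infer_instance
instance : QuasiSeparated (kummerGeneric n f) := by unfold kummerGeneric; infer_instance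

/-- The Kummer covering of `Y` given by the `n`-th root of the rational function `f`: the
normalization of `Y` in `K(Y)[w] / (w ^ n - f)`. -/
abbrev kummerCover : Scheme.{0} := (kummerGeneric n f).normalization

/-- The covering map. -/
abbrev kummerCover.π : kummerCover n f ⟶ Y := (kummerGeneric n f).fromNormalization

instance : IsIntegralHom (kummerCover.π n f) :=
  inferInstanceAs (IsIntegralHom (kummerGeneric n f).fromNormalization)

/-- The endomorphism `w ↦ ζ * w` of `K(Y)[w] / (w ^ n - f)`. -/
def kummerAlgebraRot (ζ : Y.functionField) (hζ : ζ ^ n = 1) :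
    KummerAlgebra n f →+* KummerAlgebra n f :=
  AdjoinRoot.lift (AdjoinRoot.of _) (AdjoinRoot.of _ ζ * AdjoinRoot.root _) (by
    have h := AdjoinRoot.eval₂_root (X ^ n - C f : Y.functionField[X])
    simp only [eval₂_sub, eval₂_X_pow, eval₂_C, mul_pow, ← map_pow, hζ, map_one, one_mul] at h ⊢
    exact h)

/-- The automorphism `w ↦ ζ * w` of the Kummer covering. -/
def kummerCover.rot (ζ : Y.functionField) (hζ : ζ ^ n = 1) : kummerCover n f ⟶ kummerCover n f :=
  (kummerGeneric n f).normalizationDesc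
    (Spec.map (CommRingCat.ofHom (kummerAlgebraRot n f ζ hζ)) ≫
      (kummerGeneric n f).toNormalization)
    (kummerGeneric n f).fromNormalization (by
      rw [Category.assoc, Scheme.Hom.toNormalization_fromNormalization, kummerGeneric,
        ← Spec.map_comp_assoc, ← CommRingCat.ofHom_comp]
      congr 3
      ext x
      simp [kummerAlgebraRot])

theorem kummerCover.rot_π (ζ : Y.functionField) (hζ : ζ ^ n = 1) :
    kummerCover.rot n f ζ hζ ≫ kummerCover.π n f = kummerCover.π n f :=
  Scheme.Hom.normalizationDesc_comp ..

/-- The Cartier divisor of the rational function `f` is the difference of the divisors cut out by the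
ideal sheaves `I` and `J`: locally `f * J = I`. -/
def HasDivisor (f : Y.functionField) (I J : Y.IdealSheafData) : Prop :=
  ∀ y : Y, ∃ (U : Y.affineOpens) (hy : y ∈ U.1),
    haveI : Nonempty U.1 := ⟨⟨y, hy⟩⟩
    (fun a ↦ f * (Y.germToFunctionField U.1).hom a) '' (J.ideal U : Set Γ(Y, U.1)) =
      (Y.germToFunctionField U.1).hom '' (I.ideal U : Set Γ(Y, U.1))

end Kummer

section Quotient

theorem isLocalization_eqLocus {A A' : Type} [CommRing A] [CommRing A'] [Algebra A A'] (a : A)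
    [IsLocalization.Away a A'] (s : A →+* A) (s' : A' →+* A')
    (hs : ∀ x, s' (algebraMap A A' x) = algebraMap A A' (s x)) (ha : s a = a)
    (ρ : s.eqLocus (RingHom.id A) →+* s'.eqLocus (RingHom.id A'))
    (hρ : ∀ x, (ρ x : A') = algebraMap A A' x) :
    letI := ρ.toAlgebra
    IsLocalization.Away (⟨a, ha⟩ : s.eqLocus (RingHom.id A)) (s'.eqLocus (RingHom.id A')) := by
  let := ρ.toAlgebra
  have hu : IsUnit (algebraMap A A' a) := IsLocalization.Away.algebraMap_isUnit a
  have hn (n : ℕ) : s (a ^ n) = a ^ n := by rw [map_pow, ha]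
  refine IsLocalization.Away.mk _ ?_ ?_ ?_
  · obtain ⟨v, hv⟩ := hu.exists_left_inv
    refine .of_mul_eq_one ⟨v, ?_⟩ (Subtype.ext ?_)
    · change s' v = v
      refine hu.mul_right_cancel ?_
      conv_lhs => rw [← ha, ← hs, ← map_mul, hv, map_one]
      exact hv.symm
    · change (ρ ⟨a, ha⟩ : A') * v = 1
      rw [hρ, mul_comm]
      exact hv
  · rintro ⟨z, hz⟩
    change s' z = z at hz
    obtain ⟨n, b, hb⟩ := IsLocalization.Away.surj a z
    have h : algebraMap A A' (s b) = algebraMap A A' b := by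
      rw [← hs, ← hb, map_mul, map_pow, hs, ha, hz]
    obtain ⟨m, hm⟩ := IsLocalization.Away.exists_of_eq a h
    refine ⟨m + n, ⟨a ^ m * b, ?_⟩, Subtype.ext ?_⟩
    · change s (a ^ m * b) = a ^ m * b
      rw [map_mul, hn, hm]
    · change z * (ρ ⟨a, ha⟩ : A') ^ (m + n) = ρ _
      rw [hρ, hρ, map_mul, ← hb, map_pow]
      ring
  · intro x y hxy
    have h : algebraMap A A' x = algebraMap A A' y := by
      rw [← hρ, ← hρ]
      exact congrArg Subtype.val hxy
    obtain ⟨m, hm⟩ := IsLocalization.Away.exists_of_eq a h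
    exact ⟨m, Subtype.ext hm⟩

variable {Z B : Scheme.{0}} (p : Z ⟶ B) (g : Z ⟶ Z) (hg : g ≫ p = p)

/-- The action of `g` on the functions on the preimage of `U`. -/
def invariantAction (U : B.Opens) : Γ(Z, p ⁻¹ᵁ U) →+* Γ(Z, p ⁻¹ᵁ U) :=
  (g.appLE (p ⁻¹ᵁ U) (p ⁻¹ᵁ U) (by rw [← Scheme.Hom.comp_preimage, hg])).hom

/-- The functions on the preimage of `U` which are invariant under `g`. -/
abbrev invariantSections (U : B.Opens) : Subring Γ(Z, p ⁻¹ᵁ U) :=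
  (invariantAction p g hg U).eqLocus (RingHom.id _)

theorem invariantAction_res {U V : B.Opens} (h : V ≤ U) (x : Γ(Z, p ⁻¹ᵁ U)) :
    invariantAction p g hg V (Z.presheaf.map (homOfLE (p.preimage_mono h)).op x) =
      Z.presheaf.map (homOfLE (p.preimage_mono h)).op (invariantAction p g hg U x) := by
  have h₁ := g.map_appLE (U' := p ⁻¹ᵁ U) (U := p ⁻¹ᵁ V) (V := p ⁻¹ᵁ V)
    (by rw [← Scheme.Hom.comp_preimage, hg]) (homOfLE (p.preimage_mono h)).op
  have h₂ := g.appLE_map (U := p ⁻¹ᵁ U) (V := p ⁻¹ᵁ U) (V' := p ⁻¹ᵁ V)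
    (by rw [← Scheme.Hom.comp_preimage, hg]) (homOfLE (p.preimage_mono h)).op
  exact congr(($(h₁.trans h₂.symm)).hom x)

theorem invariant_app (U : B.Opens) (x : Γ(B, U)) :
    (p.app U).hom x ∈ invariantSections p g hg U := by
  have h₁ := Scheme.Hom.comp_appLE g p U (p ⁻¹ᵁ U) (by rw [hg])
  have h₂ : (g ≫ p).appLE U (p ⁻¹ᵁ U) (by rw [hg]) = p.app U := by
    rw [p.app_eq_appLE]
    congr 1
  exact congr(($(h₁.symm.trans h₂)).hom x)

/-- The sheaf `U ↦ Γ(Z, p⁻¹ U) ^ g` on `B`. -/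
def invariantDiagram : B.Opensᵒᵖ ⥤ CommRingCat.{0} where
  obj U := .of (invariantSections p g hg U.unop)
  map {U V} i := CommRingCat.ofHom
    ((Z.presheaf.map (homOfLE (p.preimage_mono i.unop.le)).op).hom.restrict _ _ fun x hx ↦ by
      exact (invariantAction_res p g hg i.unop.le x).trans congr(Z.presheaf.map _ $hx))
  map_id U := by
    ext x
    exact (DFunLike.congr_fun (congrArg CommRingCat.Hom.hom (Z.presheaf.map_id _)) x.1)
  map_comp i j := by
    ext x
    exact (DFunLike.congr_fun (congrArg CommRingCat.Hom.hom
      (Z.presheaf.map_comp (homOfLE (p.preimage_mono i.unop.le)).op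
        (homOfLE (p.preimage_mono j.unop.le)).op)) x.1)

/-- The structure morphism from the structure sheaf of `B` to the invariants. -/
def invariantDiagramMap : B.presheaf ⟶ invariantDiagram p g hg where
  app U := CommRingCat.ofHom ((p.app U.unop).hom.codRestrict _ (invariant_app p g hg U.unop))
  naturality {U V} i := by
    ext x
    exact Subtype.ext congr(($(p.naturality i)).hom x)

open Scheme.AffineZariskiSite

theorem coequifibered_invariantDiagramMap [IsAffineHom p] :
    ((toOpensFunctor B).op.whiskerLeft (invariantDiagramMap p g hg)).Coequifibered := by
  refine coequifibered_iff_forall_isLocalizationAway.mpr fun U r ↦ ?_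
  let : Algebra Γ(Z, p ⁻¹ᵁ U.1) Γ(Z, p ⁻¹ᵁ (U.basicOpen r).1) :=
    (Z.presheaf.map (homOfLE (p.preimage_mono (B.basicOpen_le r))).op).hom.toAlgebra
  have h : IsLocalization.Away ((p.app U.1).hom r) Γ(Z, p ⁻¹ᵁ (U.basicOpen r).1) :=
    (U.2.preimage p).isLocalization_of_eq_basicOpen _ _ (p.preimage_basicOpen r)
  exact isLocalization_eqLocus (A := Γ(Z, p ⁻¹ᵁ U.1)) (A' := Γ(Z, p ⁻¹ᵁ (U.basicOpen r).1))
    ((p.app U.1).hom r) (invariantAction p g hg U.1) (invariantAction p g hg (U.basicOpen r).1)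
    (invariantAction_res p g hg (B.basicOpen_le r)) (invariant_app p g hg U.1 r)
    ((invariantDiagram p g hg).map (homOfLE (B.basicOpen_le r)).op).hom fun _ ↦ rfl

/-- The data that glue the spectra of the rings of invariants. -/
def quotientData [IsAffineHom p] :=
  relativeGluingData (coequifibered_invariantDiagramMap p g hg)

/-- The quotient of `Z` by the group generated by `g`, where `g` acts on `Z` over `B` and `Z` is affine
over `B`: it is glued from the spectra of `Γ(Z, p⁻¹ U) ^ g` for the affine open subsets `U` of `B`. -/
def cyclicQuotient [IsAffineHom p] : Scheme.{0} := (quotientData p g hg).glued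

/-- The morphism from the quotient to the base. -/
def cyclicQuotient.toBase [IsAffineHom p] : cyclicQuotient p g hg ⟶ B :=
  (quotientData p g hg).toBase

end Quotient

section Product

variable {S Y₁ Y₂ B₁ B₂ : Scheme.{0}} (p₁ : Y₁ ⟶ B₁) (p₂ : Y₂ ⟶ B₂) (s₁ : B₁ ⟶ S) (s₂ : B₂ ⟶ S)

/-- The morphism `Y₁ ×[S] Y₂ ⟶ B₁ ×[S] B₂` induced by `p₁` and `p₂`. -/
def prodMap : pullback (p₁ ≫ s₁) (p₂ ≫ s₂) ⟶ pullback s₁ s₂ :=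
  pullback.map _ _ _ _ p₁ p₂ (𝟙 S) (by simp) (by simp)

instance [IsAffineHom p₁] [IsAffineHom p₂] : IsAffineHom (prodMap p₁ p₂ s₁ s₂) := by
  have : MorphismProperty.IsStableUnderComposition @IsAffineHom := ⟨fun f g _ _ ↦ inferInstance⟩
  exact MorphismProperty.pullbackMap (P := @IsAffineHom) ‹_› ‹_› rfl rfl

/-- The morphism `(g₁, g₂)` of `Y₁ ×[S] Y₂` for `g₁` over `B₁` and `g₂` over `B₂`. -/
def prodRot (g₁ : Y₁ ⟶ Y₁) (g₂ : Y₂ ⟶ Y₂) (h₁ : g₁ ≫ p₁ = p₁) (h₂ : g₂ ≫ p₂ = p₂) :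
    pullback (p₁ ≫ s₁) (p₂ ≫ s₂) ⟶ pullback (p₁ ≫ s₁) (p₂ ≫ s₂) :=
  pullback.map _ _ _ _ g₁ g₂ (𝟙 S) (by rw [reassoc_of% h₁, Category.comp_id])
    (by rw [reassoc_of% h₂, Category.comp_id])

theorem prodRot_prodMap (g₁ : Y₁ ⟶ Y₁) (g₂ : Y₂ ⟶ Y₂) (h₁ : g₁ ≫ p₁ = p₁) (h₂ : g₂ ≫ p₂ = p₂) :
    prodRot p₁ p₂ s₁ s₂ g₁ g₂ h₁ h₂ ≫ prodMap p₁ p₂ s₁ s₂ = prodMap p₁ p₂ s₁ s₂ := by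
  refine pullback.hom_ext ?_ ?_
  · have e₁ : prodMap p₁ p₂ s₁ s₂ ≫ pullback.fst _ _ = pullback.fst _ _ ≫ p₁ :=
      pullback.lift_fst _ _ _
    have e₂ : prodRot p₁ p₂ s₁ s₂ g₁ g₂ h₁ h₂ ≫ pullback.fst _ _ = pullback.fst _ _ ≫ g₁ :=
      pullback.lift_fst _ _ _
    rw [Category.assoc, e₁, reassoc_of% e₂, h₁]
  · have e₁ : prodMap p₁ p₂ s₁ s₂ ≫ pullback.snd _ _ = pullback.snd _ _ ≫ p₂ :=
      pullback.lift_snd _ _ _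
    have e₂ : prodRot p₁ p₂ s₁ s₂ g₁ g₂ h₁ h₂ ≫ pullback.snd _ _ = pullback.snd _ _ ≫ g₂ :=
      pullback.lift_snd _ _ _
    rw [Category.assoc, e₁, reassoc_of% e₂, h₂]

end Product

section Main
open Polynomial

/-- A polynomial in `x` as a rational function on the projective line. -/
def lineFunction : ℂ[X] →+* (P1 ℂ).functionField :=
  chartToFunctionField (R := .of ℂ[X]) (P1.ι₀ ℂ)

/-- A polynomial in the base coordinate `x` (inner variable) and the fibre coordinate `t` (outer
variable) as a rational function on `ℙ(𝒪 ⊕ 𝒪(n))`. -/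
def ruledFunction (n : ℕ) : ℂ[X][X] →+* (Hirz n).functionField :=
  chartToFunctionField (R := .of ℂ[X][X]) (P1.ι₀ ℂ[X] ≫ Hirz.j₀ n)

/-- The structure morphism of `ℙ(𝒪 ⊕ 𝒪(n))`. -/
def Hirz.str (n : ℕ) : Hirz n ⟶ Spec (.of ℂ) := Hirz.proj n ≫ P1.str ℂ

/-- The morphism `μ : ℙ(𝒪 ⊕ 𝒪(2)) ⟶ ℙ(𝒪 ⊕ 𝒪(8))` of degree 4. -/
def mu₄ : Hirz 2 ⟶ Hirz 8 := Hirz.mu 2 4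

/-- The ideal sheaf of the pull-back `μ^* E_σ`. -/
def muPullbackE (σ : MvPolynomial (Fin 2) ℂ) (hσ : σ.IsHomogeneous 8) : (Hirz 2).IdealSheafData :=
  (Hirz.sectionE σ hσ).ker.comap mu₄

/-- The rational function `(t ^ 4 + σ(1, x)) / t ^ 4` on `ℙ(𝒪 ⊕ 𝒪(2))`, with divisor
`μ^* E_σ - μ^* E_0`. -/
def branchFunction (σ : MvPolynomial (Fin 2) ℂ) : (Hirz 2).functionField :=
  ruledFunction 2 (X ^ 4 + C (Hirz.dehom₀ σ)) / ruledFunction 2 (X ^ 4)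

/-- The double covering `𝒴` of `ℙ(𝒪 ⊕ 𝒪(2))` ramified along `μ^* E_σ`. -/
abbrev surfaceY (σ : MvPolynomial (Fin 2) ℂ) : Scheme.{0} := kummerCover 2 (branchFunction σ)

/-- The structure morphism of `𝒴`. -/
def surfaceY.str (σ : MvPolynomial (Fin 2) ℂ) : surfaceY σ ⟶ Spec (.of ℂ) :=
  kummerCover.π 2 (branchFunction σ) ≫ Hirz.str 2

/-- The cyclic covering `C` of degree 4 of the projective line, given by `y ^ 4 = σ`. -/
abbrev curveC (σ : MvPolynomial (Fin 2) ℂ) : Scheme.{0} :=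
  kummerCover 4 (lineFunction (Hirz.dehom₀ σ))

/-- The elliptic curve `𝔼` given by `y ^ 4 = x * (x - 1) ^ 2`. -/
abbrev curveE : Scheme.{0} := kummerCover 4 (lineFunction (X * (X - 1) ^ 2))

theorem lineFunction_root {ζ : ℂ} (hζ : ζ ^ 4 = 1) : lineFunction (C ζ) ^ 4 = 1 := by
  rw [← map_pow, ← C_pow, hζ, C_1, map_one]

/-- The quotient `C × 𝔼 / ⟨(1, 1)⟩` by the group generated by `(γ₁, γ₂)`, where `γ₁` and `γ₂` are both
given by `(x, y) ↦ (x, ζ * y)`. -/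
def quotientCE (σ : MvPolynomial (Fin 2) ℂ) (ζ : ℂ) (hζ : ζ ^ 4 = 1) : Scheme.{0} :=
  cyclicQuotient _ _ (prodRot_prodMap (kummerCover.π 4 (lineFunction (Hirz.dehom₀ σ)))
    (kummerCover.π 4 (lineFunction (X * (X - 1) ^ 2))) (P1.str ℂ) (P1.str ℂ)
    (kummerCover.rot _ _ (lineFunction (C ζ)) (lineFunction_root hζ))
    (kummerCover.rot _ _ (lineFunction (C ζ)) (lineFunction_root hζ))
    (kummerCover.rot_π ..) (kummerCover.rot_π ..))

/-- The structure morphism of `C × 𝔼 / ⟨(1, 1)⟩`. -/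
def quotientCE.str (σ : MvPolynomial (Fin 2) ℂ) (ζ : ℂ) (hζ : ζ ^ 4 = 1) :
    quotientCE σ ζ hζ ⟶ Spec (.of ℂ) :=
  cyclicQuotient.toBase _ _ _ ≫ pullback.fst (P1.str ℂ) (P1.str ℂ) ≫ P1.str ℂ

end Main

end KummerK3

end

noncomputable section
namespace KummerK3
open CategoryTheory CategoryTheory.Limits AlgebraicGeometry

section Normalization

theorem isIntegral_of_isIntegralHom_of_comp {X N : Scheme.{0}} {A L : CommRingCat.{0}}
    (e : X ≅ Spec L) (t : X ⟶ N) (π : N ⟶ Spec A) [IsIntegralHom π] (ψ : A ⟶ L)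
    (h : t ≫ π = e.hom ≫ Spec.map ψ) (z : Γ(N, ⊤)) :
    ψ.hom.IsIntegralElem ((e.inv ≫ t).appTop ≫ (Scheme.ΓSpecIso L).hom |>.hom z) := by
  have h₁ : (π.appTop).hom.IsIntegralElem z :=
    IsIntegralHom.isIntegral_app π ⊤ (isAffineOpen_top _) z
  have h₂ : (Scheme.ΓSpecIso A).inv ≫ π.appTop ≫ (e.inv ≫ t).appTop ≫ (Scheme.ΓSpecIso L).hom = ψ := by
    rw [← Category.assoc π.appTop, ← Scheme.Hom.comp_appTop, Category.assoc, h, Iso.inv_hom_id_assoc]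
    simp
  obtain ⟨q, hq, hz⟩ := h₁
  refine ⟨q.map (Scheme.ΓSpecIso A).hom.hom, hq.map _, ?_⟩
  rw [Polynomial.eval₂_map]
  have h₃ : ψ.hom.comp (Scheme.ΓSpecIso A).hom.hom =
      ((e.inv ≫ t).appTop ≫ (Scheme.ΓSpecIso L).hom).hom.comp π.appTop.hom := by
    rw [← h₂, ← CommRingCat.hom_comp, ← CommRingCat.hom_comp]
    simp
  rw [h₃, ← Polynomial.hom_eval₂, hz, map_zero]

theorem isIso_normalizationDesc {X : Scheme.{0}} {A T L : CommRingCat.{0}} (e : X ≅ Spec L)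
    (ψ : A ⟶ T) (χ : T ⟶ L) (hχ : Function.Injective χ)
    (hT : ∀ z, (ψ ≫ χ).hom.IsIntegralElem z → z ∈ χ.hom.range) (f : X ⟶ Spec A)
    [QuasiCompact f] [QuasiSeparated f] [IsIntegralHom (Spec.map ψ)]
    (hf : f = (e.hom ≫ Spec.map χ) ≫ Spec.map ψ) :
    IsIso (f.normalizationDesc (e.hom ≫ Spec.map χ) (Spec.map ψ) hf) := by
  let d := f.normalizationDesc (e.hom ≫ Spec.map χ) (Spec.map ψ) hf
  have : IsAffine f.normalization := isAffine_of_isAffineHom f.fromNormalization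
  have : IsSchemeTheoreticallyDominant f.toNormalization := ⟨f.ker_toNormalization⟩
  have : IsSchemeTheoreticallyDominant (e.inv ≫ f.toNormalization) := inferInstance
  have hd : (e.inv ≫ f.toNormalization) ≫ d = Spec.map χ := by
    simp only [d, Category.assoc, Scheme.Hom.toNormalization_normalizationDesc]
    simp
  have hd' : d.appTop ≫ (e.inv ≫ f.toNormalization).appTop ≫ (Scheme.ΓSpecIso L).hom =
      (Scheme.ΓSpecIso T).hom ≫ χ := by
    rw [← Category.assoc, ← Scheme.Hom.comp_appTop, hd]
    simp
  have hinj : Function.Injective (e.inv ≫ f.toNormalization).appTop :=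
    Scheme.Hom.app_injective _ _
  suffices IsIso d.appTop from (MorphismProperty.arrow_mk_iso_iff (.isomorphisms Scheme.{0})
    (arrowIsoSpecΓOfIsAffine d)).mpr (inferInstanceAs (IsIso (Spec.map d.appTop)))
  refine (ConcreteCategory.isIso_iff_bijective _).mpr ⟨?_, fun z ↦ ?_⟩
  · have : Function.Injective (d.appTop ≫ (e.inv ≫ f.toNormalization).appTop ≫
        (Scheme.ΓSpecIso L).hom) := by
      rw [hd']
      exact hχ.comp (Scheme.ΓSpecIso T).commRingCatIsoToRingEquiv.injective
    exact Function.Injective.of_comp (f := (e.inv ≫ f.toNormalization).appTop ≫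
        (Scheme.ΓSpecIso L).hom) this
  · obtain ⟨t, ht⟩ := hT _ (isIntegral_of_isIntegralHom_of_comp e f.toNormalization
      f.fromNormalization (ψ ≫ χ) (by simp [hf]) z)
    refine ⟨(Scheme.ΓSpecIso T).inv t, hinj ?_⟩
    apply (Scheme.ΓSpecIso L).commRingCatIsoToRingEquiv.injective
    refine Eq.trans ?_ ht
    have := congr($hd' ((Scheme.ΓSpecIso T).inv t))
    rw [CommRingCat.comp_apply, CommRingCat.comp_apply, CommRingCat.comp_apply,
      CommRingCat.hom_inv_apply] at this
    exact this

/-- Over an affine open subset `Spec A`, the normalization in `Spec L` is the spectrum of the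
integral closure `T` of `A` in `L`. -/
theorem exists_isPullback_normalization {Y : Scheme.{0}} {A T L : CommRingCat.{0}}
    (i : Spec A ⟶ Y) [IsOpenImmersion i] (ψ : A ⟶ T) (χ : T ⟶ L) (hψ : ψ.hom.IsIntegral)
    (hχ : Function.Injective χ) (hT : ∀ z, (ψ ≫ χ).hom.IsIntegralElem z → z ∈ χ.hom.range)
    (g : Spec L ⟶ Y) [QuasiCompact g] [QuasiSeparated g]
    (hg : g = Spec.map χ ≫ Spec.map ψ ≫ i) :
    ∃ h : Spec T ⟶ g.normalization, IsPullback h (Spec.map ψ) g.fromNormalization i ∧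
      Spec.map χ ≫ h = g.toNormalization := by
  have : IsIntegralHom (Spec.map ψ) := IsIntegralHom.SpecMap_iff.mpr hψ
  let e' : Spec L ⟶ pullback g i := pullback.lift (𝟙 _) (Spec.map χ ≫ Spec.map ψ) (by simp [hg])
  have h₁ : e' ≫ pullback.fst g i = 𝟙 _ := pullback.lift_fst _ _ _
  have h₂ : e' ≫ pullback.snd g i = Spec.map χ ≫ Spec.map ψ := pullback.lift_snd _ _ _
  have he : pullback.snd g i = (pullback.fst g i ≫ Spec.map χ) ≫ Spec.map ψ := by
    rw [← cancel_mono i, ← pullback.condition]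
    simp [hg]
  let e : pullback g i ≅ Spec L := ⟨pullback.fst g i, e', by
    refine pullback.hom_ext ?_ ?_
    · rw [Category.assoc, h₁, Category.comp_id, Category.id_comp]
    · rw [Category.assoc, h₂, Category.id_comp, he, Category.assoc], h₁⟩
  let d := (pullback.snd g i).normalizationDesc (e.hom ≫ Spec.map χ) (Spec.map ψ) he
  have : IsIso d := isIso_normalizationDesc e ψ χ hχ hT _ he
  refine ⟨inv d ≫ g.normalizationPullback i ≫ pullback.fst _ _, ?_, ?_⟩
  · refine IsPullback.of_iso (IsPullback.of_hasPullback g.fromNormalization i)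
      ((asIso (g.normalizationPullback i)).symm.trans (asIso d)) (Iso.refl _) (Iso.refl _)
      (Iso.refl _) ?_ ?_ ?_ ?_
    · simp
    · simp [d, ← Scheme.Hom.normalizationPullback_snd]
    · simp
    · simp
  · have : Spec.map χ = e.inv ≫ (pullback.snd g i).toNormalization ≫ d := by
      simp [d]
    rw [this]
    simp only [Category.assoc, IsIso.hom_inv_id_assoc,
      Scheme.Hom.toNormalization_normalizationPullback_fst]
    rw [reassoc_of% h₁]

end Normalization

section KummerRing
open Polynomial

/-- The endomorphism `w ↦ ζ * w` of `A[w] / (w ^ n - a)`. -/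
def kummerRot {A : Type} [CommRing A] (n : ℕ) (a ζ : A) (hζ : ζ ^ n = 1) :
    AdjoinRoot (X ^ n - C a) →ₐ[A] AdjoinRoot (X ^ n - C a) :=
  AdjoinRoot.liftAlgHom _ (Algebra.ofId _ _) (AdjoinRoot.of _ ζ * AdjoinRoot.root _) (by
    have h := AdjoinRoot.eval₂_root (X ^ n - C a)
    simp only [Algebra.toRingHom_ofId, AdjoinRoot.algebraMap_eq]
    simp only [eval₂_sub, eval₂_X_pow, eval₂_C, mul_pow, ← map_pow, hζ, map_one, one_mul] at h ⊢
    exact h)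

section
variable {A : Type} [CommRing A] {n : ℕ} {a : A}

theorem kummerRing_root_pow : (AdjoinRoot.root (X ^ n - C a)) ^ n = AdjoinRoot.of _ a := by
  have h := AdjoinRoot.eval₂_root (X ^ n - C a)
  simpa [sub_eq_zero] using h

@[simp]
theorem kummerRot_root {ζ : A} (hζ : ζ ^ n = 1) :
    kummerRot n a ζ hζ (AdjoinRoot.root _) = AdjoinRoot.of _ ζ * AdjoinRoot.root _ := by
  simp [kummerRot]

/-- The elements of `A[w] / (w ^ n - a)` are the polynomials in `w` of degree less than `n`. -/
theorem exists_kummerRing_eq_sum (hn : n ≠ 0) (z : AdjoinRoot (X ^ n - C a)) : ∃ c : ℕ → A,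
    z = ∑ j ∈ Finset.range n, AdjoinRoot.of _ (c j) * AdjoinRoot.root _ ^ j := by
  obtain _ | _ := subsingleton_or_nontrivial A
  · have := Module.subsingleton A (AdjoinRoot (X ^ n - C a))
    exact ⟨0, Subsingleton.elim _ _⟩
  obtain ⟨q, rfl⟩ := AdjoinRoot.mk_surjective z
  have hm : (X ^ n - C a).Monic := monic_X_pow_sub_C a hn
  refine ⟨fun j ↦ (q %ₘ (X ^ n - C a)).coeff j, ?_⟩
  have h₁ : AdjoinRoot.mk (X ^ n - C a) q = AdjoinRoot.mk _ (q %ₘ (X ^ n - C a)) := by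
    conv_lhs => rw [← modByMonic_add_div q (X ^ n - C a)]
    simp
  have h₂ : (q %ₘ (X ^ n - C a)).natDegree < n := by
    have := natDegree_modByMonic_lt q hm (by
      intro h
      have := congrArg natDegree h
      rw [natDegree_X_pow_sub_C, natDegree_one] at this
      exact hn this)
    rwa [natDegree_X_pow_sub_C] at this
  rw [h₁]
  conv_lhs => rw [(q %ₘ (X ^ n - C a)).as_sum_range' n h₂]
  simp [← C_mul_X_pow_eq_monomial]

theorem kummerRing_sum_eq_zero (hn : n ≠ 0) {c : ℕ → A}
    (hc : ∑ j ∈ Finset.range n, AdjoinRoot.of (X ^ n - C a) (c j) * AdjoinRoot.root _ ^ j = 0)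
    {j : ℕ} (hj : j < n) : c j = 0 := by
  nontriviality A
  have hm : (X ^ n - C a).Monic := monic_X_pow_sub_C a hn
  let q : A[X] := ∑ j ∈ Finset.range n, C (c j) * X ^ j
  have hq : AdjoinRoot.mk (X ^ n - C a) q = 0 := by simpa [q] using hc
  have hd : q.degree < (X ^ n - C a).degree := by
    rw [degree_X_pow_sub_C (Nat.pos_of_ne_zero hn)]
    refine (degree_sum_le _ _).trans_lt ((Finset.sup_lt_iff (WithBot.bot_lt_coe n)).mpr
      fun i hi ↦ (degree_C_mul_X_pow_le _ _).trans_lt ?_)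
    exact Nat.cast_lt.mpr (Finset.mem_range.mp hi)
  have : q = 0 := by
    by_contra h
    exact hm.not_dvd_of_degree_lt h hd (AdjoinRoot.mk_eq_zero.mp hq)
  have := congrArg (coeff · j) this
  simpa [q, finsetSum_coeff, coeff_C_mul, coeff_X_pow, hj] using this

theorem kummerRing_sum_rot {ζ : A} (hζ : ζ ^ n = 1)
    (hu : ∀ j < n, j ≠ 0 → ∑ k ∈ Finset.range n, (ζ ^ j) ^ k = 0) (c : ℕ → A) {j : ℕ} (hj : j < n) :
    ∑ k ∈ Finset.range n, AdjoinRoot.of _ (ζ ^ (n - j)) ^ k * (kummerRot n a ζ hζ)^[k]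
      (∑ i ∈ Finset.range n, AdjoinRoot.of _ (c i) * AdjoinRoot.root _ ^ i) =
        (n : AdjoinRoot (X ^ n - C a)) * (AdjoinRoot.of _ (c j) * AdjoinRoot.root _ ^ j) := by
  have hr (k : ℕ) (c : A) (i : ℕ) : (kummerRot n a ζ hζ)^[k]
      (AdjoinRoot.of _ c * AdjoinRoot.root _ ^ i) =
        AdjoinRoot.of _ ((ζ ^ i) ^ k) * (AdjoinRoot.of _ c * AdjoinRoot.root _ ^ i) := by
    induction k with
    | zero => simp
    | succ k ih =>
      have h (x : A) : kummerRot n a ζ hζ (AdjoinRoot.of _ x) = AdjoinRoot.of _ x :=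
        (kummerRot n a ζ hζ).commutes x
      rw [Function.iterate_succ_apply', ih]
      simp only [map_mul, map_pow, h, kummerRot_root]
      ring
  have hs (k : ℕ) (f : ℕ → AdjoinRoot (X ^ n - C a)) : (kummerRot n a ζ hζ)^[k]
      (∑ i ∈ Finset.range n, f i) = ∑ i ∈ Finset.range n, (kummerRot n a ζ hζ)^[k] (f i) := by
    rw [← AlgHom.coe_pow]
    exact map_sum _ _ _
  simp_rw [hs, hr, Finset.mul_sum]
  rw [Finset.sum_comm]
  rw [Finset.sum_eq_single_of_mem j (Finset.mem_range.mpr hj)]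
  · have (k : ℕ) : AdjoinRoot.of (X ^ n - C a) (ζ ^ (n - j)) ^ k *
        (AdjoinRoot.of _ ((ζ ^ j) ^ k) * (AdjoinRoot.of _ (c j) * AdjoinRoot.root _ ^ j)) =
          AdjoinRoot.of _ (c j) * AdjoinRoot.root _ ^ j := by
      rw [← map_pow, ← mul_assoc, ← map_mul, ← mul_pow, ← pow_add, Nat.sub_add_cancel hj.le, hζ]
      simp
    simp only [this, Finset.sum_const, Finset.card_range, nsmul_eq_mul]
  · intro i hi hij
    simp_rw [← mul_assoc, ← Finset.sum_mul, ← map_pow, ← map_mul, ← map_sum, ← mul_pow, ← pow_add]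
    have : ∑ k ∈ Finset.range n, (ζ ^ (n - j + i)) ^ k = 0 := by
      have hi := Finset.mem_range.mp hi
      obtain h | h := lt_or_gt_of_ne hij
      · exact hu _ (by lia) (by lia)
      · have : ζ ^ (n - j + i) = ζ ^ (i - j) := by
          rw [show n - j + i = n + (i - j) by lia, pow_add, hζ, one_mul]
        rw [this]
        exact hu _ (by lia) (by lia)
    rw [this]
    simp

theorem sum_range_pow_eq_zero [IsDomain A] {ζ : A} (hζ : IsPrimitiveRoot ζ n) (j : ℕ) (hj : j < n)
    (hj₀ : j ≠ 0) : ∑ k ∈ Finset.range n, (ζ ^ j) ^ k = 0 := by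
  have h := mul_geom_sum (ζ ^ j) n
  rw [pow_right_comm, hζ.pow_eq_one, one_pow, sub_self] at h
  exact (mul_eq_zero.mp h).resolve_left (sub_ne_zero.mpr (hζ.pow_ne_one_of_pos_of_lt hj₀ hj))

theorem isIntegral_kummerRing (hn : n ≠ 0) : (AdjoinRoot.of (X ^ n - C a)).IsIntegral := by
  have := (monic_X_pow_sub_C a hn).finite_adjoinRoot
  exact (Algebra.IsIntegral.of_finite A (AdjoinRoot (X ^ n - C a))).isIntegral

/-- The invariants of `w ↦ ζ * w` are the constants. -/
theorem kummerRot_eq_self_iff {ζ : A} (hn : n ≠ 0) (hζ : ζ ^ n = 1)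
    (hu : ∀ j < n, j ≠ 0 → IsUnit (ζ ^ j - 1)) (z : AdjoinRoot (X ^ n - C a)) :
    kummerRot n a ζ hζ z = z ↔ z ∈ (AdjoinRoot.of (X ^ n - C a)).range := by
  have h (x : A) : kummerRot n a ζ hζ (AdjoinRoot.of _ x) = AdjoinRoot.of _ x :=
    (kummerRot n a ζ hζ).commutes x
  refine ⟨fun hz ↦ ?_, fun ⟨x, hx⟩ ↦ hx ▸ h x⟩
  obtain ⟨c, rfl⟩ := exists_kummerRing_eq_sum hn z
  rw [← sub_eq_zero, map_sum, ← Finset.sum_sub_distrib] at hz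
  have hc (j : ℕ) (hj : j < n) : (ζ ^ j - 1) * c j = 0 := by
    refine kummerRing_sum_eq_zero hn (c := fun j ↦ (ζ ^ j - 1) * c j) (a := a) ?_ hj
    rw [← hz]
    refine Finset.sum_congr rfl fun j _ ↦ ?_
    simp only [map_mul, map_pow, map_sub, map_one, h, kummerRot_root]
    ring
  refine ⟨c 0, ?_⟩
  rw [Finset.sum_eq_single_of_mem 0 (Finset.mem_range.mpr (Nat.pos_of_ne_zero hn)), pow_zero, mul_one]
  intro j hj hj₀
  rw [(hu j (Finset.mem_range.mp hj) hj₀).mul_right_eq_zero.mp (hc j (Finset.mem_range.mp hj)),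
    map_zero, zero_mul]

variable {K : Type} [Field K] (φ : A →+* K)

/-- The homomorphism `A[w] / (w ^ n - a) ⟶ K[w] / (w ^ n - φ a)`. -/
def kummerMap (n : ℕ) (a : A) : AdjoinRoot (X ^ n - C a) →+* AdjoinRoot (X ^ n - C (φ a)) :=
  AdjoinRoot.map φ _ _ (by simp)

@[simp]
theorem kummerMap_of (x : A) : kummerMap φ n a (AdjoinRoot.of _ x) = AdjoinRoot.of _ (φ x) := by
  simp [kummerMap]

@[simp]
theorem kummerMap_root : kummerMap φ n a (AdjoinRoot.root _) = AdjoinRoot.root _ := by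
  simp [kummerMap]

theorem kummerMap_injective (hn : n ≠ 0) (hφ : Function.Injective φ) :
    Function.Injective (kummerMap φ n a) := by
  rw [injective_iff_map_eq_zero]
  intro z hz
  obtain ⟨c, rfl⟩ := exists_kummerRing_eq_sum hn z
  refine Finset.sum_eq_zero fun j hj ↦ ?_
  have := kummerRing_sum_eq_zero hn (c := fun j ↦ φ (c j)) (a := φ a) (by simpa using hz)
    (Finset.mem_range.mp hj)
  rw [(map_eq_zero_iff φ hφ).mp this]
  simp

/-- If `A` is integrally closed and `n` and `a` are units, then `A[w] / (w ^ n - a)` is integrally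
closed in `K[w] / (w ^ n - a)`. -/
theorem mem_range_kummerMap (hφ : Function.Injective φ)
    (hA : ∀ x, φ.IsIntegralElem x → x ∈ φ.range) (hn : IsUnit (n : A)) (hn₀ : n ≠ 0)
    (ha : IsUnit a) {ζ : A} (hζ : IsPrimitiveRoot ζ n) (z : AdjoinRoot (X ^ n - C (φ a)))
    (hz : ((AdjoinRoot.of (X ^ n - C (φ a))).comp φ).IsIntegralElem z) :
    z ∈ (kummerMap φ n a).range := by
  let := φ.toAlgebra
  have hζ' : IsPrimitiveRoot (φ ζ) n := hζ.map_of_injective hφ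
  let ρ := (kummerRot n (φ a) (φ ζ) hζ'.pow_eq_one).restrictScalars A
  have hint (x : A) : IsIntegral A (AdjoinRoot.of (X ^ n - C (φ a)) (φ x)) :=
    isIntegral_algebraMap (R := A) (A := AdjoinRoot (X ^ n - C (φ a))) (x := x)
  have hw : IsIntegral A (AdjoinRoot.root (X ^ n - C (φ a))) := by
    refine IsIntegral.of_pow (Nat.pos_of_ne_zero hn₀) ?_
    rw [kummerRing_root_pow]
    exact hint a
  have hρ (k : ℕ) (x) (hx : IsIntegral A x) : IsIntegral A (ρ^[k] x) := by
    induction k with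
    | zero => exact hx
    | succ k ih =>
      rw [Function.iterate_succ_apply']
      exact ih.map ρ
  have hz' : IsIntegral A z := hz
  obtain ⟨c, hc⟩ := exists_kummerRing_eq_sum hn₀ z
  have key (j : ℕ) (hj : j < n) : c j ∈ φ.range := by
    have h₁ := kummerRing_sum_rot hζ'.pow_eq_one (sum_range_pow_eq_zero hζ') c hj (a := φ a)
    rw [← hc] at h₁
    have h₂ : IsIntegral A ((n : AdjoinRoot (X ^ n - C (φ a))) *
        (AdjoinRoot.of (X ^ n - C (φ a)) (c j) * AdjoinRoot.root _ ^ j)) := by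
      rw [← h₁]
      refine IsIntegral.sum _ fun k _ ↦ IsIntegral.mul ?_ (hρ k z hz')
      rw [← map_pow φ]
      exact (hint _).pow k
    have h₃ : IsIntegral A (AdjoinRoot.of (X ^ n - C (φ a)) (φ n * φ a * c j)) := by
      have := h₂.mul (hw.pow (n - j))
      have e : (n : AdjoinRoot (X ^ n - C (φ a))) * (AdjoinRoot.of (X ^ n - C (φ a)) (c j) *
          AdjoinRoot.root _ ^ j) * AdjoinRoot.root _ ^ (n - j) =
          AdjoinRoot.of (X ^ n - C (φ a)) (φ n * φ a * c j) := by
        rw [mul_assoc, mul_assoc, ← pow_add, Nat.add_sub_cancel' hj.le, kummerRing_root_pow]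
        simp
        ring
      rwa [e] at this
    have h₄ : IsIntegral A (φ n * φ a * c j) := by
      refine (isIntegral_algHom_iff (IsScalarTower.toAlgHom A K (AdjoinRoot (X ^ n - C (φ a)))) ?_).mp
        h₃
      have : Nontrivial (AdjoinRoot (X ^ n - C (φ a))) :=
        AdjoinRoot.nontrivial _ (by
          rw [degree_X_pow_sub_C (Nat.pos_of_ne_zero hn₀)]
          exact_mod_cast hn₀)
      exact (AdjoinRoot.of (X ^ n - C (φ a))).injective
    obtain ⟨b, hb⟩ := hA _ h₄
    obtain ⟨v, hv⟩ := (hn.mul ha).exists_left_inv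
    refine ⟨v * b, ?_⟩
    rw [map_mul, hb, ← map_mul, ← mul_assoc, ← map_mul, hv, map_one, one_mul]
  have hc' (j : ℕ) : ∃ b, j < n → φ b = c j := by
    by_cases hj : j < n
    · obtain ⟨b, hb⟩ := key j hj
      exact ⟨b, fun _ ↦ hb⟩
    · exact ⟨0, fun h ↦ absurd h hj⟩
  choose b hb using hc'
  refine ⟨∑ j ∈ Finset.range n, AdjoinRoot.of _ (b j) * AdjoinRoot.root _ ^ j, ?_⟩
  rw [hc, map_sum]
  refine Finset.sum_congr rfl fun j hj ↦ ?_
  simp [hb j (Finset.mem_range.mp hj)]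

end
end KummerRing

section Chart
variable {Y : Scheme.{0}} [IsIntegral Y]

theorem SpecMap_chartToFunctionField {R : CommRingCat.{0}} [Nonempty (Spec R)] (i : Spec R ⟶ Y)
    [IsOpenImmersion i] : Spec.map (CommRingCat.ofHom (chartToFunctionField i)) ≫ i =
      Y.fromSpecStalk (genericPoint Y) := by
  have hU : IsAffineOpen (i ''ᵁ ⊤) := (isAffineOpen_top _).image_of_isOpenImmersion i
  have : Nonempty (i ''ᵁ ⊤ : Y.Opens) :=
    let ⟨x⟩ : Nonempty (Spec R) := inferInstance
    ⟨⟨i x, x, trivial, rfl⟩⟩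
  have hx : genericPoint Y ∈ i ''ᵁ ⊤ :=
    ((genericPoint_spec Y).mem_open_set_iff (i ''ᵁ ⊤).isOpen).mpr
      (by simpa using (this : Nonempty (i ''ᵁ ⊤ : Y.Opens)))
  rw [← hU.fromSpecStalk_eq_fromSpecStalk hx, IsAffineOpen.fromSpecStalk]
  have h : hU.fromSpec = Spec.map ((Scheme.ΓSpecIso R).inv ≫ (i.appIso ⊤).inv) ≫ i := by
    have h₁ := hU.SpecMap_appLE_fromSpec i (isAffineOpen_top (Spec R)) (i.preimage_image_eq ⊤).ge
    rw [← Scheme.Hom.appIso_hom', IsAffineOpen.fromSpec_top, Scheme.isoSpec_Spec_inv] at h₁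
    rw [Spec.map_comp, Category.assoc, ← h₁, ← Spec.map_comp_assoc]
    simp
  rw [h, ← Spec.map_comp_assoc]
  rfl

theorem chartToFunctionField_eq {R : CommRingCat.{0}} [Nonempty (Spec R)] (i : Spec R ⟶ Y)
    [IsOpenImmersion i] {φ : R →+* Y.functionField}
    (h : Spec.map (CommRingCat.ofHom φ) ≫ i = Y.fromSpecStalk (genericPoint Y)) :
    chartToFunctionField i = φ := by
  rw [← SpecMap_chartToFunctionField i, cancel_mono] at h
  exact (congrArg CommRingCat.Hom.hom (Spec.map_injective h)).symm

theorem chartToFunctionField_comp {R S : CommRingCat.{0}} [Nonempty (Spec R)] [Nonempty (Spec S)]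
    (i : Spec R ⟶ Y) [IsOpenImmersion i] (ψ : R ⟶ S) [IsOpenImmersion (Spec.map ψ)] :
    chartToFunctionField i = (chartToFunctionField (Spec.map ψ ≫ i)).comp ψ.hom := by
  refine chartToFunctionField_eq i ?_
  rw [← SpecMap_chartToFunctionField (Spec.map ψ ≫ i), ← Spec.map_comp_assoc]
  rfl

theorem isFractionRing_chartToFunctionField {R : CommRingCat.{0}} [Nonempty (Spec R)]
    (i : Spec R ⟶ Y) [IsOpenImmersion i] :
    letI := (chartToFunctionField i).toAlgebra
    IsFractionRing R Y.functionField := by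
  have hU : IsAffineOpen (i ''ᵁ ⊤) := (isAffineOpen_top _).image_of_isOpenImmersion i
  have : Nonempty (i ''ᵁ ⊤ : Y.Opens) :=
    let ⟨x⟩ : Nonempty (Spec R) := inferInstance
    ⟨⟨i x, x, trivial, rfl⟩⟩
  have := functionField_isFractionRing_of_isAffineOpen Y (i ''ᵁ ⊤) hU
  let e : R ≃+* Γ(Y, i ''ᵁ ⊤) := ((Scheme.ΓSpecIso R).symm ≪≫ (i.appIso ⊤).symm).commRingCatIsoToRingEquiv
  let := (chartToFunctionField i).toAlgebra
  exact IsFractionRing.of_ringEquiv_left e fun _ ↦ rfl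

theorem chartToFunctionField_injective {R : CommRingCat.{0}} [Nonempty (Spec R)]
    (i : Spec R ⟶ Y) [IsOpenImmersion i] : Function.Injective (chartToFunctionField i) :=
  letI := (chartToFunctionField i).toAlgebra
  haveI := isFractionRing_chartToFunctionField i
  IsFractionRing.injective R Y.functionField

theorem mem_range_chartToFunctionField {R : CommRingCat.{0}} [IsDomain R] [IsIntegrallyClosed R]
    (i : Spec R ⟶ Y) [IsOpenImmersion i] (x : Y.functionField)
    (hx : (chartToFunctionField i).IsIntegralElem x) : x ∈ (chartToFunctionField i).range := by
  let := (chartToFunctionField i).toAlgebra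
  have := isFractionRing_chartToFunctionField i
  exact (IsIntegrallyClosed.isIntegral_iff (R := R)).mp hx

end Chart

section KummerCover
variable {Y : Scheme.{0}} [IsIntegral Y]
open Polynomial

theorem dense_preimage_kummerCover (n : ℕ) (f : Y.functionField) (U : Y.Opens) (hU : (U : Set Y).Nonempty) :
    Dense ((kummerCover.π n f ⁻¹ᵁ U : (kummerCover n f).Opens) : Set (kummerCover n f)) := by
  refine (kummerGeneric n f).toNormalization.denseRange.mono ?_
  rintro _ ⟨x, rfl⟩
  change kummerCover.π n f ((kummerGeneric n f).toNormalization x) ∈ U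
  rw [← Scheme.Hom.comp_apply, Scheme.Hom.toNormalization_fromNormalization, kummerGeneric,
    Scheme.Hom.comp_apply]
  have h := Y.range_fromSpecStalk (x := genericPoint Y)
  have hx : genericPoint Y ∈ U := ((genericPoint_spec Y).mem_open_set_iff U.isOpen).mpr
    (by simpa using hU)
  exact (h.le (Set.mem_range_self _) : _ ⤳ genericPoint Y).mem_open U.isOpen hx

theorem exists_isPullback_kummerCover {A : Type} [CommRing A] [IsDomain A] [IsIntegrallyClosed A]
    (i : Spec (.of A) ⟶ Y) [IsOpenImmersion i] {n : ℕ} (hn : IsUnit (n : A)) (hn₀ : n ≠ 0) {a : A}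
    (ha : IsUnit a) {ζ : A} (hζ : IsPrimitiveRoot ζ n) {f : Y.functionField}
    (hf : f = chartToFunctionField i a) :
    ∃ h : Spec (.of (AdjoinRoot (X ^ n - C a))) ⟶ kummerCover n f,
      IsPullback h (Spec.map (CommRingCat.ofHom (AdjoinRoot.of _))) (kummerCover.π n f) i ∧
      ∀ (ξ : A) (hξ : ξ ^ n = 1) (η : Y.functionField) (hη : η ^ n = 1),
        η = chartToFunctionField i ξ →
        Spec.map (CommRingCat.ofHom (kummerRot n a ξ hξ).toRingHom) ≫ h =
          h ≫ kummerCover.rot n f η hη := by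
  subst hf
  let φ : A →+* Y.functionField := chartToFunctionField (R := .of A) i
  have hφ : Function.Injective φ := chartToFunctionField_injective (R := .of A) i
  have hχ : Function.Injective (kummerMap φ n a) := kummerMap_injective φ hn₀ hφ
  have hcomp : (kummerMap φ n a).comp (AdjoinRoot.of _) = (AdjoinRoot.of _).comp φ := by
    ext x; simp
  obtain ⟨h, hh, hh'⟩ := exists_isPullback_normalization i
    (CommRingCat.ofHom (AdjoinRoot.of (X ^ n - C a))) (CommRingCat.ofHom (kummerMap φ n a))
    (isIntegral_kummerRing hn₀) hχ (fun z hz ↦ mem_range_kummerMap φ hφ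
      (mem_range_chartToFunctionField (R := .of A) i) hn hn₀ ha hζ z (by
        rw [← hcomp]; exact hz)) (kummerGeneric n (φ a)) (by
      rw [kummerGeneric, ← SpecMap_chartToFunctionField (R := .of A) i, ← Spec.map_comp_assoc,
        ← Spec.map_comp_assoc, ← CommRingCat.ofHom_comp, ← CommRingCat.ofHom_comp, hcomp])
  refine ⟨h, hh, fun ξ hξ η hη e ↦ ?_⟩
  subst e
  have : IsOpenImmersion h := MorphismProperty.of_isPullback hh.flip inferInstance
  obtain ⟨q, hq₁⟩ : ∃ q, q ≫ h = h ≫ kummerCover.rot n (φ a) (φ ξ) hη :=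
    ⟨hh.lift (h ≫ kummerCover.rot n (φ a) (φ ξ) hη) (Spec.map (CommRingCat.ofHom (AdjoinRoot.of _)))
      (by rw [Category.assoc, kummerCover.rot_π, hh.w]), hh.lift_fst _ _ _⟩
  obtain ⟨ψ, rfl⟩ := Spec.map_surjective q
  rw [← hq₁]
  congr 2
  have h₁ : Spec.map (CommRingCat.ofHom (kummerMap φ n a)) ≫ Spec.map ψ =
      Spec.map (CommRingCat.ofHom (kummerAlgebraRot n (φ a) (φ ξ) hη)) ≫
        Spec.map (CommRingCat.ofHom (kummerMap φ n a)) := by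
    rw [← cancel_mono h, Category.assoc, hq₁, reassoc_of% hh', Category.assoc, hh',
      kummerCover.rot, Scheme.Hom.toNormalization_normalizationDesc]
  rw [← Spec.map_comp, ← Spec.map_comp, Spec.map_inj] at h₁
  refine CommRingCat.hom_ext (RingHom.ext fun x ↦ hχ ?_)
  have h₂ : (kummerMap φ n a) (ψ x) = kummerAlgebraRot n (φ a) (φ ξ) hη (kummerMap φ n a x) :=
    congr($h₁ x)
  change kummerMap φ n a (kummerRot n a ξ hξ x) = kummerMap φ n a (ψ x)
  rw [h₂]
  have h₃ : (kummerMap φ n a).comp (kummerRot n a ξ hξ).toRingHom =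
      (kummerAlgebraRot n (φ a) (φ ξ) hη).comp (kummerMap φ n a) := by
    ext x
    · simp [kummerAlgebraRot, kummerRot]
    · simp [kummerAlgebraRot]
  exact congr($h₃ x)

end KummerCover

section QuotientChart
variable {Z B : Scheme.{0}} (p : Z ⟶ B) (g : Z ⟶ Z) (hg : g ≫ p = p) [IsAffineHom p]

instance : ((quotientData p g hg).functor ⋙ Scheme.forget).IsLocallyDirected :=
  Scheme.Cover.RelativeGluingData.instIsLocallyDirectedI₀CompFunctorForgetOfIsThin ..

/-- The cover of the quotient by its charts over the affine open subsets of the base. -/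
def cyclicQuotient.openCover : (cyclicQuotient p g hg).OpenCover := (quotientData p g hg).cover

/-- The chart of the quotient over an affine open subset `V` of the base. -/
def cyclicQuotient.chart (V : B.affineOpens) :
    Spec (.of (invariantSections p g hg V.1)) ⟶ cyclicQuotient p g hg :=
  (cyclicQuotient.openCover p g hg).f V

instance (V : B.affineOpens) : IsOpenImmersion (cyclicQuotient.chart p g hg V) :=
  (cyclicQuotient.openCover p g hg).map_prop V

theorem cyclicQuotient.chart_toBase (V : B.affineOpens) :
    cyclicQuotient.chart p g hg V ≫ cyclicQuotient.toBase p g hg =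
      Spec.map (CommRingCat.ofHom ((p.app V.1).hom.codRestrict _ (invariant_app p g hg V.1))) ≫
        V.2.fromSpec :=
  colimit.ι_desc _ _

theorem cyclicQuotient.opensRange_chart (V : B.affineOpens) :
    (cyclicQuotient.chart p g hg V).opensRange = cyclicQuotient.toBase p g hg ⁻¹ᵁ V.1 := by
  have := (quotientData p g hg).toBase_preimage_eq_opensRange_ι V
  have h : ((Scheme.AffineZariskiSite.directedCover B).f V).opensRange = V.1 :=
    Scheme.Opens.opensRange_ι V.1
  rw [h] at this
  exact this.symm

theorem cyclicQuotient.exists_chart (x : cyclicQuotient p g hg) :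
    ∃ (V : B.affineOpens) (y : _), cyclicQuotient.chart p g hg V y = x := by
  obtain ⟨V, y, hy⟩ := (quotientData p g hg).cover.exists_eq x
  exact ⟨V, y, hy⟩

theorem cyclicQuotient.chart_comp_toBase (V : B.affineOpens) :
    Spec.map (CommRingCat.ofHom (invariantSections p g hg V.1).subtype) ≫
      cyclicQuotient.chart p g hg V ≫ cyclicQuotient.toBase p g hg =
        (V.2.preimage p).fromSpec ≫ p := by
  rw [cyclicQuotient.chart_toBase, ← Spec.map_comp_assoc]
  have := V.2.SpecMap_appLE_fromSpec p (V.2.preimage p) le_rfl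
  rw [← this, ← p.app_eq_appLE]
  rfl

/-- If the preimage of `U` is dense in `Z`, then it is dense in the quotient. -/
theorem cyclicQuotient.dense_preimage (U : B.Opens) (hU : Dense ((p ⁻¹ᵁ U : Z.Opens) : Set Z)) :
    Dense ((cyclicQuotient.toBase p g hg ⁻¹ᵁ U : (cyclicQuotient p g hg).Opens) :
      Set (cyclicQuotient p g hg)) := by
  intro x
  obtain ⟨V, y, rfl⟩ := cyclicQuotient.exists_chart p g hg x
  let s := Spec.map (CommRingCat.ofHom (invariantSections p g hg V.1).subtype)
  have hs : DenseRange s := (PrimeSpectrum.denseRange_comap_iff_ker_le_nilRadical _).mpr (by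
    rw [(RingHom.injective_iff_ker_eq_bot _).mp Subtype.val_injective]
    exact bot_le)
  have hd : Dense ((V.2.preimage p).fromSpec ⁻¹' (p ⁻¹ᵁ U)) :=
    hU.preimage (V.2.preimage p).fromSpec.isOpenEmbedding.isOpenMap
  have h₁ := hs.dense_image s.continuous hd
  refine map_mem_closure (cyclicQuotient.chart p g hg V).continuous (h₁ y) ?_
  rintro _ ⟨z, hz, rfl⟩
  change cyclicQuotient.toBase p g hg (cyclicQuotient.chart p g hg V (s z)) ∈ U
  have := congr($(cyclicQuotient.chart_comp_toBase p g hg V) z)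
  rw [Scheme.Hom.comp_apply, Scheme.Hom.comp_apply, Scheme.Hom.comp_apply] at this
  rw [this]
  exact hz

/-- A description of the quotient over an affine open subset `V` of the base. -/
theorem cyclicQuotient.exists_openImmersion (V : B.affineOpens) {M R : CommRingCat.{0}}
    (h : Spec M ⟶ Z) [IsOpenImmersion h] (hV : h.opensRange = p ⁻¹ᵁ V.1) (τ : M ⟶ M)
    (hτ : Spec.map τ ≫ h = h ≫ g) (ρ : R ⟶ M) (hρ : Function.Injective ρ)
    (hinv : ∀ m, τ m = m ↔ m ∈ ρ.hom.range) :
    ∃ q : Spec R ⟶ cyclicQuotient p g hg, IsOpenImmersion q ∧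
      Set.range q = (cyclicQuotient.toBase p g hg ⁻¹ᵁ V.1 : (cyclicQuotient p g hg).Opens) ∧
      Spec.map ρ ≫ q ≫ cyclicQuotient.toBase p g hg = h ≫ p := by
  have hle : ⊤ ≤ h ⁻¹ᵁ p ⁻¹ᵁ V.1 := by rw [← hV, Scheme.Hom.preimage_opensRange]
  let e : Γ(Z, p ⁻¹ᵁ V.1) ⟶ M := h.appLE (p ⁻¹ᵁ V.1) ⊤ hle ≫ (Scheme.ΓSpecIso M).hom
  have happ : IsIso (h.appLE (p ⁻¹ᵁ V.1) ⊤ hle) := by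
    have : IsIso (h.app (p ⁻¹ᵁ V.1)) := h.isIso_app _ hV.ge
    rw [Scheme.Hom.appLE]
    have : IsIso (homOfLE hle) := by
      refine ⟨homOfLE le_top, ?_, ?_⟩ <;> subsingleton
    infer_instance
  have he : IsIso e := inferInstance
  have hact : CommRingCat.ofHom (invariantAction p g hg V.1) ≫ e = e ≫ τ := by
    have h₁ : CommRingCat.ofHom (invariantAction p g hg V.1) ≫ h.appLE (p ⁻¹ᵁ V.1) ⊤ hle =
        (h ≫ g).appLE _ _ _ := Scheme.Hom.appLE_comp_appLE ..
    have h₂ : h.appLE (p ⁻¹ᵁ V.1) ⊤ hle ≫ (Spec.map τ).appTop = (Spec.map τ ≫ h).appLE _ ⊤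
        (by rw [Scheme.Hom.comp_preimage]; exact (Scheme.Hom.preimage_mono _ hle)) := by
      have : (Spec.map τ).appTop = (Spec.map τ).appLE ⊤ ⊤ le_rfl := Scheme.Hom.app_eq_appLE _
      rw [this]
      exact Scheme.Hom.appLE_comp_appLE ..
    simp only [e]
    rw [reassoc_of% h₁, Category.assoc, ← Scheme.ΓSpecIso_naturality τ, reassoc_of% h₂]
    simp only [hτ]
  have hfrom : Spec.map e ≫ (V.2.preimage p).fromSpec = h := by
    rw [Spec.map_comp, Category.assoc, (V.2.preimage p).SpecMap_appLE_fromSpec h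
      (isAffineOpen_top (Spec M)) hle, IsAffineOpen.fromSpec_top, Scheme.isoSpec_Spec_inv,
      ← Spec.map_comp_assoc]
    simp
  have hinv_e (m : M) : e (inv e m) = m := by rw [← CommRingCat.comp_apply]; simp
  have he_inj : Function.Injective e := ((ConcreteCategory.isIso_iff_bijective e).mp he).1
  have hmem (x : Γ(Z, p ⁻¹ᵁ V.1)) : x ∈ invariantSections p g hg V.1 ↔ e x ∈ ρ.hom.range := by
    rw [← hinv]
    have : e (invariantAction p g hg V.1 x) = τ (e x) := congr($hact x)
    rw [← this]
    exact he_inj.eq_iff.symm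
  let r : R →+* invariantSections p g hg V.1 := (ρ ≫ inv e).hom.codRestrict _ fun x ↦ by
    rw [hmem]
    exact ⟨x, (hinv_e (ρ x)).symm⟩
  have hr : (CommRingCat.ofHom r) ≫ CommRingCat.ofHom (invariantSections p g hg V.1).subtype ≫ e =
      ρ := by
    ext x
    exact hinv_e (ρ x)
  have hbij : Function.Bijective r := by
    refine ⟨fun x y hxy ↦ hρ ?_, fun ⟨x, hx⟩ ↦ ?_⟩
    · rw [← hr]
      exact congr(e ($hxy).1)
    · obtain ⟨y, hy⟩ := (hmem x).mp hx
      refine ⟨y, Subtype.ext (he_inj ?_)⟩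
      exact (hinv_e (ρ y)).trans hy
  have hiso : IsIso (CommRingCat.ofHom r) := (ConcreteCategory.isIso_iff_bijective _).mpr hbij
  refine ⟨inv (Spec.map (CommRingCat.ofHom r)) ≫ cyclicQuotient.chart p g hg V, inferInstance, ?_, ?_⟩
  · rw [← cyclicQuotient.opensRange_chart, ← Scheme.Hom.coe_opensRange,
      Scheme.Hom.opensRange_comp_of_isIso]
  · rw [← hr, Spec.map_comp, Spec.map_comp]
    simp only [Category.assoc, IsIso.hom_inv_id_assoc]
    rw [cyclicQuotient.chart_comp_toBase, reassoc_of% hfrom]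

end QuotientChart

section ProductChart
open TensorProduct
variable {k : Type} [CommRing k]

/-- The chart `Spec (A₁ ⊗ A₂)` of a fibre product given by charts `Spec A₁` and `Spec A₂`. -/
def prodChart {B₁ B₂ : Scheme.{0}} (s₁ : B₁ ⟶ Spec (.of k)) (s₂ : B₂ ⟶ Spec (.of k))
    {A₁ A₂ : Type} [CommRing A₁] [CommRing A₂] [Algebra k A₁] [Algebra k A₂]
    (i₁ : Spec (.of A₁) ⟶ B₁) (i₂ : Spec (.of A₂) ⟶ B₂)
    (h₁ : i₁ ≫ s₁ = Spec.map (CommRingCat.ofHom (algebraMap k A₁)))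
    (h₂ : i₂ ≫ s₂ = Spec.map (CommRingCat.ofHom (algebraMap k A₂))) :
    Spec (.of (A₁ ⊗[k] A₂)) ⟶ pullback s₁ s₂ :=
  (pullbackSpecIso k A₁ A₂).inv ≫ pullback.map _ _ _ _ i₁ i₂ (𝟙 _) (by rw [h₁, Category.comp_id])
    (by rw [h₂, Category.comp_id])

variable {B₁ B₂ : Scheme.{0}} {s₁ : B₁ ⟶ Spec (.of k)} {s₂ : B₂ ⟶ Spec (.of k)}
    {A₁ A₂ : Type} [CommRing A₁] [CommRing A₂] [Algebra k A₁] [Algebra k A₂]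
    {i₁ : Spec (.of A₁) ⟶ B₁} {i₂ : Spec (.of A₂) ⟶ B₂}
    (h₁ : i₁ ≫ s₁ = Spec.map (CommRingCat.ofHom (algebraMap k A₁)))
    (h₂ : i₂ ≫ s₂ = Spec.map (CommRingCat.ofHom (algebraMap k A₂)))

theorem prodChart_fst : prodChart s₁ s₂ i₁ i₂ h₁ h₂ ≫ pullback.fst _ _ =
    Spec.map (CommRingCat.ofHom Algebra.TensorProduct.includeLeftRingHom) ≫ i₁ := by
  rw [prodChart, Category.assoc, pullback.map, pullback.lift_fst, ← Category.assoc]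
  rw [pullbackSpecIso_inv_fst]

theorem prodChart_snd : prodChart s₁ s₂ i₁ i₂ h₁ h₂ ≫ pullback.snd _ _ =
    Spec.map (CommRingCat.ofHom Algebra.TensorProduct.includeRight.toRingHom) ≫ i₂ := by
  rw [prodChart, Category.assoc, pullback.map, pullback.lift_snd, ← Category.assoc]
  rw [pullbackSpecIso_inv_snd]
  rfl

instance [IsOpenImmersion i₁] [IsOpenImmersion i₂] :
    IsOpenImmersion (prodChart s₁ s₂ i₁ i₂ h₁ h₂) := by
  unfold prodChart
  infer_instance

theorem range_prodChart : Set.range (prodChart s₁ s₂ i₁ i₂ h₁ h₂) =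
    pullback.fst s₁ s₂ ⁻¹' Set.range i₁ ∩ pullback.snd s₁ s₂ ⁻¹' Set.range i₂ := by
  rw [prodChart, Scheme.Hom.comp_base, TopCat.coe_comp, Set.range_comp,
    Set.range_eq_univ.mpr (Scheme.Hom.surjective _), Set.image_univ]
  exact Scheme.Pullback.range_map ..

end ProductChart

section Product
open TensorProduct

theorem range_eq_of_isPullback {P X Y Z : Scheme.{0}} {a : P ⟶ X} {b : P ⟶ Y} {f : X ⟶ Z} {g : Y ⟶ Z}
    (h : IsPullback a b f g) : Set.range a = f ⁻¹' Set.range g := by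
  rw [← h.isoPullback_hom_fst, Scheme.Hom.comp_base, TopCat.coe_comp, Set.range_comp,
    Set.range_eq_univ.mpr (Scheme.Hom.surjective _), Set.image_univ]
  exact Scheme.Pullback.range_fst ..

variable {k : Type} [Field k] {Y₁ Y₂ B₁ B₂ : Scheme.{0}} (p₁ : Y₁ ⟶ B₁) (p₂ : Y₂ ⟶ B₂)
  (s₁ : B₁ ⟶ Spec (.of k)) (s₂ : B₂ ⟶ Spec (.of k))

theorem prodMap_fst : prodMap p₁ p₂ s₁ s₂ ≫ pullback.fst _ _ = pullback.fst _ _ ≫ p₁ :=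
  pullback.lift_fst _ _ _

theorem prodMap_snd : prodMap p₁ p₂ s₁ s₂ ≫ pullback.snd _ _ = pullback.snd _ _ ≫ p₂ :=
  pullback.lift_snd _ _ _

theorem prodMap_preimage (U₁ : Set B₁) (U₂ : Set B₂) :
    prodMap p₁ p₂ s₁ s₂ ⁻¹' (pullback.fst s₁ s₂ ⁻¹' U₁ ∩ pullback.snd s₁ s₂ ⁻¹' U₂) =
      pullback.fst (p₁ ≫ s₁) (p₂ ≫ s₂) ⁻¹' (p₁ ⁻¹' U₁) ∩
        pullback.snd (p₁ ≫ s₁) (p₂ ≫ s₂) ⁻¹' (p₂ ⁻¹' U₂) := by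
  ext x
  have e₁ := congr($(prodMap_fst p₁ p₂ s₁ s₂) x)
  have e₂ := congr($(prodMap_snd p₁ p₂ s₁ s₂) x)
  rw [Scheme.Hom.comp_apply, Scheme.Hom.comp_apply] at e₁ e₂
  simp only [Set.mem_preimage, Set.mem_inter_iff, e₁, e₂]

theorem dense_prodMap_preimage {U₁ : Set B₁} {U₂ : Set B₂} (ho : IsOpen U₁) (h₁ : Dense (p₁ ⁻¹' U₁))
    (h₂ : Dense (p₂ ⁻¹' U₂)) :
    Dense (prodMap p₁ p₂ s₁ s₂ ⁻¹' (pullback.fst s₁ s₂ ⁻¹' U₁ ∩ pullback.snd s₁ s₂ ⁻¹' U₂)) := by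
  rw [prodMap_preimage]
  have : Subsingleton (Spec (.of k)) := inferInstanceAs (Subsingleton (PrimeSpectrum k))
  have d₁ := h₁.preimage (pullback.fst (p₁ ≫ s₁) (p₂ ≫ s₂)).isOpenMap
  have d₂ := h₂.preimage (pullback.snd (p₁ ≫ s₁) (p₂ ≫ s₂)).isOpenMap
  exact d₁.inter_of_isOpen_left d₂
    ((ho.preimage p₁.continuous).preimage (pullback.fst (p₁ ≫ s₁) (p₂ ≫ s₂)).continuous)

variable {T₁ T₂ : Type} [CommRing T₁] [CommRing T₂] [Algebra k T₁] [Algebra k T₂]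

theorem prodChart_prodRot (h₁ : Spec (.of T₁) ⟶ Y₁) (h₂ : Spec (.of T₂) ⟶ Y₂)
    (e₁ : h₁ ≫ p₁ ≫ s₁ = Spec.map (CommRingCat.ofHom (algebraMap k T₁)))
    (e₂ : h₂ ≫ p₂ ≫ s₂ = Spec.map (CommRingCat.ofHom (algebraMap k T₂)))
    (g₁ : Y₁ ⟶ Y₁) (g₂ : Y₂ ⟶ Y₂) (hg₁ : g₁ ≫ p₁ = p₁) (hg₂ : g₂ ≫ p₂ = p₂)
    (τ₁ : T₁ →ₐ[k] T₁) (τ₂ : T₂ →ₐ[k] T₂)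
    (hτ₁ : Spec.map (CommRingCat.ofHom τ₁.toRingHom) ≫ h₁ = h₁ ≫ g₁)
    (hτ₂ : Spec.map (CommRingCat.ofHom τ₂.toRingHom) ≫ h₂ = h₂ ≫ g₂) :
    Spec.map (CommRingCat.ofHom (Algebra.TensorProduct.map τ₁ τ₂).toRingHom) ≫
        prodChart (p₁ ≫ s₁) (p₂ ≫ s₂) h₁ h₂ e₁ e₂ =
      prodChart (p₁ ≫ s₁) (p₂ ≫ s₂) h₁ h₂ e₁ e₂ ≫ prodRot p₁ p₂ s₁ s₂ g₁ g₂ hg₁ hg₂ := by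
  refine pullback.hom_ext ?_ ?_
  · have e : prodRot p₁ p₂ s₁ s₂ g₁ g₂ hg₁ hg₂ ≫ pullback.fst _ _ = pullback.fst _ _ ≫ g₁ :=
      pullback.lift_fst _ _ _
    rw [Category.assoc, Category.assoc, e, prodChart_fst, reassoc_of% (prodChart_fst e₁ e₂),
      ← hτ₁, ← Spec.map_comp_assoc, ← Spec.map_comp_assoc]
    congr 2
    ext x
    simp
  · have e : prodRot p₁ p₂ s₁ s₂ g₁ g₂ hg₁ hg₂ ≫ pullback.snd _ _ = pullback.snd _ _ ≫ g₂ :=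
      pullback.lift_snd _ _ _
    rw [Category.assoc, Category.assoc, e, prodChart_snd, reassoc_of% (prodChart_snd e₁ e₂),
      ← hτ₂, ← Spec.map_comp_assoc, ← Spec.map_comp_assoc]
    congr 2
    ext x
    simp

/-- The quotient of a product of two coverings, over a product of affine open subsets. -/
theorem exists_openImmersion_prodQuotient [IsAffineHom p₁] [IsAffineHom p₂]
    {A₁ A₂ : Type} [CommRing A₁] [CommRing A₂] [Algebra k A₁] [Algebra k A₂]
    (i₁ : Spec (.of A₁) ⟶ B₁) (i₂ : Spec (.of A₂) ⟶ B₂) [IsOpenImmersion i₁] [IsOpenImmersion i₂]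
    (f₁ : i₁ ≫ s₁ = Spec.map (CommRingCat.ofHom (algebraMap k A₁)))
    (f₂ : i₂ ≫ s₂ = Spec.map (CommRingCat.ofHom (algebraMap k A₂)))
    (hd₁ : Dense (p₁ ⁻¹' Set.range i₁)) (hd₂ : Dense (p₂ ⁻¹' Set.range i₂))
    (h₁ : Spec (.of T₁) ⟶ Y₁) (h₂ : Spec (.of T₂) ⟶ Y₂)
    [Algebra A₁ T₁] [Algebra A₂ T₂] [IsScalarTower k A₁ T₁] [IsScalarTower k A₂ T₂]
    (hp₁ : IsPullback h₁ (Spec.map (CommRingCat.ofHom (algebraMap A₁ T₁))) p₁ i₁)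
    (hp₂ : IsPullback h₂ (Spec.map (CommRingCat.ofHom (algebraMap A₂ T₂))) p₂ i₂)
    (g₁ : Y₁ ⟶ Y₁) (g₂ : Y₂ ⟶ Y₂) (hg₁ : g₁ ≫ p₁ = p₁) (hg₂ : g₂ ≫ p₂ = p₂)
    (τ₁ : T₁ →ₐ[k] T₁) (τ₂ : T₂ →ₐ[k] T₂)
    (hτ₁ : Spec.map (CommRingCat.ofHom τ₁.toRingHom) ≫ h₁ = h₁ ≫ g₁)
    (hτ₂ : Spec.map (CommRingCat.ofHom τ₂.toRingHom) ≫ h₂ = h₂ ≫ g₂)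
    {R : Type} [CommRing R] [Algebra k R] (ρ : R →ₐ[k] T₁ ⊗[k] T₂) (hρ : Function.Injective ρ)
    (hinv : ∀ m, Algebra.TensorProduct.map τ₁ τ₂ m = m ↔ m ∈ ρ.range) :
    ∃ q : Spec (.of R) ⟶ cyclicQuotient _ _ (prodRot_prodMap p₁ p₂ s₁ s₂ g₁ g₂ hg₁ hg₂),
      IsOpenImmersion q ∧ DenseRange q ∧
      q ≫ cyclicQuotient.toBase _ _ (prodRot_prodMap p₁ p₂ s₁ s₂ g₁ g₂ hg₁ hg₂) ≫
        pullback.fst s₁ s₂ ≫ s₁ = Spec.map (CommRingCat.ofHom (algebraMap k R)) := by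
  have e₁ : h₁ ≫ p₁ ≫ s₁ = Spec.map (CommRingCat.ofHom (algebraMap k T₁)) := by
    rw [reassoc_of% hp₁.w, f₁, ← Spec.map_comp, ← CommRingCat.ofHom_comp,
      IsScalarTower.algebraMap_eq k A₁ T₁]
  have e₂ : h₂ ≫ p₂ ≫ s₂ = Spec.map (CommRingCat.ofHom (algebraMap k T₂)) := by
    rw [reassoc_of% hp₂.w, f₂, ← Spec.map_comp, ← CommRingCat.ofHom_comp,
      IsScalarTower.algebraMap_eq k A₂ T₂]
  have : IsOpenImmersion h₁ := MorphismProperty.of_isPullback hp₁.flip inferInstance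
  have : IsOpenImmersion h₂ := MorphismProperty.of_isPullback hp₂.flip inferInstance
  let i := prodChart s₁ s₂ i₁ i₂ f₁ f₂
  let h := prodChart (p₁ ≫ s₁) (p₂ ≫ s₂) h₁ h₂ e₁ e₂
  have hi := range_prodChart f₁ f₂
  have hrange : h.opensRange = prodMap p₁ p₂ s₁ s₂ ⁻¹ᵁ i.opensRange := by
    refine TopologicalSpace.Opens.ext ?_
    change Set.range h = prodMap p₁ p₂ s₁ s₂ ⁻¹' Set.range i
    rw [range_prodChart, range_prodChart, prodMap_preimage, range_eq_of_isPullback hp₁,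
      range_eq_of_isPullback hp₂]
  obtain ⟨q, hq, hq₁, hq₂⟩ := cyclicQuotient.exists_openImmersion _ _
    (prodRot_prodMap p₁ p₂ s₁ s₂ g₁ g₂ hg₁ hg₂) ⟨i.opensRange, isAffineOpen_opensRange i⟩ h hrange _
    (prodChart_prodRot p₁ p₂ s₁ s₂ h₁ h₂ e₁ e₂ g₁ g₂ hg₁ hg₂ τ₁ τ₂ hτ₁ hτ₂)
    (CommRingCat.ofHom ρ.toRingHom) hρ hinv
  refine ⟨q, hq, ?_, ?_⟩
  · rw [DenseRange, hq₁]
    refine cyclicQuotient.dense_preimage _ _ _ _ ?_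
    change Dense (prodMap p₁ p₂ s₁ s₂ ⁻¹' Set.range i)
    rw [range_prodChart]
    exact dense_prodMap_preimage p₁ p₂ s₁ s₂ i₁.isOpenEmbedding.isOpen_range hd₁ hd₂
  · obtain ⟨ψ, hψ⟩ := Spec.map_surjective (q ≫ cyclicQuotient.toBase _ _
      (prodRot_prodMap p₁ p₂ s₁ s₂ g₁ g₂ hg₁ hg₂) ≫ pullback.fst s₁ s₂ ≫ s₁)
    rw [← hψ]
    congr 1
    refine CommRingCat.hom_ext (RingHom.ext fun x ↦ hρ ?_)
    have h₃ : Spec.map (CommRingCat.ofHom ρ.toRingHom) ≫ Spec.map ψ =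
        Spec.map (CommRingCat.ofHom (algebraMap k (T₁ ⊗[k] T₂))) := by
      have e₃ : prodMap p₁ p₂ s₁ s₂ ≫ pullback.fst s₁ s₂ ≫ s₁ = pullback.fst _ _ ≫ p₁ ≫ s₁ := by
        rw [reassoc_of% (prodMap_fst p₁ p₂ s₁ s₂)]
      rw [hψ, reassoc_of% hq₂, e₃, reassoc_of% (prodChart_fst e₁ e₂), e₁, ← Spec.map_comp,
        ← CommRingCat.ofHom_comp]
    rw [← Spec.map_comp, Spec.map_inj] at h₃
    exact (congr($h₃ x) : ρ (ψ x) = _).trans (ρ.commutes x).symm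

end Product

section KummerTensor
open Polynomial TensorProduct

section
variable {k A T : Type} [CommRing k] [CommRing A] [CommRing T] [Algebra k A] [Algebra k T]
  {n : ℕ} {a : A}

/-- The homomorphism `A[w] / (w ^ n - a) ⟶ T` given by an `n`-th root `x` of the image of `a`. -/
def kummerLift (i : A →ₐ[k] T) (x : T) (hx : x ^ n = i a) : AdjoinRoot (X ^ n - C a) →ₐ[k] T :=
  AdjoinRoot.liftAlgHom _ i x (by simp [hx])

@[simp]
theorem kummerLift_of (i : A →ₐ[k] T) (x : T) (hx : x ^ n = i a) (b : A) :
    kummerLift i x hx (AdjoinRoot.of _ b) = i b := by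
  simp [kummerLift]

@[simp]
theorem kummerLift_root (i : A →ₐ[k] T) (x : T) (hx : x ^ n = i a) :
    kummerLift i x hx (AdjoinRoot.root _) = x := by
  simp [kummerLift]

/-- The inverse of the root of `w ^ n = a`. -/
def kummerRootInv (n : ℕ) (a : Aˣ) : AdjoinRoot (X ^ n - C (a : A)) :=
  AdjoinRoot.of _ (a⁻¹ : Aˣ).1 * AdjoinRoot.root _ ^ (n - 1)

theorem kummerRootInv_mul (hn : n ≠ 0) (a : Aˣ) :
    kummerRootInv n a * AdjoinRoot.root (X ^ n - C (a : A)) = 1 := by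
  rw [kummerRootInv, mul_assoc, ← pow_succ, Nat.sub_add_cancel (Nat.pos_of_ne_zero hn),
    kummerRing_root_pow, ← map_mul]
  simp

theorem kummerRootInv_pow (hn : n ≠ 0) (a : Aˣ) :
    kummerRootInv n a ^ n = AdjoinRoot.of (X ^ n - C (a : A)) (a⁻¹ : Aˣ).1 := by
  have h := congrArg (· ^ n) (kummerRootInv_mul hn a)
  simp only [mul_pow, kummerRing_root_pow, one_pow] at h
  calc _ = AdjoinRoot.of (X ^ n - C (a : A)) (a⁻¹ : Aˣ).1 * (AdjoinRoot.of _ (a : A) *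
      kummerRootInv n a ^ n) := by rw [← mul_assoc, ← map_mul]; simp
    _ = _ := by rw [mul_comm (AdjoinRoot.of _ (a : A)), h, mul_one]

end

variable (k : Type) {A₁ A₂ : Type} [CommRing k] [CommRing A₁] [CommRing A₂] [Algebra k A₁]
  [Algebra k A₂] (n : ℕ) (a₁ : A₁) (a₂ : A₂ˣ)

/-- The ring `(A₁ ⊗ A₂)[r] / (r ^ n - a₁ / a₂)`. -/
abbrev KummerQuotientRing : Type := AdjoinRoot (X ^ n - C (a₁ ⊗ₜ[k] (a₂⁻¹ : A₂ˣ).1))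

variable {n}

/-- The embedding `r ↦ y / v` of `(A₁ ⊗ A₂)[r] / (r ^ n - a₁ / a₂)` in
`A₁[y] / (y ^ n - a₁) ⊗ A₂[v] / (v ^ n - a₂)`. -/
def kummerQuotientToTensor (hn : n ≠ 0) : KummerQuotientRing k n a₁ a₂ →ₐ[k]
    AdjoinRoot (X ^ n - C a₁) ⊗[k] AdjoinRoot (X ^ n - C (a₂ : A₂)) :=
  kummerLift (Algebra.TensorProduct.map (AdjoinRoot.ofAlgHom k _) (AdjoinRoot.ofAlgHom k _))
    (AdjoinRoot.root _ ⊗ₜ kummerRootInv n a₂) (by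
      rw [Algebra.TensorProduct.tmul_pow, kummerRing_root_pow, kummerRootInv_pow hn]
      rfl)

variable (n) in
/-- The Kummer extension `R[v] / (v ^ n - a₂)` of `R = (A₁ ⊗ A₂)[r] / (r ^ n - a₁ / a₂)`. -/
abbrev KummerTower : Type := AdjoinRoot (X ^ n - C (AdjoinRoot.of _
  ((1 : A₁) ⊗ₜ[k] (a₂ : A₂)) : KummerQuotientRing k n a₁ a₂))

/-- The homomorphism `R[v] / (v ^ n - a₂) ⟶ A₁[y] / (y ^ n - a₁) ⊗ A₂[v] / (v ^ n - a₂)`. -/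
def kummerTowerToTensor (hn : n ≠ 0) : KummerTower k n a₁ a₂ →ₐ[k]
    AdjoinRoot (X ^ n - C a₁) ⊗[k] AdjoinRoot (X ^ n - C (a₂ : A₂)) :=
  kummerLift (kummerQuotientToTensor k a₁ a₂ hn) (1 ⊗ₜ AdjoinRoot.root _) (by
    rw [Algebra.TensorProduct.tmul_pow, kummerRing_root_pow, kummerQuotientToTensor, kummerLift_of]
    simp)

variable (n) in
/-- The inclusion of `A₁ ⊗ A₂` in `R[v] / (v ^ n - a₂)`. -/
def baseToKummerTower : A₁ ⊗[k] A₂ →ₐ[k] KummerTower k n a₁ a₂ :=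
  (AdjoinRoot.ofAlgHom k _).comp (AdjoinRoot.ofAlgHom k _)

variable (n) in
/-- The homomorphism `y ↦ r * v` from `A₁[y] / (y ^ n - a₁)` to `R[v] / (v ^ n - a₂)`. -/
def leftToKummerTower : AdjoinRoot (X ^ n - C a₁) →ₐ[k] KummerTower k n a₁ a₂ :=
  kummerLift ((baseToKummerTower k n a₁ a₂).comp Algebra.TensorProduct.includeLeft)
    (AdjoinRoot.of _ (AdjoinRoot.root _) * AdjoinRoot.root _) (by
      rw [mul_pow, ← map_pow, kummerRing_root_pow, kummerRing_root_pow, ← map_mul, ← map_mul]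
      simp [baseToKummerTower])

variable (n) in
/-- The homomorphism `v ↦ v` from `A₂[v] / (v ^ n - a₂)` to `R[v] / (v ^ n - a₂)`. -/
def rightToKummerTower : AdjoinRoot (X ^ n - C (a₂ : A₂)) →ₐ[k] KummerTower k n a₁ a₂ :=
  kummerLift ((baseToKummerTower k n a₁ a₂).comp Algebra.TensorProduct.includeRight)
    (AdjoinRoot.root _) (by rw [kummerRing_root_pow]; rfl)

variable (n) in
/-- The homomorphism `A₁[y] / (y ^ n - a₁) ⊗ A₂[v] / (v ^ n - a₂) ⟶ R[v] / (v ^ n - a₂)`. -/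
def tensorToKummerTower : AdjoinRoot (X ^ n - C a₁) ⊗[k] AdjoinRoot (X ^ n - C (a₂ : A₂)) →ₐ[k]
    KummerTower k n a₁ a₂ :=
  Algebra.TensorProduct.lift (leftToKummerTower k n a₁ a₂) (rightToKummerTower k n a₁ a₂)
    fun _ _ ↦ Commute.all _ _

theorem kummerQuotientToTensor_root (hn : n ≠ 0) :
    kummerQuotientToTensor k a₁ a₂ hn (AdjoinRoot.root _) =
      AdjoinRoot.root _ ⊗ₜ kummerRootInv n a₂ := by
  rw [kummerQuotientToTensor, kummerLift_root]

theorem kummerQuotientToTensor_of_tmul (hn : n ≠ 0) (x : A₁) (y : A₂) :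
    kummerQuotientToTensor k a₁ a₂ hn (AdjoinRoot.of _ (x ⊗ₜ y)) =
      AdjoinRoot.of _ x ⊗ₜ AdjoinRoot.of _ y := by
  rw [kummerQuotientToTensor, kummerLift_of]
  rfl

theorem kummerTowerToTensor_root (hn : n ≠ 0) :
    kummerTowerToTensor k a₁ a₂ hn (AdjoinRoot.root _) = 1 ⊗ₜ AdjoinRoot.root _ := by
  rw [kummerTowerToTensor, kummerLift_root]

theorem kummerTowerToTensor_of (hn : n ≠ 0) (x : KummerQuotientRing k n a₁ a₂) :
    kummerTowerToTensor k a₁ a₂ hn (AdjoinRoot.of _ x) = kummerQuotientToTensor k a₁ a₂ hn x := by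
  rw [kummerTowerToTensor, kummerLift_of]

theorem kummerTowerToTensor_comp (hn : n ≠ 0) :
    (kummerTowerToTensor k a₁ a₂ hn).comp (tensorToKummerTower k n a₁ a₂) = AlgHom.id k _ := by
  refine Algebra.TensorProduct.ext ?_ ?_
  · refine AdjoinRoot.algHom_ext' (AlgHom.ext fun x ↦ ?_) ?_
    · simp [tensorToKummerTower, leftToKummerTower, baseToKummerTower, kummerTowerToTensor_of,
        kummerQuotientToTensor_of_tmul]
    · simp [tensorToKummerTower, leftToKummerTower, kummerTowerToTensor_of, kummerTowerToTensor_root,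
        kummerQuotientToTensor_root, kummerRootInv_mul hn]
  · refine AdjoinRoot.algHom_ext' (AlgHom.ext fun x ↦ ?_) ?_
    · simp [tensorToKummerTower, rightToKummerTower, baseToKummerTower, kummerTowerToTensor_of,
        kummerQuotientToTensor_of_tmul]
    · simp [tensorToKummerTower, rightToKummerTower, kummerTowerToTensor_root]

theorem tensorToKummerTower_comp (hn : n ≠ 0) :
    (tensorToKummerTower k n a₁ a₂).comp (kummerTowerToTensor k a₁ a₂ hn) = AlgHom.id k _ := by
  refine AdjoinRoot.algHom_ext' (AdjoinRoot.algHom_ext' (Algebra.TensorProduct.ext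
    (AlgHom.ext fun x ↦ ?_) (AlgHom.ext fun x ↦ ?_)) ?_) ?_
  · simp [tensorToKummerTower, leftToKummerTower, baseToKummerTower, kummerTowerToTensor_of,
      kummerQuotientToTensor_of_tmul]
  · simp [tensorToKummerTower, rightToKummerTower, baseToKummerTower, kummerTowerToTensor_of,
      kummerQuotientToTensor_of_tmul]
  · have h := congrArg (rightToKummerTower k n a₁ a₂) (kummerRootInv_mul hn a₂)
    have hr : rightToKummerTower k n a₁ a₂ (AdjoinRoot.root _) = AdjoinRoot.root _ := by
      simp [rightToKummerTower]
    rw [map_mul, map_one, hr] at h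
    simp only [AlgHom.comp_apply, AdjoinRoot.coe_ofAlgHom, kummerTowerToTensor_of,
      kummerQuotientToTensor_root, tensorToKummerTower, Algebra.TensorProduct.lift_tmul,
      leftToKummerTower, kummerLift_root, AlgHom.id_apply]
    rw [mul_assoc, mul_comm (AdjoinRoot.root _), h, mul_one]
  · simp [tensorToKummerTower, rightToKummerTower, kummerTowerToTensor_root]

theorem kummerTowerToTensor_bijective (hn : n ≠ 0) :
    Function.Bijective (kummerTowerToTensor k a₁ a₂ hn) :=
  Function.bijective_iff_has_inverse.mpr ⟨tensorToKummerTower k n a₁ a₂,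
    fun x ↦ congr($(tensorToKummerTower_comp k a₁ a₂ hn) x),
    fun x ↦ congr($(kummerTowerToTensor_comp k a₁ a₂ hn) x)⟩

theorem of_kummerRing_injective {A : Type} [CommRing A] {a : A} (hn : n ≠ 0) :
    Function.Injective (AdjoinRoot.of (X ^ n - C a)) := by
  rw [injective_iff_map_eq_zero]
  intro x hx
  refine kummerRing_sum_eq_zero hn (c := fun j ↦ if j = 0 then x else 0) (a := a) (j := 0) ?_
    (Nat.pos_of_ne_zero hn) |>.symm.trans (by simp) |>.symm
  refine Finset.sum_eq_zero fun j _ ↦ ?_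
  obtain rfl | h := eq_or_ne j 0
  · simp [hx]
  · simp [h]

theorem kummerQuotientToTensor_injective (hn : n ≠ 0) :
    Function.Injective (kummerQuotientToTensor k a₁ a₂ hn) := by
  have : ⇑(kummerQuotientToTensor k a₁ a₂ hn) =
      kummerTowerToTensor k a₁ a₂ hn ∘ AdjoinRoot.of _ := by
    ext x
    exact (kummerTowerToTensor_of k a₁ a₂ hn x).symm
  rw [this]
  exact (kummerTowerToTensor_bijective k a₁ a₂ hn).1.comp (of_kummerRing_injective hn)

/-- The automorphism `w ↦ ζ * w` of `A[w] / (w ^ n - a)` for a root of unity `ζ` in `k`. -/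
def kummerRotOver {A : Type} [CommRing A] [Algebra k A] (a : A) {ζ : k} (hζ : ζ ^ n = 1) :
    AdjoinRoot (X ^ n - C a) →ₐ[k] AdjoinRoot (X ^ n - C a) :=
  (kummerRot n a (algebraMap k A ζ) (by rw [← map_pow, hζ, map_one])).restrictScalars k

variable {k}

theorem kummerRotOver_of {A : Type} [CommRing A] [Algebra k A] (a : A) {ζ : k} (hζ : ζ ^ n = 1)
    (x : A) : kummerRotOver k a hζ (AdjoinRoot.of _ x) = AdjoinRoot.of _ x :=
  (kummerRot n a (algebraMap k A ζ) (by rw [← map_pow, hζ, map_one])).commutes x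

theorem kummerRotOver_root {A : Type} [CommRing A] [Algebra k A] (a : A) {ζ : k} (hζ : ζ ^ n = 1) :
    kummerRotOver k a hζ (AdjoinRoot.root _) = ζ • AdjoinRoot.root _ := by
  change kummerRot n a (algebraMap k A ζ) (by rw [← map_pow, hζ, map_one]) _ = _
  rw [kummerRot_root, Algebra.smul_def,
    IsScalarTower.algebraMap_apply k A (AdjoinRoot (X ^ n - C a)), AdjoinRoot.algebraMap_eq]

theorem kummerRotOver_rootInv {ζ : k} (hζ : ζ ^ n = 1) :
    kummerRotOver k (a₂ : A₂) hζ (kummerRootInv n a₂) = ζ ^ (n - 1) • kummerRootInv n a₂ := by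
  rw [kummerRootInv, map_mul, map_pow, kummerRotOver_root, kummerRotOver_of, _root_.smul_pow,
    mul_smul_comm]

theorem map_rot_kummerQuotientToTensor (hn : n ≠ 0) {ζ : k} (hζ : ζ ^ n = 1) :
    (Algebra.TensorProduct.map (kummerRotOver k a₁ hζ) (kummerRotOver k (a₂ : A₂) hζ)).comp
      (kummerQuotientToTensor k a₁ a₂ hn) = kummerQuotientToTensor k a₁ a₂ hn := by
  refine AdjoinRoot.algHom_ext' (Algebra.TensorProduct.ext
    (AlgHom.ext fun x ↦ ?_) (AlgHom.ext fun x ↦ ?_)) ?_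
  · simp [kummerQuotientToTensor_of_tmul, kummerRotOver_of]
  · simp [kummerQuotientToTensor_of_tmul, kummerRotOver_of]
  · rw [AlgHom.comp_apply, kummerQuotientToTensor_root, Algebra.TensorProduct.map_tmul,
      kummerRotOver_root, kummerRotOver_rootInv a₂, smul_tmul_smul, ← pow_succ',
      Nat.sub_add_cancel (Nat.pos_of_ne_zero hn), hζ, one_smul]

theorem map_rot_kummerTowerToTensor (hn : n ≠ 0) {ζ : k} (hζ : ζ ^ n = 1) :
    (Algebra.TensorProduct.map (kummerRotOver k a₁ hζ) (kummerRotOver k (a₂ : A₂) hζ)).comp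
      (kummerTowerToTensor k a₁ a₂ hn) =
        (kummerTowerToTensor k a₁ a₂ hn).comp (kummerRotOver k _ hζ) := by
  refine AdjoinRoot.algHom_ext' (AlgHom.ext fun x ↦ ?_) ?_
  · simp only [AlgHom.comp_apply, AdjoinRoot.coe_ofAlgHom, kummerRotOver_of, kummerTowerToTensor_of]
    exact congr($(map_rot_kummerQuotientToTensor a₁ a₂ hn hζ) x)
  · simp [kummerTowerToTensor_root, kummerRotOver_root]

/-- The invariants of `(y, v) ↦ (ζ * y, ζ * v)` are generated by `y / v`. -/
theorem map_rot_eq_self_iff (hn : n ≠ 0) {ζ : k} (hζ : ζ ^ n = 1)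
    (hu : ∀ j < n, j ≠ 0 → IsUnit (ζ ^ j - 1))
    (m : AdjoinRoot (X ^ n - C a₁) ⊗[k] AdjoinRoot (X ^ n - C (a₂ : A₂))) :
    Algebra.TensorProduct.map (kummerRotOver k a₁ hζ) (kummerRotOver k (a₂ : A₂) hζ) m = m ↔
      m ∈ (kummerQuotientToTensor k a₁ a₂ hn).range := by
  have hb := kummerTowerToTensor_bijective k a₁ a₂ hn
  obtain ⟨z, rfl⟩ := hb.2 m
  have h : Algebra.TensorProduct.map (kummerRotOver k a₁ hζ) (kummerRotOver k (a₂ : A₂) hζ)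
      (kummerTowerToTensor k a₁ a₂ hn z) = kummerTowerToTensor k a₁ a₂ hn (kummerRotOver k _ hζ z) :=
    congr($(map_rot_kummerTowerToTensor a₁ a₂ hn hζ) z)
  rw [h, hb.1.eq_iff]
  refine (kummerRot_eq_self_iff hn (by rw [← map_pow, hζ, map_one]) (fun j hj hj₀ ↦ ?_) z).trans ⟨?_, ?_⟩
  · rw [← map_pow, ← map_one (algebraMap k _), ← map_sub]
    exact (hu j hj hj₀).map _
  · rintro ⟨x, rfl⟩
    exact ⟨x, (kummerTowerToTensor_of k a₁ a₂ hn x).symm⟩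
  · rintro ⟨x, hx⟩
    exact ⟨x, hb.1 ((kummerTowerToTensor_of k a₁ a₂ hn x).trans hx)⟩

end KummerTensor

section Algebra
open Polynomial TensorProduct

section
variable {k A B T : Type} [CommRing k] [CommRing A] [CommRing B] [CommRing T] [Algebra k A]
  [Algebra k B] [Algebra k T] [Algebra A B] [IsScalarTower k A B]

theorem exists_algHom_of_isLocalizationAway (s : A) [IsLocalization.Away s B] (f : A →ₐ[k] T)
    (hs : IsUnit (f s)) : ∃ g : B →ₐ[k] T, ∀ x, g (algebraMap A B x) = f x := by
  have h (y : Submonoid.powers s) : IsUnit (f y) := by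
    obtain ⟨_, n, rfl⟩ := y
    simpa using hs.pow n
  exact ⟨IsLocalization.liftAlgHom (M := Submonoid.powers s) h, fun x ↦ by simp⟩

theorem algHom_ext_of_isLocalizationAway (s : A) [IsLocalization.Away s B] {f g : B →ₐ[k] T}
    (h : ∀ x, f (algebraMap A B x) = g (algebraMap A B x)) : f = g :=
  IsLocalization.algHom_ext (Submonoid.powers s) (AlgHom.ext h)

end

variable {A₁ A₂ A₃ : Type} [CommRing A₁] [Algebra ℂ A₁] [Algebra ℂ[X] A₁] [IsScalarTower ℂ ℂ[X] A₁]
  [CommRing A₂] [Algebra ℂ A₂] [Algebra ℂ[X] A₂] [IsScalarTower ℂ ℂ[X] A₂]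
  [CommRing A₃] [Algebra ℂ A₃] [Algebra ℂ[X][X] A₃] [IsScalarTower ℂ ℂ[X][X] A₃]
  (s : ℂ[X]) [IsLocalization.Away s A₁] [IsLocalization.Away (X * (X - 1) * (X + 1) : ℂ[X]) A₂]

variable {T : Type} [CommRing T] [Algebra ℂ T]

variable (T) in
theorem isUnit_two_of_algebra : IsUnit (2 : T) := by
  have := (isUnit_iff_ne_zero.mpr (two_ne_zero : (2 : ℂ) ≠ 0)).map (algebraMap ℂ T)
  rwa [map_ofNat] at this

theorem aeval_algHom_X (j : ℂ[X] →ₐ[ℂ] T) (p : ℂ[X]) : aeval (j X) p = j p := by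
  rw [aeval_algHom_apply, aeval_X_left_apply]

theorem exists_algHom_quotientRing (a₂ : A₂ˣ)
    (ha₂ : (a₂ : A₂) = algebraMap ℂ[X] A₂ (X * (X - 1) ^ 2)) {x u r : T}
    (hx : IsUnit (aeval x s)) (hu : IsUnit (u * (u - 1) * (u + 1)))
    (hr : r ^ 4 * (u * (u - 1) ^ 2) = aeval x s) :
    ∃ φ : KummerQuotientRing ℂ 4 (algebraMap ℂ[X] A₁ s) a₂ →ₐ[ℂ] T,
      φ (AdjoinRoot.of _ (algebraMap ℂ[X] A₁ X ⊗ₜ 1)) = x ∧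
      φ (AdjoinRoot.of _ (1 ⊗ₜ algebraMap ℂ[X] A₂ X)) = u ∧ φ (AdjoinRoot.root _) = r := by
  obtain ⟨φ₁, h₁⟩ := exists_algHom_of_isLocalizationAway (B := A₁) s (aeval (R := ℂ) x) hx
  obtain ⟨φ₂, h₂⟩ := exists_algHom_of_isLocalizationAway (B := A₂) (X * (X - 1) * (X + 1))
    (aeval (R := ℂ) u) (by simpa using hu)
  have h : φ₂ (a₂⁻¹ : A₂ˣ) * (u * (u - 1) ^ 2) = 1 := by
    have : φ₂ ((a₂⁻¹ : A₂ˣ) * (a₂ : A₂)) = 1 := by rw [Units.inv_mul, map_one]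
    rw [map_mul, ha₂, h₂] at this
    simpa using this
  refine ⟨kummerLift (Algebra.TensorProduct.lift φ₁ φ₂ fun _ _ ↦ Commute.all _ _) r ?_, ?_, ?_, ?_⟩
  · rw [Algebra.TensorProduct.lift_tmul, h₁, ← hr, mul_assoc, mul_comm (u * (u - 1) ^ 2), h, mul_one]
  · simp [h₁]
  · simp [h₂]
  · simp

theorem algHom_ext_quotientRing (a₂ : A₂ˣ)
    {f g : KummerQuotientRing ℂ 4 (algebraMap ℂ[X] A₁ s) a₂ →ₐ[ℂ] T}
    (hx : f (AdjoinRoot.of _ (algebraMap ℂ[X] A₁ X ⊗ₜ 1)) =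
      g (AdjoinRoot.of _ (algebraMap ℂ[X] A₁ X ⊗ₜ 1)))
    (hu : f (AdjoinRoot.of _ (1 ⊗ₜ algebraMap ℂ[X] A₂ X)) =
      g (AdjoinRoot.of _ (1 ⊗ₜ algebraMap ℂ[X] A₂ X)))
    (hr : f (AdjoinRoot.root _) = g (AdjoinRoot.root _)) : f = g := by
  refine AdjoinRoot.algHom_ext' (Algebra.TensorProduct.ext
    (algHom_ext_of_isLocalizationAway s fun p ↦ ?_)
    (algHom_ext_of_isLocalizationAway (X * (X - 1) * (X + 1) : ℂ[X]) fun p ↦ ?_)) hr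
  · let j : ℂ[X] →ₐ[ℂ] KummerQuotientRing ℂ 4 (algebraMap ℂ[X] A₁ s) a₂ :=
      (AdjoinRoot.ofAlgHom ℂ _).comp (Algebra.TensorProduct.includeLeft.comp
        (IsScalarTower.toAlgHom ℂ ℂ[X] A₁))
    have : f.comp j = g.comp j := Polynomial.algHom_ext hx
    exact congr($this p)
  · let j : ℂ[X] →ₐ[ℂ] KummerQuotientRing ℂ 4 (algebraMap ℂ[X] A₁ s) a₂ :=
      (AdjoinRoot.ofAlgHom ℂ _).comp (Algebra.TensorProduct.includeRight.comp
        (IsScalarTower.toAlgHom ℂ ℂ[X] A₂))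
    have : f.comp j = g.comp j := Polynomial.algHom_ext hu
    exact congr($this p)

theorem exists_algHom_doubleCover [IsLocalization.Away (X * C s * (X ^ 4 + C s) : ℂ[X][X]) A₃]
    {a₃ : A₃} (ha₃ : a₃ * algebraMap ℂ[X][X] A₃ (X ^ 4) =
      algebraMap ℂ[X][X] A₃ (X ^ 4 + C s)) {x t w : T} (hu : IsUnit (t * aeval x s * (t ^ 4 + aeval x s)))
    (hw : w ^ 2 * t ^ 4 = t ^ 4 + aeval x s) :
    ∃ φ : AdjoinRoot (X ^ 2 - C a₃) →ₐ[ℂ] T,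
      φ (AdjoinRoot.of _ (algebraMap ℂ[X][X] A₃ (C X))) = x ∧
      φ (AdjoinRoot.of _ (algebraMap ℂ[X][X] A₃ X)) = t ∧ φ (AdjoinRoot.root _) = w := by
  let ψ : ℂ[X][X] →ₐ[ℂ] T := aevalAeval x t
  have hC (p : ℂ[X]) : ψ (C p) = aeval x p := by simp [ψ]
  have hX : ψ X = t := by simp [ψ]
  obtain ⟨φ, hφ⟩ := exists_algHom_of_isLocalizationAway (B := A₃)
    (X * C s * (X ^ 4 + C s)) ψ (by simpa only [map_mul, map_add, map_pow, hC, hX] using hu)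
  refine ⟨kummerLift φ w ?_, ?_, ?_, ?_⟩
  · have ht : IsUnit (t ^ 4) := (isUnit_of_mul_isUnit_left (isUnit_of_mul_isUnit_left hu)).pow 4
    have := congrArg φ ha₃
    rw [map_mul, hφ, hφ, map_add, map_pow, hX, hC, ← hw] at this
    exact (ht.mul_right_cancel this).symm
  · rw [kummerLift_of, hφ, hC, aeval_X]
  · rw [kummerLift_of, hφ, hX]
  · rw [kummerLift_root]

theorem algHom_ext_doubleCover [IsLocalization.Away (X * C s * (X ^ 4 + C s) : ℂ[X][X]) A₃]
    {a₃ : A₃} {f g : AdjoinRoot (X ^ 2 - C a₃) →ₐ[ℂ] T}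
    (hx : f (AdjoinRoot.of _ (algebraMap ℂ[X][X] A₃ (C X))) =
      g (AdjoinRoot.of _ (algebraMap ℂ[X][X] A₃ (C X))))
    (ht : f (AdjoinRoot.of _ (algebraMap ℂ[X][X] A₃ X)) =
      g (AdjoinRoot.of _ (algebraMap ℂ[X][X] A₃ X)))
    (hw : f (AdjoinRoot.root _) = g (AdjoinRoot.root _)) : f = g := by
  refine AdjoinRoot.algHom_ext'
    (algHom_ext_of_isLocalizationAway (X * C s * (X ^ 4 + C s) : ℂ[X][X]) fun p ↦ ?_) hw
  let j : ℂ[X][X] →ₐ[ℂ] AdjoinRoot (X ^ 2 - C a₃) :=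
    (AdjoinRoot.ofAlgHom ℂ _).comp (IsScalarTower.toAlgHom ℂ ℂ[X][X] A₃)
  have hj : (f.comp j).comp CAlgHom = (g.comp j).comp CAlgHom := Polynomial.algHom_ext hx
  have : (f.comp j).toRingHom = (g.comp j).toRingHom :=
    Polynomial.ringHom_ext (fun q ↦ congr($hj q)) ht
  exact congr($this p)

/-- The substitution `u = (w - 1) / (w + 1)`, `r = t * (w + 1) / √2` identifies the universal solution
of `r ^ 4 * u * (u - 1) ^ 2 = s(x)` with that of `w ^ 2 * t ^ 4 = t ^ 4 + s(x)`. -/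
theorem nonempty_algEquiv_of_universal {R B : Type} [CommRing R] [Algebra ℂ R] [CommRing B]
    [Algebra ℂ B] {x u r : R} {x' t w : B} (hS : IsUnit (aeval x s))
    (hU : IsUnit (u * (u - 1) * (u + 1))) (hrr : r ^ 4 * (u * (u - 1) ^ 2) = aeval x s)
    (hT : IsUnit (t * aeval x' s * (t ^ 4 + aeval x' s))) (hww : w ^ 2 * t ^ 4 = t ^ 4 + aeval x' s)
    (hext : ∀ {f g : R →ₐ[ℂ] R}, f x = g x → f u = g u → f r = g r → f = g)
    (hext' : ∀ {f g : B →ₐ[ℂ] B}, f x' = g x' → f t = g t → f w = g w → f = g)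
    (hlift : ∀ {y v q : B}, IsUnit (aeval y s) → IsUnit (v * (v - 1) * (v + 1)) →
      q ^ 4 * (v * (v - 1) ^ 2) = aeval y s → ∃ φ : R →ₐ[ℂ] B, φ x = y ∧ φ u = v ∧ φ r = q)
    (hlift' : ∀ {y q v : R}, IsUnit (q * aeval y s * (q ^ 4 + aeval y s)) →
      v ^ 2 * q ^ 4 = q ^ 4 + aeval y s → ∃ φ : B →ₐ[ℂ] R, φ x' = y ∧ φ t = q ∧ φ w = v) :
    Nonempty (R ≃ₐ[ℂ] B) := by
  obtain ⟨c, hc⟩ : ∃ c : ℂ, c ^ 2 = 1 / 2 := IsAlgClosed.exists_pow_nat_eq _ (by norm_num)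
  replace hc : c ^ 2 * 2 = 1 := by rw [hc]; norm_num
  have hcB : algebraMap ℂ B c ^ 2 * 2 = 1 := by
    rw [← map_pow, ← map_ofNat (algebraMap ℂ B) 2, ← map_mul, hc, map_one]
  have hcR : algebraMap ℂ R c ^ 2 * 2 = 1 := by
    rw [← map_pow, ← map_ofNat (algebraMap ℂ R) 2, ← map_mul, hc, map_one]
  set γ := algebraMap ℂ B c
  set δ := algebraMap ℂ R c
  have hSB := isUnit_of_mul_isUnit_right (isUnit_of_mul_isUnit_left hT)
  have hw₁ : IsUnit (t ^ 4 * (w - 1) * (w + 1)) := by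
    convert! hSB using 1
    linear_combination hww
  have hw₀ : IsUnit w := isUnit_of_mul_isUnit_left (y := w * t ^ 4) (by
    rw [← mul_assoc, ← sq, hww]
    exact isUnit_of_mul_isUnit_right hT)
  obtain ⟨v, hv⟩ := (isUnit_of_mul_isUnit_right hw₁).exists_right_inv
  have hu₁ : IsUnit (1 - u) := by
    rw [← neg_sub]
    exact (isUnit_of_mul_isUnit_right (isUnit_of_mul_isUnit_left hU)).neg
  have hu₂ : IsUnit (1 + u) := by
    rw [add_comm]
    exact isUnit_of_mul_isUnit_right hU
  have hr₀ : IsUnit r := by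
    rw [← hrr] at hS
    exact (isUnit_pow_iff four_ne_zero).mp (isUnit_of_mul_isUnit_left hS)
  obtain ⟨z, hz⟩ := hu₁.exists_right_inv
  have hU₁ : (w - 1) * v - 1 = -2 * v := by linear_combination hv
  have hU₂ : (w - 1) * v + 1 = 2 * w * v := by linear_combination -hv
  have hγ : γ ^ 4 * 4 = 1 := by linear_combination (γ ^ 2 * 2 + 1) * hcB
  have hδ : δ ^ 4 * 4 = 1 := by linear_combination (δ ^ 2 * 2 + 1) * hcR
  obtain ⟨φ, hφx, hφu, hφr⟩ : ∃ φ : R →ₐ[ℂ] B, φ x = x' ∧ φ u = (w - 1) * v ∧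
      φ r = γ * t * (w + 1) := by
    refine hlift hSB ?_ ?_
    · rw [hU₁, hU₂]
      have h₁ := isUnit_of_mul_isUnit_right (isUnit_of_mul_isUnit_left hw₁)
      have h₂ : IsUnit v := .of_mul_eq_one_right _ hv
      have h₃ := isUnit_two_of_algebra B
      exact ((h₁.mul h₂).mul (h₃.neg.mul h₂)).mul ((h₃.mul hw₀).mul h₂)
    · rw [hU₁]
      calc _ = (γ ^ 4 * 4) * t ^ 4 * ((w + 1) * v) ^ 3 * (w ^ 2 - 1) := by ring
        _ = _ := by rw [hγ, hv]; linear_combination hww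
  have ht' : (δ * r * (1 - u)) ^ 4 + aeval x s = δ ^ 4 * r ^ 4 * (1 - u) ^ 2 * (1 + u) ^ 2 := by
    rw [← hrr]
    linear_combination -r ^ 4 * u * (1 - u) ^ 2 * hδ
  obtain ⟨ψ, hψx, hψt, hψw⟩ : ∃ ψ : B →ₐ[ℂ] R, ψ x' = x ∧ ψ t = δ * r * (1 - u) ∧
      ψ w = (1 + u) * z := by
    refine hlift' ?_ ?_
    · rw [ht']
      have h₁ : IsUnit δ := .of_mul_eq_one (δ ^ 3 * 4) (by rw [← hδ]; ring)
      exact (((h₁.mul hr₀).mul hu₁).mul hS).mul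
        ((((h₁.pow 4).mul (hr₀.pow 4)).mul (hu₁.pow 2)).mul (hu₂.pow 2))
    · rw [ht']
      calc _ = δ ^ 4 * r ^ 4 * (1 - u) ^ 2 * (1 + u) ^ 2 * ((1 - u) * z) ^ 2 := by ring
        _ = _ := by rw [hz]; ring
  have hφγ : φ δ = γ := φ.commutes c
  have hψγ : ψ γ = δ := ψ.commutes c
  have hφz := congrArg φ hz
  have hψv := congrArg ψ hv
  rw [map_mul, map_sub, map_one, hφu] at hφz
  rw [map_mul, map_add, map_one, hψw] at hψv
  refine ⟨AlgEquiv.ofAlgHom φ ψ (hext' ?_ ?_ ?_) (hext ?_ ?_ ?_)⟩ <;>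
    rw [AlgHom.comp_apply, AlgHom.id_apply]
  · rw [hψx, hφx]
  · rw [hψt, map_mul, map_mul, map_sub, map_one, hφγ, hφr, hφu]
    linear_combination t * hcB + (2 - (w + 1)) * γ ^ 2 * t * hv
  · rw [hψw, map_mul, map_add, map_one, hφu]
    linear_combination (w - 1) * φ z * hv + w * hφz
  · rw [hφx, hψx]
  · rw [hφu, map_mul, map_sub, map_one, hψw]
    linear_combination u * hψv + (u + 1) * ψ v * hz
  · rw [hφr, map_mul, map_mul, map_add, map_one, hψγ, hψt, hψw]
    linear_combination r * hcR + (1 + u) * δ ^ 2 * r * hz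

theorem exists_doubleCover_algEquiv [IsLocalization.Away (X * C s * (X ^ 4 + C s) : ℂ[X][X]) A₃]
    (a₂ : A₂ˣ) (ha₂ : (a₂ : A₂) = algebraMap ℂ[X] A₂ (X * (X - 1) ^ 2)) {a₃ : A₃}
    (ha₃ : a₃ * algebraMap ℂ[X][X] A₃ (X ^ 4) = algebraMap ℂ[X][X] A₃ (X ^ 4 + C s)) :
    Nonempty (KummerQuotientRing ℂ 4 (algebraMap ℂ[X] A₁ s) a₂ ≃ₐ[ℂ] AdjoinRoot (X ^ 2 - C a₃)) := by
  set R := KummerQuotientRing ℂ 4 (algebraMap ℂ[X] A₁ s) a₂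
  set B := AdjoinRoot (X ^ 2 - C a₃)
  set x : R := AdjoinRoot.of _ (algebraMap ℂ[X] A₁ X ⊗ₜ 1)
  set u : R := AdjoinRoot.of _ (1 ⊗ₜ algebraMap ℂ[X] A₂ X)
  set r : R := AdjoinRoot.root _
  set x' : B := AdjoinRoot.of _ (algebraMap ℂ[X][X] A₃ (C X))
  set t : B := AdjoinRoot.of _ (algebraMap ℂ[X][X] A₃ X)
  set w : B := AdjoinRoot.root _
  let j₁ : ℂ[X] →ₐ[ℂ] R := (AdjoinRoot.ofAlgHom ℂ _).comp
    (Algebra.TensorProduct.includeLeft.comp (IsScalarTower.toAlgHom ℂ ℂ[X] A₁))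
  let j₂ : ℂ[X] →ₐ[ℂ] R := (AdjoinRoot.ofAlgHom ℂ _).comp
    (Algebra.TensorProduct.includeRight.comp (IsScalarTower.toAlgHom ℂ ℂ[X] A₂))
  let j₃ : ℂ[X][X] →ₐ[ℂ] B := (AdjoinRoot.ofAlgHom ℂ _).comp (IsScalarTower.toAlgHom ℂ ℂ[X][X] A₃)
  have hxs : aeval x s = j₁ s := aeval_algHom_X j₁ s
  have hxs' : aeval x' s = j₃ (C s) := aeval_algHom_X (j₃.comp CAlgHom) s
  have hS : IsUnit (aeval x s) := by
    rw [hxs]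
    exact (IsLocalization.Away.algebraMap_isUnit (S := A₁) s).map
      ((AdjoinRoot.ofAlgHom ℂ _).comp Algebra.TensorProduct.includeLeft : A₁ →ₐ[ℂ] R)
  have hU : IsUnit (u * (u - 1) * (u + 1)) := by
    have : u * (u - 1) * (u + 1) = j₂ (X * (X - 1) * (X + 1)) := by
      simp only [map_mul, map_sub, map_add, map_one]
      rfl
    rw [this]
    exact (IsLocalization.Away.algebraMap_isUnit (S := A₂) (X * (X - 1) * (X + 1) : ℂ[X])).map
      ((AdjoinRoot.ofAlgHom ℂ _).comp Algebra.TensorProduct.includeRight : A₂ →ₐ[ℂ] R)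
  have hrr : r ^ 4 * (u * (u - 1) ^ 2) = aeval x s := by
    have h₁ : u * (u - 1) ^ 2 = AdjoinRoot.of _ (1 ⊗ₜ (a₂ : A₂)) := by
      trans j₂ (X * (X - 1) ^ 2)
      · simp only [map_mul, map_sub, map_pow, map_one]
        rfl
      · rw [ha₂]
        rfl
    have h₂ : r ^ 4 = AdjoinRoot.of _ (algebraMap ℂ[X] A₁ s ⊗ₜ[ℂ] (a₂⁻¹ : A₂ˣ).1) :=
      kummerRing_root_pow
    rw [hxs, h₁, h₂, ← map_mul, Algebra.TensorProduct.tmul_mul_tmul, mul_one, Units.inv_mul]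
    rfl
  have hT : IsUnit (t * aeval x' s * (t ^ 4 + aeval x' s)) := by
    have : t * aeval x' s * (t ^ 4 + aeval x' s) = j₃ (X * C s * (X ^ 4 + C s)) := by
      rw [hxs', map_mul, map_mul, map_add, map_pow]
      rfl
    rw [this]
    exact (IsLocalization.Away.algebraMap_isUnit (S := A₃) (X * C s * (X ^ 4 + C s) : ℂ[X][X])).map
      (AdjoinRoot.ofAlgHom ℂ _ : A₃ →ₐ[ℂ] B)
  have hww : w ^ 2 * t ^ 4 = t ^ 4 + aeval x' s := by
    have h₁ : w ^ 2 = AdjoinRoot.of _ a₃ := kummerRing_root_pow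
    have h₂ : t ^ 4 + aeval x' s = AdjoinRoot.of _ (algebraMap ℂ[X][X] A₃ (X ^ 4 + C s)) := by
      rw [hxs', map_add, map_add, map_pow, map_pow]
      rfl
    rw [h₁, h₂, ← ha₃, map_mul, map_pow, map_pow]
  exact nonempty_algEquiv_of_universal s hS hU hrr hT hww (algHom_ext_quotientRing s a₂)
    (algHom_ext_doubleCover s) (exists_algHom_quotientRing s a₂ ha₂) (exists_algHom_doubleCover s ha₃)

end Algebra

section Birational
open Polynomial TensorProduct

theorem exists_kummerChart_of_isLocalizationAway {Y : Scheme.{0}} [IsIntegral Y] {P A : Type}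
    [CommRing P] [IsDomain P] [IsIntegrallyClosed P] [Algebra ℂ P] [CommRing A] [Algebra ℂ A]
    [Algebra P A] [IsScalarTower ℂ P A] {s : P} (hs : s ≠ 0) [IsLocalization.Away s A]
    (i₀ : Spec (.of P) ⟶ Y) [IsOpenImmersion i₀] {str : Y ⟶ Spec (.of ℂ)}
    (hstr : i₀ ≫ str = Spec.map (CommRingCat.ofHom (algebraMap ℂ P))) {n : ℕ} (hn : n ≠ 0)
    {ζ : ℂ} (hζ : IsPrimitiveRoot ζ n) {a : A} (ha : IsUnit a) {p q : P} (hq : q ≠ 0)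
    (hpq : a * algebraMap P A q = algebraMap P A p) {f : Y.functionField}
    (hf : f = chartToFunctionField i₀ p / chartToFunctionField i₀ q) :
    ∃ (i : Spec (.of A) ⟶ Y) (h : Spec (.of (AdjoinRoot (X ^ n - C a))) ⟶ kummerCover n f),
      IsOpenImmersion i ∧ i ≫ str = Spec.map (CommRingCat.ofHom (algebraMap ℂ A)) ∧
      Dense (kummerCover.π n f ⁻¹' Set.range i) ∧
      IsPullback h (Spec.map (CommRingCat.ofHom (algebraMap A (AdjoinRoot (X ^ n - C a)))))
        (kummerCover.π n f) i ∧
      ∀ (ξ : ℂ) (hξ : ξ ^ n = 1) (η : Y.functionField) (hη : η ^ n = 1),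
        η = chartToFunctionField i₀ (algebraMap ℂ P ξ) →
        Spec.map (CommRingCat.ofHom (kummerRotOver ℂ a hξ).toRingHom) ≫ h =
          h ≫ kummerCover.rot n f η hη := by
  have hM : Submonoid.powers s ≤ nonZeroDivisors P := powers_le_nonZeroDivisors_of_noZeroDivisors hs
  have : IsDomain A := IsLocalization.isDomain_of_le_nonZeroDivisors A hM
  have : IsIntegrallyClosed A := isIntegrallyClosed_of_isLocalization A _ hM
  have : IsOpenImmersion (Spec.map (CommRingCat.ofHom (algebraMap P A))) :=
    IsOpenImmersion.of_isLocalization s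
  let i : Spec (.of A) ⟶ Y := Spec.map (CommRingCat.ofHom (algebraMap P A)) ≫ i₀
  have hi (b : P) : chartToFunctionField i₀ b = chartToFunctionField i (algebraMap P A b) :=
    congr($(chartToFunctionField_comp i₀ (CommRingCat.ofHom (algebraMap P A))) b)
  have hfi : f = chartToFunctionField i a := by
    have hq₀ : chartToFunctionField i₀ q ≠ 0 := by
      rw [Ne, map_eq_zero_iff _ (chartToFunctionField_injective i₀)]
      exact hq
    rw [hf, div_eq_iff hq₀, hi, hi, ← map_mul, hpq]
  have hn' : IsUnit (n : A) := by
    have := (isUnit_iff_ne_zero.mpr (Nat.cast_ne_zero.mpr hn : (n : ℂ) ≠ 0)).map (algebraMap ℂ A)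
    rwa [map_natCast] at this
  obtain ⟨h, hh, hh'⟩ := exists_isPullback_kummerCover i hn' hn ha
    (hζ.map_of_injective (algebraMap ℂ A).injective) hfi
  refine ⟨i, h, inferInstance, ?_, ?_, hh, fun ξ hξ η hη e ↦ ?_⟩
  · rw [Category.assoc, hstr, ← Spec.map_comp, ← CommRingCat.ofHom_comp,
      IsScalarTower.algebraMap_eq ℂ P A]
  · obtain ⟨x⟩ : Nonempty (Spec (.of A)) := inferInstance
    exact dense_preimage_kummerCover n f i.opensRange ⟨i x, x, rfl⟩
  · refine hh' (algebraMap ℂ A ξ) (by rw [← map_pow, hξ, map_one]) η hη ?_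
    rw [e, hi, ← IsScalarTower.algebraMap_apply ℂ P A]

theorem Hirz.j₀_str (n : ℕ) : P1.ι₀ ℂ[X] ≫ Hirz.j₀ n ≫ Hirz.str n =
    Spec.map (CommRingCat.ofHom (algebraMap ℂ ℂ[X][X])) := by
  have h : Hirz.j₀ n ≫ Hirz.proj n = P1.str ℂ[X] ≫ P1.ι₀ ℂ := pushout.inl_desc _ _ _
  rw [Hirz.str, reassoc_of% h, P1.ι₀_str, reassoc_of% (P1.ι₀_str), ← Spec.map_comp,
    ← CommRingCat.ofHom_comp]

theorem birationalOver_surfaceY_quotientCE (σ : MvPolynomial (Fin 2) ℂ) (hσ : Hirz.dehom₀ σ ≠ 0)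
    {ζ : ℂ} (hζ : IsPrimitiveRoot ζ 4) :
    Scheme.BirationalOver (surfaceY.str σ) (quotientCE.str σ ζ hζ.pow_eq_one) := by
  set s := Hirz.dehom₀ σ with hs
  let e : ℂ[X] := X * (X - 1) * (X + 1)
  let d : ℂ[X][X] := X * C s * (X ^ 4 + C s)
  have hX1 : (X - 1 : ℂ[X]) ≠ 0 := X_sub_C_ne_zero 1
  have hX2 : (X + 1 : ℂ[X]) ≠ 0 := X_add_C_ne_zero 1
  have he : e ≠ 0 := mul_ne_zero (mul_ne_zero X_ne_zero hX1) hX2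
  have hX4 : (X ^ 4 + C s : ℂ[X][X]) ≠ 0 := X_pow_add_C_ne_zero (by norm_num) s
  have hd : d ≠ 0 := mul_ne_zero (mul_ne_zero X_ne_zero (C_ne_zero.mpr hσ)) hX4
  let A₁ := Localization.Away s
  let A₂ := Localization.Away e
  let A₃ := Localization.Away d
  have ha₁ : IsUnit (algebraMap ℂ[X] A₁ s) := IsLocalization.Away.algebraMap_isUnit s
  have he' : IsUnit (algebraMap ℂ[X] A₂ e) := IsLocalization.Away.algebraMap_isUnit e
  have hd' : IsUnit (algebraMap ℂ[X][X] A₃ d) := IsLocalization.Away.algebraMap_isUnit d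
  have ha₂ : IsUnit (algebraMap ℂ[X] A₂ (X * (X - 1) ^ 2)) := by
    simp only [e, map_mul, map_pow] at he' ⊢
    have h := isUnit_of_mul_isUnit_left he'
    exact (isUnit_of_mul_isUnit_left h).mul ((isUnit_of_mul_isUnit_right h).pow 2)
  obtain ⟨a₂, ha₂⟩ := ha₂
  obtain ⟨a₃, hu₃, ha₃⟩ : ∃ a₃ : A₃, IsUnit a₃ ∧ a₃ * algebraMap ℂ[X][X] A₃ (X ^ 4) =
      algebraMap ℂ[X][X] A₃ (X ^ 4 + C s) := by
    simp only [d, map_mul] at hd'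
    have h₁ := isUnit_of_mul_isUnit_right hd'
    have h₂ := (isUnit_of_mul_isUnit_left (isUnit_of_mul_isUnit_left hd')).pow 4
    rw [← map_pow] at h₂
    obtain ⟨b, hb⟩ := h₂.exists_left_inv
    exact ⟨b * algebraMap ℂ[X][X] A₃ (X ^ 4 + C s), (IsUnit.of_mul_eq_one _ hb).mul h₁, by
      rw [mul_right_comm, hb, one_mul]⟩
  obtain ⟨i₁, h₁, _, hs₁, hd₁, hp₁, hr₁⟩ := exists_kummerChart_of_isLocalizationAway (A := A₁) hσ
    (P1.ι₀ ℂ) (P1.ι₀_str ℂ) four_ne_zero hζ ha₁ (p := s) (q := 1) one_ne_zero (by simp)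
    (f := lineFunction s) (by rw [map_one, div_one]; rfl)
  obtain ⟨i₂, h₂, _, hs₂, hd₂, hp₂, hr₂⟩ := exists_kummerChart_of_isLocalizationAway (A := A₂) he
    (P1.ι₀ ℂ) (P1.ι₀_str ℂ) four_ne_zero hζ a₂.isUnit (p := X * (X - 1) ^ 2) (q := 1) one_ne_zero
    (by simp [ha₂]) (f := lineFunction (X * (X - 1) ^ 2)) (by rw [map_one, div_one]; rfl)
  obtain ⟨i₃, h₃, _, hs₃, hd₃, hp₃, -⟩ := exists_kummerChart_of_isLocalizationAway (A := A₃) hd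
    (P1.ι₀ ℂ[X] ≫ Hirz.j₀ 2) (str := Hirz.str 2) ((Category.assoc _ _ _).trans (Hirz.j₀_str 2))
    two_ne_zero (IsPrimitiveRoot.neg_one 0 (by norm_num)) hu₃ (pow_ne_zero 4 X_ne_zero)
    ha₃ (f := branchFunction σ) rfl
  have hn (j : ℕ) (hj : j < 4) (hj₀ : j ≠ 0) : IsUnit (ζ ^ j - 1) :=
    isUnit_iff_ne_zero.mpr (sub_ne_zero.mpr (hζ.pow_ne_one_of_pos_of_lt hj₀ hj))
  obtain ⟨q, hq, hqd, hqs⟩ := exists_openImmersion_prodQuotient (kummerCover.π 4 (lineFunction s))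
    (kummerCover.π 4 (lineFunction (X * (X - 1) ^ 2))) (P1.str ℂ) (P1.str ℂ) i₁ i₂ hs₁ hs₂ hd₁ hd₂
    h₁ h₂ hp₁ hp₂ (kummerCover.rot _ _ (lineFunction (C ζ)) (lineFunction_root hζ.pow_eq_one))
    (kummerCover.rot _ _ (lineFunction (C ζ)) (lineFunction_root hζ.pow_eq_one))
    (kummerCover.rot_π ..) (kummerCover.rot_π ..) (kummerRotOver ℂ _ hζ.pow_eq_one)
    (kummerRotOver ℂ _ hζ.pow_eq_one) (hr₁ ζ _ _ _ rfl) (hr₂ ζ _ _ _ rfl)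
    (kummerQuotientToTensor ℂ (algebraMap ℂ[X] A₁ s) a₂ four_ne_zero)
    (kummerQuotientToTensor_injective ℂ _ a₂ four_ne_zero)
    (map_rot_eq_self_iff _ a₂ four_ne_zero hζ.pow_eq_one hn)
  obtain ⟨ε⟩ := exists_doubleCover_algEquiv (A₁ := A₁) s a₂ ha₂ ha₃
  have : IsOpenImmersion h₃ := MorphismProperty.of_isPullback hp₃.flip inferInstance
  have : IsDominant h₃ := ⟨by rwa [DenseRange, range_eq_of_isPullback hp₃]⟩
  have : IsDominant q := ⟨hqd⟩
  let e' := Spec.map ε.toRingEquiv.toCommRingCatIso.hom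
  have : IsDominant (e' ≫ q) := inferInstance
  have hY : h₃ ≫ surfaceY.str σ =
      Spec.map (CommRingCat.ofHom (algebraMap ℂ (AdjoinRoot (X ^ 2 - C a₃)))) := by
    rw [surfaceY.str, reassoc_of% hp₃.w, hs₃, ← Spec.map_comp, ← CommRingCat.ofHom_comp,
      IsScalarTower.algebraMap_eq ℂ A₃ (AdjoinRoot (X ^ 2 - C a₃))]
  have hQ : (e' ≫ q) ≫ quotientCE.str σ ζ hζ.pow_eq_one =
      Spec.map (CommRingCat.ofHom (algebraMap ℂ (AdjoinRoot (X ^ 2 - C a₃)))) := by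
    refine (Category.assoc _ _ _).trans ((congrArg (e' ≫ ·) hqs).trans ?_)
    rw [← Spec.map_comp]
    congr 1
    exact CommRingCat.hom_ext (RingHom.ext fun x ↦ ε.commutes x)
  exact (h₃.birationalOver _ _ hY).symm.trans ((e' ≫ q).birationalOver _ _ hQ)

end Birational

section Ideals
open Scheme

theorem ideal_comap_of_isAffine {X Y : Scheme.{0}} [IsAffine X] [IsAffine Y] (I : Y.IdealSheafData)
    (f : X ⟶ Y) : (I.comap f).ideal ⟨⊤, isAffineOpen_top X⟩ =
      (I.ideal ⟨⊤, isAffineOpen_top Y⟩).map f.appTop.hom := by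
  have h (J : X.IdealSheafData) : (I.comap f).ideal ⟨⊤, isAffineOpen_top X⟩ ≤
      J.ideal ⟨⊤, isAffineOpen_top X⟩ ↔ (I.ideal ⟨⊤, isAffineOpen_top Y⟩).map f.appTop.hom ≤
        J.ideal ⟨⊤, isAffineOpen_top X⟩ := by
    have h₁ : (J.map f).ideal ⟨⊤, isAffineOpen_top Y⟩ =
        (J.ideal ⟨⊤, isAffineOpen_top X⟩).comap f.appTop.hom :=
      IdealSheafData.ideal_map_of_isAffineHom J f ⟨⊤, isAffineOpen_top Y⟩
    rw [Ideal.map_le_iff_le_comap, ← h₁]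
    exact ⟨fun h ↦ IdealSheafData.le_map_iff_comap_le.mpr (IdealSheafData.le_of_isAffine h) _,
      fun h ↦ IdealSheafData.le_map_iff_comap_le.mp (IdealSheafData.le_of_isAffine h) _⟩
  refine le_antisymm ?_ ((h _).mp le_rfl)
  have := h (IdealSheafData.ofIdealTop ((I.ideal ⟨⊤, isAffineOpen_top Y⟩).map f.appTop.hom))
  simp only [IdealSheafData.ofIdealTop_ideal] at this
  simpa using this

/-- The ideal of `P` given by the restriction of the ideal sheaf `I` along `i : Spec P ⟶ Y`. -/
def chartIdeal {Y : Scheme.{0}} (I : Y.IdealSheafData) {P : CommRingCat.{0}} (i : Spec P ⟶ Y) :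
    Ideal P :=
  ((I.comap i).ideal ⟨⊤, isAffineOpen_top _⟩).comap (Scheme.ΓSpecIso P).inv.hom

theorem chartIdeal_comap {X Y : Scheme.{0}} (I : Y.IdealSheafData) {P : CommRingCat.{0}}
    (f : X ⟶ Y) (i : Spec P ⟶ X) : chartIdeal (I.comap f) i = chartIdeal I (i ≫ f) := by
  rw [chartIdeal, chartIdeal, IdealSheafData.comap_comp]

theorem chartIdeal_SpecMap_comp {Y : Scheme.{0}} (I : Y.IdealSheafData) {P Q : CommRingCat.{0}}
    (i : Spec P ⟶ Y) (φ : P ⟶ Q) :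
    chartIdeal I (Spec.map φ ≫ i) = (chartIdeal I i).map φ.hom := by
  rw [chartIdeal, chartIdeal, IdealSheafData.comap_comp, ideal_comap_of_isAffine]
  set K := (I.comap i).ideal ⟨⊤, isAffineOpen_top _⟩
  have hP : K.comap (Scheme.ΓSpecIso P).inv.hom = K.map (Scheme.ΓSpecIso P).hom.hom :=
    (Ideal.map_comap_of_equiv (Scheme.ΓSpecIso P).commRingCatIsoToRingEquiv).symm
  have hQ (L) : Ideal.comap (Scheme.ΓSpecIso Q).inv.hom L = Ideal.map (Scheme.ΓSpecIso Q).hom.hom L :=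
    (Ideal.map_comap_of_equiv (Scheme.ΓSpecIso Q).commRingCatIsoToRingEquiv).symm
  rw [hP, hQ, Ideal.map_map, Ideal.map_map, ← CommRingCat.hom_comp, ← CommRingCat.hom_comp,
    Scheme.ΓSpecIso_naturality]

theorem chartIdeal_ker {Y Z : Scheme.{0}} (f : Z ⟶ Y) [QuasiCompact f] {P Q : CommRingCat.{0}}
    (i : Spec P ⟶ Y) [IsOpenImmersion i] (φ : P ⟶ Q) (j : Spec Q ⟶ Z)
    (h : IsPullback (Spec.map φ) j i f) : chartIdeal f.ker i = RingHom.ker φ.hom := by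
  rw [chartIdeal, IdealSheafData.ideal_comap_of_isOpenImmersion,
    ← ker_ideal_of_isPullback_of_isOpenImmersion f (Spec.map φ) j i h, Scheme.Hom.ker_apply]
  ext x
  change (Spec.map φ).appTop.hom ((Scheme.ΓSpecIso P).inv.hom x) = 0 ↔ φ.hom x = 0
  have : (Spec.map φ).appTop.hom ((Scheme.ΓSpecIso P).inv.hom x) =
      (Scheme.ΓSpecIso Q).inv.hom (φ.hom x) := congr($((Scheme.ΓSpecIso_inv_naturality φ).symm) x)
  rw [this]
  exact map_eq_zero_iff _ (Scheme.ΓSpecIso Q).symm.commRingCatIsoToRingEquiv.injective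

theorem germToFunctionField_image_ideal {Y : Scheme.{0}} [IsIntegral Y] (I : Y.IdealSheafData)
    {P : CommRingCat.{0}} [Nonempty (Spec P)] (i : Spec P ⟶ Y) [IsOpenImmersion i]
    [Nonempty (i ''ᵁ ⊤ : Y.Opens)] :
    (Y.germToFunctionField (i ''ᵁ ⊤)).hom ''
      (I.ideal ⟨i ''ᵁ ⊤, (isAffineOpen_top _).image_of_isOpenImmersion i⟩ : Set Γ(Y, i ''ᵁ ⊤)) =
    chartToFunctionField i '' (chartIdeal I i : Set P) := by
  rw [chartIdeal, IdealSheafData.ideal_comap_of_isOpenImmersion]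
  let e : P ≃+* Γ(Y, i ''ᵁ ⊤) :=
    ((Scheme.ΓSpecIso P).symm ≪≫ (i.appIso ⊤).symm).commRingCatIsoToRingEquiv
  have h₁ : ⇑(chartToFunctionField i) = (Y.germToFunctionField (i ''ᵁ ⊤)).hom ∘ e := rfl
  rw [h₁, Set.image_comp]
  congr 1
  exact (Set.image_preimage_eq _ e.surjective).symm

theorem exists_affineOpens_of_chart {Y : Scheme.{0}} [IsIntegral Y] {f : Y.functionField}
    {I J : Y.IdealSheafData} {P : CommRingCat.{0}} [Nonempty (Spec P)] (i : Spec P ⟶ Y)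
    [IsOpenImmersion i] {p q : P} (hI : chartIdeal I i = Ideal.span {p})
    (hJ : chartIdeal J i = Ideal.span {q})
    (hf : f * chartToFunctionField i q = chartToFunctionField i p) {y : Y} (hy : y ∈ Set.range i) :
    ∃ (U : Y.affineOpens) (hy : y ∈ U.1),
      haveI : Nonempty U.1 := ⟨⟨y, hy⟩⟩
      (fun a ↦ f * (Y.germToFunctionField U.1).hom a) '' (J.ideal U : Set Γ(Y, U.1)) =
        (Y.germToFunctionField U.1).hom '' (I.ideal U : Set Γ(Y, U.1)) := by
  obtain ⟨x, rfl⟩ := hy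
  refine ⟨⟨i ''ᵁ ⊤, (isAffineOpen_top _).image_of_isOpenImmersion i⟩, ⟨x, trivial, rfl⟩, ?_⟩
  have : Nonempty (i ''ᵁ ⊤ : Y.Opens) := ⟨⟨i x, x, trivial, rfl⟩⟩
  rw [germToFunctionField_image_ideal I i, hI]
  have h := germToFunctionField_image_ideal J i
  rw [hJ] at h
  have h₂ := congrArg (Set.image (f * ·)) h
  rw [Set.image_image, Set.image_image] at h₂
  refine h₂.trans ?_
  ext z
  simp only [Set.mem_image, SetLike.mem_coe, Ideal.mem_span_singleton']
  constructor
  · rintro ⟨_, ⟨b, rfl⟩, rfl⟩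
    exact ⟨_, ⟨b, rfl⟩, by rw [map_mul, map_mul, ← hf]; ring⟩
  · rintro ⟨_, ⟨b, rfl⟩, rfl⟩
    exact ⟨_, ⟨b, rfl⟩, by rw [map_mul, map_mul, ← hf]; ring⟩

end Ideals

section Divisor
open Polynomial LaurentPolynomial

theorem range_gm₁ (R : Type) [CommRing R] : Set.range (gm₁ R) =
    {p : Spec (.of R[X]) | (X : R[X]) ∉ p.asIdeal} := by
  let e : CommRingCat.of R[T;T⁻¹] ≅ CommRingCat.of R[T;T⁻¹] :=
    (invert (R := R)).toRingEquiv.toCommRingCatIso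
  have : gm₁ R = Spec.map e.hom ≫ gm₀ R := by
    simp only [gm₁, gm₀, ← Spec.map_comp]
    congr 1
    ext x <;> simp [e]
  rw [this, ← range_gm₀, Scheme.Hom.comp_base, TopCat.coe_comp, Set.range_comp,
    (Spec.map e.hom).surjective.range_eq, Set.image_univ]

instance : TopologicalSpace.NoetherianSpace (P1 ℂ) := by
  have h : Set.range (P1.ι₀ ℂ) ∪ Set.range (P1.ι₁ ℂ) = Set.univ :=
    Set.eq_univ_of_forall P1.exists_chart
  rw [← TopologicalSpace.noetherian_univ_iff, ← h, Set.union_eq_iUnion]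
  have := TopologicalSpace.NoetherianSpace.range (P1.ι₀ ℂ) (P1.ι₀ ℂ).continuous
  have := TopologicalSpace.NoetherianSpace.range (P1.ι₁ ℂ) (P1.ι₁ ℂ).continuous
  have (b : Bool) : TopologicalSpace.NoetherianSpace
      ↥(cond b (Set.range (P1.ι₀ ℂ)) (Set.range (P1.ι₁ ℂ))) := by
    cases b <;> assumption
  exact TopologicalSpace.NoetherianSpace.iUnion _

/-- Two charts that agree on an open subset of both. -/
theorem exists_chartToFunctionField_eq {Y : Scheme.{0}} [IsIntegral Y] {P Q S : CommRingCat.{0}}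
    [Nonempty (Spec P)] [Nonempty (Spec Q)] [Nonempty (Spec S)] (i : Spec P ⟶ Y) (j : Spec Q ⟶ Y)
    [IsOpenImmersion i] [IsOpenImmersion j] (φ : P ⟶ S) (ψ : Q ⟶ S) [IsOpenImmersion (Spec.map φ)]
    [IsOpenImmersion (Spec.map ψ)] (h : Spec.map φ ≫ i = Spec.map ψ ≫ j) :
    ∃ κ : S →+* Y.functionField, (∀ p, chartToFunctionField i p = κ (φ p)) ∧
      ∀ q, chartToFunctionField j q = κ (ψ q) := by
  refine ⟨chartToFunctionField (Spec.map φ ≫ i), fun p ↦ congr($(chartToFunctionField_comp i φ) p),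
    fun q ↦ ?_⟩
  simp only [h]
  exact congr($(chartToFunctionField_comp j ψ) q)

theorem chartToFunctionField_ι₁_mul_ι₀ {Y : Scheme.{0}} [IsIntegral Y] {R : Type} [CommRing R]
    [IsDomain R] (j : P1 R ⟶ Y) [IsOpenImmersion j] (τ : R) (k : ℕ) :
    chartToFunctionField (R := .of R[X]) (P1.ι₁ R ≫ j) (1 + Polynomial.C τ * X ^ k) *
      chartToFunctionField (R := .of R[X]) (P1.ι₀ R ≫ j) (X ^ k) =
        chartToFunctionField (R := .of R[X]) (P1.ι₀ R ≫ j) (X ^ k + Polynomial.C τ) := by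
  have h₀ : IsOpenImmersion (Spec.map (CommRingCat.ofHom (toLaurent : R[X] →+* R[T;T⁻¹]))) :=
    inferInstanceAs (IsOpenImmersion (gm₀ R))
  have h₁ : IsOpenImmersion (Spec.map (CommRingCat.ofHom
      (eval₂RingHom (LaurentPolynomial.C (R := R)) (T (-1))))) :=
    inferInstanceAs (IsOpenImmersion (gm₁ R))
  obtain ⟨κ, hκ₀, hκ₁⟩ := exists_chartToFunctionField_eq (P1.ι₀ R ≫ j) (P1.ι₁ R ≫ j)
    (CommRingCat.ofHom (toLaurent : R[X] →+* R[T;T⁻¹]))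
    (CommRingCat.ofHom (eval₂RingHom (LaurentPolynomial.C (R := R)) (T (-1))))
    (congr($(P1.glue R) ≫ j))
  rw [hκ₀, hκ₀, hκ₁, ← map_mul]
  congr 1
  change eval₂RingHom (LaurentPolynomial.C (R := R)) (T (-1)) (1 + Polynomial.C τ * X ^ k) *
    toLaurent (X ^ k) = toLaurent (X ^ k + Polynomial.C τ)
  simp only [map_add, map_mul, map_one, map_pow, coe_eval₂RingHom, Polynomial.eval₂_X,
    Polynomial.eval₂_C, toLaurent_X, toLaurent_C, T_pow]
  rw [add_mul, one_mul, mul_assoc, ← T_add]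
  simp

namespace Hirz

theorem j₀_proj (n : ℕ) : j₀ n ≫ proj n = P1.str ℂ[X] ≫ P1.ι₀ ℂ := pushout.inl_desc _ _ _

theorem j₁_proj (n : ℕ) : j₁ n ≫ proj n = P1.str ℂ[X] ≫ P1.ι₁ ℂ := pushout.inr_desc _ _ _

theorem ι₀_sectionE {n : ℕ} (σ : MvPolynomial (Fin 2) ℂ) (hσ : σ.IsHomogeneous n) :
    P1.ι₀ ℂ ≫ sectionE σ hσ =
      Spec.map (CommRingCat.ofHom (evalRingHom (-dehom₀ σ))) ≫ P1.ι₀ ℂ[X] ≫ j₀ n :=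
  pushout.inl_desc _ _ _

theorem ι₁_sectionE {n : ℕ} (σ : MvPolynomial (Fin 2) ℂ) (hσ : σ.IsHomogeneous n) :
    P1.ι₁ ℂ ≫ sectionE σ hσ =
      Spec.map (CommRingCat.ofHom (evalRingHom (-dehom₁ σ))) ≫ P1.ι₀ ℂ[X] ≫ j₁ n :=
  pushout.inr_desc _ _ _

theorem sectionE_proj {n : ℕ} (σ : MvPolynomial (Fin 2) ℂ) (hσ : σ.IsHomogeneous n) :
    sectionE σ hσ ≫ proj n = 𝟙 _ := by
  have h (p : ℂ[X]) : Spec.map (CommRingCat.ofHom (evalRingHom p)) ≫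
      Spec.map (CommRingCat.ofHom (Polynomial.C : ℂ[X] →+* ℂ[X][X])) = 𝟙 _ := by
    rw [← Spec.map_comp, ← CommRingCat.ofHom_comp, ← Spec.map_id]
    congr 1
    ext <;> simp
  refine P1.hom_ext ?_ ?_
  · rw [reassoc_of% (ι₀_sectionE σ hσ), j₀_proj, reassoc_of% (P1.ι₀_str), reassoc_of% (h),
      Category.comp_id]
  · rw [reassoc_of% (ι₁_sectionE σ hσ), j₁_proj, reassoc_of% (P1.ι₀_str), reassoc_of% (h),
      Category.comp_id]

theorem j₀_mu (n k : ℕ) : j₀ n ≫ mu n k = P1.map (RingHom.id _) 1 k ≫ j₀ (k * n) :=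
  pushout.inl_desc _ _ _

theorem j₁_mu (n k : ℕ) : j₁ n ≫ mu n k = P1.map (RingHom.id _) 1 k ≫ j₁ (k * n) :=
  pushout.inr_desc _ _ _

variable {n : ℕ} {σ : MvPolynomial (Fin 2) ℂ} {hσ : σ.IsHomogeneous n} {c : Spec (.of ℂ[X]) ⟶ P1 ℂ}
  {j : P1 ℂ[X] ⟶ Hirz n} {τ : ℂ[X]}

theorem mem_range_of_sectionE_mem_range (hj : j ≫ proj n = P1.str ℂ[X] ≫ c) {z : P1 ℂ}
    (hz : sectionE σ hσ z ∈ Set.range j) : z ∈ Set.range c := by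
  obtain ⟨x, hx⟩ := hz
  refine ⟨P1.str ℂ[X] x, ?_⟩
  have h₁ : proj n (sectionE σ hσ z) = z := congr($(sectionE_proj σ hσ) z)
  have h₂ : proj n (j x) = c (P1.str ℂ[X] x) := congr($hj x)
  rw [← h₂, hx, h₁]

theorem ker_evalRingHom_neg (τ : ℂ[X]) :
    RingHom.ker (evalRingHom (-τ)) = Ideal.span {(X + Polynomial.C τ : ℂ[X][X])} := by
  rw [Polynomial.ker_evalRingHom]
  simp

/-- The ideal of `E_σ` in the chart with fibre coordinate `t`. -/
theorem chartIdeal_ker_sectionE [IsOpenImmersion c] [IsOpenImmersion j]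
    (hj : j ≫ proj n = P1.str ℂ[X] ≫ c)
    (hE : c ≫ sectionE σ hσ = Spec.map (CommRingCat.ofHom (evalRingHom (-τ))) ≫ P1.ι₀ ℂ[X] ≫ j) :
    chartIdeal (sectionE σ hσ).ker (P1.ι₀ ℂ[X] ≫ j) =
      Ideal.span {(X + Polynomial.C τ : ℂ[X][X])} := by
  rw [← ker_evalRingHom_neg]
  refine chartIdeal_ker (sectionE σ hσ) (P1.ι₀ ℂ[X] ≫ j) (CommRingCat.ofHom (evalRingHom (-τ))) c
    (IsOpenImmersion.isPullback _ _ _ _ hE (TopologicalSpace.Opens.ext (Set.ext fun z ↦ ⟨?_, ?_⟩)))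
  · rintro ⟨x, hx⟩
    exact mem_range_of_sectionE_mem_range hj ⟨P1.ι₀ ℂ[X] x, hx⟩
  · rintro ⟨x, rfl⟩
    exact ⟨_, congr($hE.symm x)⟩

/-- `E_σ` is contained in `1 + s * σ = 0` in the chart with fibre coordinate `s = t⁻¹`. -/
theorem one_add_mem_of_sectionE [IsOpenImmersion j] (hj : j ≫ proj n = P1.str ℂ[X] ≫ c)
    (hE : c ≫ sectionE σ hσ = Spec.map (CommRingCat.ofHom (evalRingHom (-τ))) ≫ P1.ι₀ ℂ[X] ≫ j)
    {z : P1 ℂ} {a : Spec (.of ℂ[X][X])} (h : sectionE σ hσ z = (P1.ι₁ ℂ[X] ≫ j) a) :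
    (1 + Polynomial.C τ * X : ℂ[X][X]) ∈ a.asIdeal := by
  obtain ⟨x, rfl⟩ := mem_range_of_sectionE_mem_range hj ⟨P1.ι₁ ℂ[X] a, h.symm⟩
  have h₁ : sectionE σ hσ (c x) =
      j (P1.ι₀ ℂ[X] (Spec.map (CommRingCat.ofHom (evalRingHom (-τ))) x)) := congr($hE x)
  obtain ⟨b, hb₀, rfl⟩ := P1.ι₀_eq_ι₁ (j.isOpenEmbedding.injective (h₁.symm.trans h))
  have h₂ : (X + Polynomial.C τ : ℂ[X][X]) ∈ (gm₀ ℂ[X] b).asIdeal := by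
    rw [hb₀]
    change evalRingHom (-τ) (X + Polynomial.C τ) ∈ x.asIdeal
    simp
  change toLaurent (X + Polynomial.C τ : ℂ[X][X]) ∈ b.asIdeal at h₂
  change eval₂RingHom LaurentPolynomial.C (T (-1)) (1 + Polynomial.C τ * X : ℂ[X][X]) ∈ b.asIdeal
  have h₃ : eval₂RingHom LaurentPolynomial.C (T (-1)) (1 + Polynomial.C τ * X : ℂ[X][X]) =
      T (-1) * toLaurent (X + Polynomial.C τ : ℂ[X][X]) := by
    simp only [map_add, map_mul, map_one, coe_eval₂RingHom, Polynomial.eval₂_X,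
      Polynomial.eval₂_C, toLaurent_X, toLaurent_C]
    rw [mul_add, ← T_add, mul_comm (T (-1))]
    simp
  rw [h₃]
  exact b.asIdeal.mul_mem_left _ h₂

end Hirz

section Chart
variable {σ : MvPolynomial (Fin 2) ℂ} {hσ : σ.IsHomogeneous 8} {c : Spec (.of ℂ[X]) ⟶ P1 ℂ}
  {j : P1 ℂ[X] ⟶ Hirz 2} {j' : P1 ℂ[X] ⟶ Hirz 8} [IsOpenImmersion j']
  {τ : ℂ[X]}

theorem chartIdeal_muPullbackE [IsOpenImmersion c]
    (hμ : j ≫ mu₄ = P1.map (RingHom.id _) 1 4 ≫ j')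
    (hj' : j' ≫ Hirz.proj 8 = P1.str ℂ[X] ≫ c) (hE : c ≫ Hirz.sectionE σ hσ =
      Spec.map (CommRingCat.ofHom (evalRingHom (-τ))) ≫ P1.ι₀ ℂ[X] ≫ j') :
    chartIdeal (muPullbackE σ hσ) (P1.ι₀ ℂ[X] ≫ j) =
      Ideal.span {(X ^ 4 + Polynomial.C τ : ℂ[X][X])} := by
  rw [muPullbackE, chartIdeal_comap, Category.assoc, hμ, reassoc_of% (P1.ι₀_map),
    chartIdeal_SpecMap_comp, Hirz.chartIdeal_ker_sectionE hj' hE]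
  refine (Ideal.map_span _ _).trans ?_
  simp [P1.coordMap]

theorem chartIdeal_muPullbackE_eq_top (hμ : j ≫ mu₄ = P1.map (RingHom.id _) 1 4 ≫ j')
    (hj' : j' ≫ Hirz.proj 8 = P1.str ℂ[X] ≫ c) (hE : c ≫ Hirz.sectionE σ hσ =
      Spec.map (CommRingCat.ofHom (evalRingHom (-τ))) ≫ P1.ι₀ ℂ[X] ≫ j')
    {A : Type} [CommRing A] (φ : ℂ[X][X] →+* A)
    (hφ : IsUnit (φ (1 + Polynomial.C τ * X ^ 4))) :
    chartIdeal (muPullbackE σ hσ) (Spec.map (CommRingCat.ofHom φ) ≫ P1.ι₁ ℂ[X] ≫ j) = ⊤ := by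
  have h : (muPullbackE σ hσ).comap (Spec.map (CommRingCat.ofHom φ) ≫ P1.ι₁ ℂ[X] ≫ j) = ⊤ := by
    rw [← Scheme.IdealSheafData.support_eq_bot_iff, muPullbackE,
      ← Scheme.IdealSheafData.comap_comp, Scheme.IdealSheafData.support_comap]
    refine TopologicalSpace.Closeds.ext (Set.eq_empty_of_forall_notMem fun x hx ↦ ?_)
    change _ ∈ ((Hirz.sectionE σ hσ).ker.support : Set (Hirz 8)) at hx
    rw [Scheme.Hom.support_ker] at hx
    let a := Spec.map (CommRingCat.ofHom (P1.coordMap (RingHom.id ℂ[X]) 1⁻¹ 4))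
      (Spec.map (CommRingCat.ofHom φ) x)
    have hxa : (Spec.map (CommRingCat.ofHom φ) ≫ P1.ι₁ ℂ[X] ≫ j) ≫ mu₄ =
        Spec.map (CommRingCat.ofHom φ) ≫ Spec.map (CommRingCat.ofHom
          (P1.coordMap (RingHom.id ℂ[X]) 1⁻¹ 4)) ≫ P1.ι₁ ℂ[X] ≫ j' := by
      rw [Category.assoc, Category.assoc, hμ, reassoc_of% (P1.ι₁_map)]
    rw [hxa] at hx
    let V : Set (Hirz 8) := (P1.ι₁ ℂ[X] ≫ j') ''
      {b | (1 + Polynomial.C τ * X : ℂ[X][X]) ∉ b.asIdeal}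
    have hV : IsOpen V := (P1.ι₁ ℂ[X] ≫ j').isOpenEmbedding.isOpenMap _
      (PrimeSpectrum.basicOpen (1 + Polynomial.C τ * X : ℂ[X][X])).isOpen
    have ha : (1 + Polynomial.C τ * X : ℂ[X][X]) ∉ a.asIdeal := by
      intro ha
      change φ (P1.coordMap (RingHom.id ℂ[X]) 1⁻¹ 4 (1 + Polynomial.C τ * X)) ∈ x.asIdeal at ha
      refine x.isPrime.ne_top (Ideal.eq_top_of_isUnit_mem _ ha ?_)
      convert! hφ using 2
      simp [P1.coordMap]
    obtain ⟨_, ⟨b, hb, hz⟩, ⟨z, rfl⟩⟩ := mem_closure_iff.mp hx V hV ⟨a, ha, rfl⟩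
    exact hb (Hirz.one_add_mem_of_sectionE hj' hE hz.symm)
  rw [chartIdeal, h]
  rfl

end Chart

theorem exists_affineOpens_of_mem_range {σ : MvPolynomial (Fin 2) ℂ} (hσ : σ.IsHomogeneous 8)
    {c : Spec (.of ℂ[X]) ⟶ P1 ℂ} [IsOpenImmersion c] {j : P1 ℂ[X] ⟶ Hirz 2} [IsOpenImmersion j]
    {j' : P1 ℂ[X] ⟶ Hirz 8} [IsOpenImmersion j'] {τ : ℂ[X]}
    (hμ : j ≫ mu₄ = P1.map (RingHom.id _) 1 4 ≫ j')
    (hj' : j' ≫ Hirz.proj 8 = P1.str ℂ[X] ≫ c)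
    (hE : c ≫ Hirz.sectionE σ hσ =
      Spec.map (CommRingCat.ofHom (evalRingHom (-τ))) ≫ P1.ι₀ ℂ[X] ≫ j')
    (hE₀ : c ≫ Hirz.sectionE 0 (MvPolynomial.isHomogeneous_zero _ _ 8) =
      Spec.map (CommRingCat.ofHom (evalRingHom (-0))) ≫ P1.ι₀ ℂ[X] ≫ j')
    {f : (Hirz 2).functionField}
    (hf : f * chartToFunctionField (R := .of ℂ[X][X]) (P1.ι₀ ℂ[X] ≫ j) (X ^ 4) =
      chartToFunctionField (R := .of ℂ[X][X]) (P1.ι₀ ℂ[X] ≫ j) (X ^ 4 + Polynomial.C τ))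
    {y : Hirz 2} (hy : y ∈ Set.range j) :
    ∃ (U : (Hirz 2).affineOpens) (hy : y ∈ U.1),
      haveI : Nonempty U.1 := ⟨⟨y, hy⟩⟩
      (fun a ↦ f * ((Hirz 2).germToFunctionField U.1).hom a) ''
        ((muPullbackE 0 (MvPolynomial.isHomogeneous_zero _ _ _)).ideal U : Set Γ(Hirz 2, U.1)) =
        ((Hirz 2).germToFunctionField U.1).hom ''
          ((muPullbackE σ hσ).ideal U : Set Γ(Hirz 2, U.1)) := by
  have ht {y : Hirz 2} (hy : y ∈ Set.range (P1.ι₀ ℂ[X] ≫ j)) :=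
    exists_affineOpens_of_chart (P1.ι₀ ℂ[X] ≫ j) (chartIdeal_muPullbackE hμ hj' hE)
      (chartIdeal_muPullbackE hμ hj' hE₀) (f := f) (by rw [map_zero, add_zero, hf]) hy
  obtain ⟨y, rfl⟩ := hy
  obtain ⟨a, rfl⟩ | ⟨a, rfl⟩ := P1.exists_chart y
  · exact ht ⟨a, rfl⟩
  by_cases ha : (X : ℂ[X][X]) ∈ a.asIdeal
  · let d : ℂ[X][X] := 1 + Polynomial.C τ * X ^ 4
    have hd : d ∉ a.asIdeal := by
      intro h
      refine a.isPrime.ne_top ((Ideal.eq_top_iff_one _).mpr ?_)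
      have := a.asIdeal.sub_mem h (a.asIdeal.mul_mem_left (Polynomial.C τ * X ^ 3) ha)
      convert! this using 1
      simp only [d]
      ring
    have hd₀ : d ≠ 0 := fun h ↦ hd (h ▸ zero_mem _)
    let A := Localization.Away d
    have hu : IsUnit (algebraMap ℂ[X][X] A d) := IsLocalization.Away.algebraMap_isUnit d
    have : IsDomain A := IsLocalization.isDomain_of_le_nonZeroDivisors A
      (powers_le_nonZeroDivisors_of_noZeroDivisors hd₀)
    have : IsOpenImmersion (Spec.map (CommRingCat.ofHom (algebraMap ℂ[X][X] A))) :=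
      IsOpenImmersion.of_isLocalization d
    have hr : a ∈ Set.range (Spec.map (CommRingCat.ofHom (algebraMap ℂ[X][X] A))) :=
      (PrimeSpectrum.localization_away_comap_range A d).ge hd
    obtain ⟨b, rfl⟩ := hr
    refine exists_affineOpens_of_chart (Spec.map (CommRingCat.ofHom (algebraMap ℂ[X][X] A)) ≫
      P1.ι₁ ℂ[X] ≫ j) (p := algebraMap ℂ[X][X] A d) (q := 1) ?_ ?_ ?_ ⟨b, rfl⟩
    · rw [chartIdeal_muPullbackE_eq_top hμ hj' hE _ hu]
      exact (Ideal.span_singleton_eq_top.mpr hu).symm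
    · rw [chartIdeal_muPullbackE_eq_top hμ hj' hE₀ _ (by simp)]
      exact (Ideal.span_singleton_eq_top.mpr isUnit_one).symm
    · have h₁ : chartToFunctionField (R := .of ℂ[X][X]) (P1.ι₁ ℂ[X] ≫ j) d = chartToFunctionField
          (R := .of A) (Spec.map (CommRingCat.ofHom (algebraMap ℂ[X][X] A)) ≫ P1.ι₁ ℂ[X] ≫ j)
            (algebraMap ℂ[X][X] A d) :=
        congr($(chartToFunctionField_comp (P1.ι₁ ℂ[X] ≫ j)
          (CommRingCat.ofHom (algebraMap ℂ[X][X] A))) d)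
      have h₂ := chartToFunctionField_ι₁_mul_ι₀ j τ 4
      rw [← hf] at h₂
      rw [map_one, mul_one]
      refine (mul_right_cancel₀ ?_ h₂).symm.trans h₁
      rw [Ne, map_eq_zero_iff _ (chartToFunctionField_injective _)]
      exact pow_ne_zero 4 X_ne_zero
  · obtain ⟨b, rfl⟩ := (range_gm₁ ℂ[X]).ge ha
    have hb : P1.ι₀ ℂ[X] (gm₀ ℂ[X] b) = P1.ι₁ ℂ[X] (gm₁ ℂ[X] b) := congr($(P1.glue ℂ[X]) b)
    rw [← hb]
    exact ht ⟨_, rfl⟩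

theorem branchFunction_mul_ruledFunction (σ : MvPolynomial (Fin 2) ℂ) :
    branchFunction σ * ruledFunction 2 (X ^ 4) =
      ruledFunction 2 (X ^ 4 + Polynomial.C (Hirz.dehom₀ σ)) := by
  refine div_mul_cancel₀ _ ?_
  rw [Ne, ruledFunction, map_eq_zero_iff _ (chartToFunctionField_injective _)]
  exact pow_ne_zero 4 X_ne_zero

theorem branchFunction_mul_chartToFunctionField_j₁ {σ : MvPolynomial (Fin 2) ℂ}
    (hσ : σ.IsHomogeneous 8) :
    branchFunction σ * chartToFunctionField (R := .of ℂ[X][X]) (P1.ι₀ ℂ[X] ≫ Hirz.j₁ 2) (X ^ 4) =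
      chartToFunctionField (R := .of ℂ[X][X]) (P1.ι₀ ℂ[X] ≫ Hirz.j₁ 2)
        (X ^ 4 + Polynomial.C (Hirz.dehom₁ σ)) := by
  have : IsOpenImmersion (Spec.map (CommRingCat.ofHom (toLaurent : ℂ[X] →+* ℂ[T;T⁻¹]))) :=
    inferInstanceAs (IsOpenImmersion (gm₀ ℂ))
  have : IsOpenImmersion (Spec.map (CommRingCat.ofHom invX)) :=
    inferInstanceAs (IsOpenImmersion (gm₁ ℂ))
  have := P1.isOpenImmersion_coordMap (toLaurent : ℂ[X] →+* ℂ[T;T⁻¹]) 1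
  have := P1.isOpenImmersion_coordMap invX (tUnit ℂ (-(2 : ℕ)))
  obtain ⟨κ, hκ₀, hκ₁⟩ := exists_chartToFunctionField_eq (P1.ι₀ ℂ[X] ≫ Hirz.j₀ 2)
    (P1.ι₀ ℂ[X] ≫ Hirz.j₁ 2) (CommRingCat.ofHom (P1.coordMap (toLaurent : ℂ[X] →+* ℂ[T;T⁻¹]) 1 1))
    (CommRingCat.ofHom (P1.coordMap invX (tUnit ℂ (-(2 : ℕ))) 1)) (by
      rw [← reassoc_of% (P1.ι₀_map), ← reassoc_of% (P1.ι₀_map)]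
      exact congr(_ ≫ $(Hirz.glue 2)))
  have h : branchFunction σ * κ (P1.coordMap (toLaurent : ℂ[X] →+* ℂ[T;T⁻¹]) 1 1 (X ^ 4)) =
      κ (P1.coordMap (toLaurent : ℂ[X] →+* ℂ[T;T⁻¹]) 1 1 (X ^ 4 + Polynomial.C (Hirz.dehom₀ σ))) := by
    have := branchFunction_mul_ruledFunction σ
    rw [ruledFunction, hκ₀, hκ₀] at this
    exact this
  have h₁ : P1.coordMap invX (tUnit ℂ (-(2 : ℕ))) 1 (X ^ 4) =
      Polynomial.C (T (-8)) * P1.coordMap (toLaurent : ℂ[X] →+* ℂ[T;T⁻¹]) 1 1 (X ^ 4) := by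
    simp [P1.coordMap, tUnit, mul_pow, ← map_pow, T_pow]
  have h₂ : P1.coordMap invX (tUnit ℂ (-(2 : ℕ))) 1 (Polynomial.C (Hirz.dehom₁ σ)) =
      Polynomial.C (T (-8)) * P1.coordMap (toLaurent : ℂ[X] →+* ℂ[T;T⁻¹]) 1 1 (Polynomial.C (Hirz.dehom₀ σ)) := by
    simpa [P1.coordMap, Hirz.invX_dehom₁ hσ] using mul_comm _ _
  rw [hκ₁, hκ₁]
  change branchFunction σ * κ (P1.coordMap invX (tUnit ℂ (-(2 : ℕ))) 1 (X ^ 4)) =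
    κ (P1.coordMap invX (tUnit ℂ (-(2 : ℕ))) 1 (X ^ 4 + Polynomial.C (Hirz.dehom₁ σ)))
  rw [map_add, h₁, h₂, ← mul_add, ← map_add, map_mul, map_mul, ← h]
  ring

theorem hasDivisor_branchFunction {σ : MvPolynomial (Fin 2) ℂ} (hσ : σ.IsHomogeneous 8) :
    HasDivisor (branchFunction σ) (muPullbackE σ hσ)
      (muPullbackE 0 (MvPolynomial.isHomogeneous_zero _ _ _)) := by
  intro y
  obtain hy | hy := Hirz.exists_chart y
  · exact exists_affineOpens_of_mem_range hσ (Hirz.j₀_mu 2 4) (Hirz.j₀_proj 8)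
      (Hirz.ι₀_sectionE σ hσ) (by simpa [Hirz.dehom₀] using Hirz.ι₀_sectionE 0 _)
      (branchFunction_mul_ruledFunction σ) hy
  · exact exists_affineOpens_of_mem_range hσ (Hirz.j₁_mu 2 4) (Hirz.j₁_proj 8)
      (Hirz.ι₁_sectionE σ hσ) (by simpa [Hirz.dehom₁] using Hirz.ι₁_sectionE 0 _)
      (branchFunction_mul_chartToFunctionField_j₁ hσ) hy

end Divisor

theorem eval_smul_of_isHomogeneous {n : ℕ} {σ : MvPolynomial (Fin 2) ℂ} (hσ : σ.IsHomogeneous n)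
    (a : ℂ) (v : Fin 2 → ℂ) : MvPolynomial.eval (a • v) σ = a ^ n * MvPolynomial.eval v σ := by
  rw [MvPolynomial.eval_eq', MvPolynomial.eval_eq', Finset.mul_sum]
  refine Finset.sum_congr rfl fun d hd ↦ ?_
  have hn := hσ (MvPolynomial.mem_support_iff.mp hd)
  rw [Finsupp.weight_apply, Finsupp.sum_fintype _ _ (by simp)] at hn
  simp only [Pi.one_apply, smul_eq_mul, mul_one] at hn
  simp only [Pi.smul_apply, smul_eq_mul, mul_pow, Finset.prod_mul_distrib, Finset.prod_pow_eq_pow_sum,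
    hn]
  ring

theorem dehom₀_ne_zero {σ : MvPolynomial (Fin 2) ℂ} {n : ℕ} (hσ : σ.IsHomogeneous n)
    (hfin : {P : Projectivization ℂ (Fin 2 → ℂ) | MvPolynomial.eval P.rep σ = 0}.Finite) :
    Hirz.dehom₀ σ ≠ 0 := by
  intro h
  have hv (z : ℂ) : ![1, z] ≠ 0 := fun h ↦ one_ne_zero congr($h 0)
  refine Set.infinite_of_injective_forall_mem (f := fun z : ℂ ↦ Projectivization.mk ℂ ![1, z] (hv z))
    (fun y z hyz ↦ ?_) (fun z ↦ ?_) hfin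
  · obtain ⟨a, ha⟩ := (Projectivization.mk_eq_mk_iff' _ _ _ _ _).mp hyz
    have h₀ : a = 1 := by simpa using congr($ha 0)
    simpa [h₀] using congr($ha 1).symm
  · obtain ⟨a, ha⟩ := Projectivization.exists_smul_eq_mk_rep ℂ ![1, z] (hv z)
    have h₁ : MvPolynomial.eval ![1, z] σ = Polynomial.eval z (Hirz.dehom₀ σ) := by
      rw [Hirz.dehom₀, ← Polynomial.coe_evalRingHom, MvPolynomial.aeval_def, MvPolynomial.hom_eval₂]
      simp [MvPolynomial.eval₂_eq', MvPolynomial.eval_eq', Fin.prod_univ_two]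
    rw [Set.mem_ofPred, ← ha, Units.smul_def, eval_smul_of_isHomogeneous hσ, h₁, h]
    simp

end KummerK3

end

theorem mainTheorem3 (σ : MvPolynomial (Fin 2) ℂ) (hσ : σ.IsHomogeneous 8)
    (hzeros : {P : Projectivization ℂ (Fin 2 → ℂ) | MvPolynomial.eval P.rep σ = 0}.ncard = 8)
    (ζ : ℂ) (hζ : IsPrimitiveRoot ζ 4) :
    KummerK3.HasDivisor (KummerK3.branchFunction σ) (KummerK3.muPullbackE σ hσ)
        (KummerK3.muPullbackE 0 (MvPolynomial.isHomogeneous_zero _ _ _)) ∧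
      AlgebraicGeometry.Scheme.BirationalOver (KummerK3.surfaceY.str σ)
        (KummerK3.quotientCE.str σ ζ hζ.pow_eq_one) :=
  ⟨KummerK3.hasDivisor_branchFunction hσ, KummerK3.birationalOver_surfaceY_quotientCE σ
    (KummerK3.dehom₀_ne_zero hσ (Set.finite_of_ncard_ne_zero (by rw [hzeros]; norm_num))) hζ⟩
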